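/- Conventions. Alphabets are finite sets with at least two letters. A bi-infinite word over $\mathcal{A}$ is an element $x\in\mathcal{A}^{\mathbb{Z}}$ in which all letters of $\mathcal{A}$ appear. A morphism $\sigma:\mathcal{A}^*\to\mathcal{B}^*$ is a monoid homomorphism such that every letter of $\mathcal{B}$ appears in $\sigma(w)$ for some word $w\in\mathcal{A}^*$. It is non-erasing if $\sigma(a)\neq\varepsilon$ for all $a\in\mathcal{A}$; it then acts on bi-infinite words by $\sigma(\cdots x_{-1}.x_0x_1\cdots)=\cdots\sigma(x_{-1}).\sigma(x_0)\sigma(x_1)\cdots$. It is a bijective coding if the words $\sigma(a)$, $a\in\mathcal{A}$, are pairwise distinct and of length $1$. Interval exchanges. Let $\leq,\preceq$ be two total orders on $\mathcal{A}$ and let $(\lambda_a)_{a\in\mathcal{A}}$ be positive reals of sum $1$. Put $I_a=\big[\sum_{b<a}\lambda_b,\sum_{b\leq a}\lambda_b\big[$. The associated interval exchange transformation is the bijection $T:[0,1[\to[0,1[$ with $T(z)=z-\sum_{b<a}\lambda_b+\sum_{b\prec a}\lambda_b$ for $z\in I_a$. It is regular (a RIET over $\mathcal{A}$) if the two-sided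 orbits under $T$ of the non-zero numbers among $\sum_{b<a}\lambda_b$, $a\in\mathcal{A}$, are infinite and pairwise disjoint. The coding of $z\in[0,1[$ is the word $x\in\mathcal{A}^{\mathbb{Z}}$ such that, for all $n\in\mathbb{Z}$, $x_n=a$ if and only if $T^n(z)\in I_a$. A non-erasing morphism $\sigma:\mathcal{A}^*\to\mathcal{B}^*$ preserves the codings of RIETs if, for every coding $x$ of a point in a RIET over $\mathcal{A}$, the word $\sigma(x)$ is the coding of a point in a RIET over $\mathcal{B}$. Sturmian morphisms. The extension graph of a factor $w$ of a bi-infinite word $x$ is the bipartite graph whose vertex set is the disjoint union of $\{a: aw \text{ is a factor of } x\}$ and $\{b: wb\text{ is a factor of } x\}$, with an edge between $a$ on the left and $b$ on the right if and only if $awb$ is a factor of $x$. The word $x$ is dendric if the extension graph of each of its factors (including the empty word) is a tree. When $\operatorname{Card}\mathcal{A}=2$, a non-erasing morphism $\sigma:\mathcal{A}^*\to\mathcal{B}^*$ is called Sturmian if $\sigma(x)$ is dendric for every dendric bi-infinite word $x$ over $\mathcal{A}$. Theorem. A non-erasing morphism $\sigma:\mathcal{A}^*\to\mathcal{B}^*$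 preserves the codings of regular interval exchange transformations if and only if we are in one of the two following cases: 1. $\operatorname{Card}\mathcal{A}=2$ and $\sigma$ is a Sturmian morphism; 2. $\operatorname{Card}\mathcal{A}\geq 3$ and $\sigma$ is a bijective coding. -/

import Mathlib

namespace RIET

/-! ### Words, factors, extension graphs, dendric words -/

/-- The finite word `x_i x_{i+1} ⋯ x_{i+n-1}` read in the bi-infinite word `x`. -/
def window {A : Type*} (x : ℤ → A) (i : ℤ) (n : ℕ) : List A :=
  List.ofFn fun j : Fin n => x (i + ((j : ℕ) : ℤ))

/-- The language of a bi-infinite word: the set of its finite factors. -/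
def language {A : Type*} (x : ℤ → A) : Set (List A) :=
  {w | ∃ (i : ℤ) (n : ℕ), w = window x i n}

/-- Left extensions of `w` in `x`. -/
def leftExt {A : Type*} (x : ℤ → A) (w : List A) : Set A := {a | a :: w ∈ language x}

/-- Right extensions of `w` in `x`. -/
def rightExt {A : Type*} (x : ℤ → A) (w : List A) : Set A := {b | w ++ [b] ∈ language x}

/-- Bi-extensions of `w` in `x`. -/
def biExt {A : Type*} (x : ℤ → A) (w : List A) : Set (A × A) :=
  {p | p.1 :: (w ++ [p.2]) ∈ language x}

/-- The extension graph of `w` in `x`: the bipartite graph on the disjoint union of the left and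
of the right extensions of `w`, with an edge between `a` and `b` when `a w b` is a factor. -/
def extensionGraph {A : Type*} (x : ℤ → A) (w : List A) :
    SimpleGraph (leftExt x w ⊕ rightExt x w) :=
  SimpleGraph.fromRel fun u v =>
    ∃ (a : leftExt x w) (b : rightExt x w),
      u = Sum.inl a ∧ v = Sum.inr b ∧ ((a : A), (b : A)) ∈ biExt x w

/-- A bi-infinite word is dendric if the extension graphs of all its factors are trees. -/
def IsDendric {A : Type*} (x : ℤ → A) : Prop :=
  ∀ w ∈ language x, (extensionGraph x w).IsTree

/-! ### Morphisms -/

/-- A morphism is non-erasing if the image of every letter is non-empty. -/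
def NonErasing {A B : Type*} (σ : FreeMonoid A →* FreeMonoid B) : Prop :=
  ∀ a : A, σ (FreeMonoid.of a) ≠ 1

theorem NonErasing.length_le {A B : Type*} {σ : FreeMonoid A →* FreeMonoid B}
    (hσ : NonErasing σ) (w : List A) :
    w.length ≤ (FreeMonoid.toList (σ (FreeMonoid.ofList w))).length := by
  induction w with
  | nil => simp
  | cons a w ih =>
    have h1 : 1 ≤ (FreeMonoid.toList (σ (FreeMonoid.of a))).length := by
      rw [Nat.one_le_iff_ne_zero, Ne, List.length_eq_zero_iff]
      exact fun h => hσ a (FreeMonoid.toList.injective h)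
    rw [FreeMonoid.ofList_cons, map_mul, FreeMonoid.toList_mul, List.length_append,
      List.length_cons]
    omega

theorem NonErasing.lt_length {A B : Type*} {σ : FreeMonoid A →* FreeMonoid B}
    (hσ : NonErasing σ) (x : ℤ → A) (i : ℤ) (m : ℕ) :
    m < (FreeMonoid.toList (σ (FreeMonoid.ofList (window x i (m + 1))))).length :=
  lt_of_lt_of_le (by simp [window]) (hσ.length_le (window x i (m + 1)))

/-- The extension of a non-erasing morphism to bi-infinite words,
`σ(x) = ⋯ σ(x₋₂) σ(x₋₁) . σ(x₀) σ(x₁) ⋯`: the letter at position `m ≥ 0` is the letter at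
position `m` of `σ(x₀ ⋯ xₘ)`, and the letter at position `-(m+1)` is the letter at position `m`,
counted from the right end, of `σ(x₋₍ₘ₊₁₎ ⋯ x₋₁)`. -/
def biImage {A B : Type*} (σ : FreeMonoid A →* FreeMonoid B) (hσ : NonErasing σ) (x : ℤ → A) :
    ℤ → B
  | Int.ofNat m =>
      (FreeMonoid.toList (σ (FreeMonoid.ofList (window x 0 (m + 1)))))[m]'(hσ.lt_length x 0 m)
  | Int.negSucc m =>
      (FreeMonoid.toList
        (σ (FreeMonoid.ofList (window x (Int.negSucc m) (m + 1))))).reverse[m]'(by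
          rw [List.length_reverse]; exact hσ.lt_length x (Int.negSucc m) m)

/-- A bijective coding: the images of the letters are pairwise distinct words of length one. -/
def IsBijectiveCoding {A B : Type*} (σ : FreeMonoid A →* FreeMonoid B) : Prop :=
  (∀ a : A, (σ (FreeMonoid.of a)).length = 1) ∧
    Function.Injective fun a : A => σ (FreeMonoid.of a)

/-- A (non-erasing) morphism is dendric preserving if the image of every dendric bi-infinite word
in which all the letters of `A` appear is dendric. -/
def DendricPreserving {A B : Type*} (σ : FreeMonoid A →* FreeMonoid B) (hσ : NonErasing σ) :
    Prop :=
  ∀ x : ℤ → A, Function.Surjective x → IsDendric x → IsDendric (biImage σ hσ x)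

/-- Sturmian morphisms: the dendric preserving morphisms on a two-letter alphabet. -/
def IsSturmianMorphism {A B : Type*} [Fintype A] (σ : FreeMonoid A →* FreeMonoid B)
    (hσ : NonErasing σ) : Prop :=
  Fintype.card A = 2 ∧ DendricPreserving σ hσ

/-! ### Interval exchange transformations -/

/-- The data of an interval exchange: the orders `≤` (`ord`) and `≼` (`ord'`) on the alphabet and
the positive lengths of the intervals, of sum one. -/
structure IntervalExchange (A : Type*) [Fintype A] where
  ord : LinearOrder A
  ord' : LinearOrder A
  len : A → ℝ
  len_pos : ∀ a, 0 < len a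
  len_sum : ∑ a, len a = 1

/-- The left end `∑_{b < a} len b` of the interval of `a` when the intervals are arranged
according to the order `o`. -/
def leftEnd {A : Type*} [Fintype A] (o : LinearOrder A) (len : A → ℝ) (a : A) : ℝ :=
  ∑ b with b < a, len b

section Partition

theorem leftEnd_nonneg {A : Type*} [Fintype A] (o : LinearOrder A) {len : A → ℝ}
    (hpos : ∀ a, 0 < len a) (a : A) : 0 ≤ leftEnd o len a :=
  Finset.sum_nonneg fun b _ => (hpos b).le

theorem leftEnd_add {A : Type*} [Fintype A] (o : LinearOrder A) (len : A → ℝ) (a : A) :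
    leftEnd o len a + len a = ∑ b with b ≤ a, len b := by
  have h : (Finset.univ.filter fun b => b ≤ a) =
      insert a (Finset.univ.filter fun b => b < a) := by
    ext b; simp [le_iff_eq_or_lt]
  rw [h, Finset.sum_insert (by simp), leftEnd, add_comm]

theorem leftEnd_add_le_of_lt {A : Type*} [Fintype A] (o : LinearOrder A) {len : A → ℝ}
    (hpos : ∀ a, 0 < len a) {a b : A} (h : a < b) :
    leftEnd o len a + len a ≤ leftEnd o len b := by
  rw [leftEnd_add]
  refine Finset.sum_le_sum_of_subset_of_nonneg ?_ fun c _ _ => (hpos c).le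
  intro c hc
  simp only [Finset.mem_filter, Finset.mem_univ, true_and] at hc ⊢
  exact lt_of_le_of_lt hc h

theorem leftEnd_add_le_one {A : Type*} [Fintype A] (o : LinearOrder A) {len : A → ℝ}
    (hpos : ∀ a, 0 < len a) (hsum : ∑ a, len a = 1) (a : A) :
    leftEnd o len a + len a ≤ 1 := by
  rw [leftEnd_add, ← hsum]
  exact Finset.sum_le_sum_of_subset_of_nonneg (Finset.filter_subset _ _) fun c _ _ => (hpos c).le

/-- Every point of `[0, 1[` lies in one of the intervals. -/
theorem exists_mem_interval {A : Type*} [Fintype A] (o : LinearOrder A) {len : A → ℝ}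
    (hsum : ∑ a, len a = 1) {z : ℝ} (h0 : 0 ≤ z) (h1 : z < 1) :
    ∃ a, leftEnd o len a ≤ z ∧ z < leftEnd o len a + len a := by
  have hne : (Finset.univ : Finset A).Nonempty := by
    rw [Finset.nonempty_iff_ne_empty]
    intro h
    rw [h] at hsum
    simp at hsum
  have hS : (Finset.univ.filter fun a => leftEnd o len a ≤ z).Nonempty := by
    obtain ⟨m, -, hm⟩ := Finset.exists_min_image Finset.univ id hne
    have hm' : ∀ b, m ≤ b := fun b => hm b (Finset.mem_univ b)
    refine ⟨m, ?_⟩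
    have : leftEnd o len m = 0 := by
      rw [leftEnd, Finset.filter_false_of_mem fun b _ => not_lt.2 (hm' b)]
      simp
    simp [this, h0]
  obtain ⟨a, ha, hmax⟩ := Finset.exists_max_image _ id hS
  simp only [Finset.mem_filter, Finset.mem_univ, true_and, id] at ha hmax
  refine ⟨a, ha, ?_⟩
  by_contra hz
  rw [not_lt, leftEnd_add] at hz
  have hR : (Finset.univ.filter fun b => a < b).Nonempty := by
    by_contra hempty
    rw [Finset.not_nonempty_iff_eq_empty, Finset.filter_eq_empty_iff] at hempty
    rw [Finset.filter_true_of_mem fun b hb => not_lt.1 (hempty hb), hsum] at hz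
    linarith
  obtain ⟨b, hb, hmin⟩ := Finset.exists_min_image _ id hR
  simp only [Finset.mem_filter, Finset.mem_univ, true_and, id] at hb hmin
  have hEq : (Finset.univ.filter fun c => c < b) = Finset.univ.filter fun c => c ≤ a := by
    ext c
    simp only [Finset.mem_filter, Finset.mem_univ, true_and]
    refine ⟨fun hc => ?_, fun hc => lt_of_le_of_lt hc hb⟩
    by_contra hca
    exact absurd (hmin c (not_le.1 hca)) (not_le.2 hc)
  exact absurd (hmax b (by rw [leftEnd, hEq]; exact hz)) (not_le.2 hb)

/-- The point at distance `t` from the left end of the interval of `a`. -/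
def place {A : Type*} [Fintype A] (o : LinearOrder A) (len : A → ℝ)
    (hpos : ∀ a, 0 < len a) (hsum : ∑ a, len a = 1)
    (p : Σ a, Set.Ico (0 : ℝ) (len a)) : Set.Ico (0 : ℝ) 1 :=
  ⟨leftEnd o len p.1 + p.2.1,
    add_nonneg (leftEnd_nonneg o hpos p.1) p.2.2.1,
    lt_of_lt_of_le (by linarith [p.2.2.2]) (leftEnd_add_le_one o hpos hsum p.1)⟩

theorem place_bijective {A : Type*} [Fintype A] (o : LinearOrder A) (len : A → ℝ)
    (hpos : ∀ a, 0 < len a) (hsum : ∑ a, len a = 1) :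
    Function.Bijective (place o len hpos hsum) := by
  constructor
  · rintro ⟨a, s, hs0, hs⟩ ⟨b, t, ht0, ht⟩ h
    have h' : leftEnd o len a + s = leftEnd o len b + t := congrArg Subtype.val h
    rcases lt_trichotomy a b with hab | hab | hab
    · have := leftEnd_add_le_of_lt o hpos hab
      linarith
    · subst hab
      have : s = t := by linarith
      subst this
      rfl
    · have := leftEnd_add_le_of_lt o hpos hab
      linarith
  · rintro ⟨z, h0, h1⟩
    obtain ⟨a, ha, ha'⟩ := exists_mem_interval o hsum h0 h1
    exact ⟨⟨a, ⟨z - leftEnd o len a, by linarith, by linarith⟩⟩,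
      Subtype.ext (by simp [place])⟩

end Partition

namespace IntervalExchange

/-- The left end of `I_a`, that is `∑_{b < a} len b`, as a point of `[0, 1[`. -/
def leftPoint {A : Type*} [Fintype A] (D : IntervalExchange A) (a : A) : Set.Ico (0 : ℝ) 1 :=
  ⟨leftEnd D.ord D.len a, leftEnd_nonneg D.ord D.len_pos a,
    lt_of_lt_of_le (lt_add_of_pos_right _ (D.len_pos a))
      (leftEnd_add_le_one D.ord D.len_pos D.len_sum a)⟩

/-- The interval `I_a = [∑_{b < a} len b, ∑_{b ≤ a} len b[`. -/
def I {A : Type*} [Fintype A] (D : IntervalExchange A) (a : A) : Set (Set.Ico (0 : ℝ) 1) :=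
  {z | leftEnd D.ord D.len a ≤ z ∧ (z : ℝ) < leftEnd D.ord D.len a + D.len a}

/-- The interval exchange transformation: the bijection of `[0, 1[` that translates each `I_a`,
of left end `∑_{b < a} len b`, onto `J_a`, of left end `∑_{b ≺ a} len b` (see `T_apply`). -/
noncomputable def T {A : Type*} [Fintype A] (D : IntervalExchange A) :
    Equiv.Perm (Set.Ico (0 : ℝ) 1) :=
  (Equiv.ofBijective _ (place_bijective D.ord D.len D.len_pos D.len_sum)).symm.trans
    (Equiv.ofBijective _ (place_bijective D.ord' D.len D.len_pos D.len_sum))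

/-- The defining formula of the interval exchange transformation. -/
theorem T_apply {A : Type*} [Fintype A] (D : IntervalExchange A) {a : A}
    {z : Set.Ico (0 : ℝ) 1} (hz : z ∈ D.I a) :
    (D.T z : ℝ) = z - leftEnd D.ord D.len a + leftEnd D.ord' D.len a := by
  have h : (Equiv.ofBijective _ (place_bijective D.ord D.len D.len_pos D.len_sum)).symm z =
      ⟨a, ⟨z - leftEnd D.ord D.len a, by linarith [hz.1], by linarith [hz.2]⟩⟩ := by
    rw [Equiv.symm_apply_eq]
    exact Subtype.ext (by simp [place])
  rw [T, Equiv.trans_apply, h]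
  simp only [Equiv.ofBijective_apply, place]
  ring

/-- The (two-sided) orbit of a point under the interval exchange transformation. -/
def orbit {A : Type*} [Fintype A] (D : IntervalExchange A) (z : Set.Ico (0 : ℝ) 1) :
    Set (Set.Ico (0 : ℝ) 1) :=
  Set.range fun n : ℤ => (D.T ^ n) z

/-- Regularity: the orbits of the non-zero left ends `∑_{b < a} len b` are infinite and
pairwise disjoint. -/
def IsRegular {A : Type*} [Fintype A] (D : IntervalExchange A) : Prop :=
  (∀ a, (D.leftPoint a : ℝ) ≠ 0 → (D.orbit (D.leftPoint a)).Infinite) ∧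
    ∀ a b, a ≠ b → (D.leftPoint a : ℝ) ≠ 0 → (D.leftPoint b : ℝ) ≠ 0 →
      Disjoint (D.orbit (D.leftPoint a)) (D.orbit (D.leftPoint b))

/-- `x` is the natural coding of the point `z`. -/
def IsCodingOf {A : Type*} [Fintype A] (D : IntervalExchange A) (z : Set.Ico (0 : ℝ) 1)
    (x : ℤ → A) : Prop :=
  ∀ (n : ℤ) (a : A), x n = a ↔ (D.T ^ n) z ∈ D.I a

end IntervalExchange

/-- `x` is the natural coding of some point for some regular interval exchange transformation
on the alphabet `A`. -/
def IsRIETCoding {A : Type*} [Fintype A] (x : ℤ → A) : Prop :=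
  ∃ D : IntervalExchange A, D.IsRegular ∧ ∃ z, D.IsCodingOf z x

/-- A (non-erasing) morphism preserves the codings of regular interval exchange transformations
if it maps every such coding over `A` to such a coding over `B`. -/
def RIETPreserving {A B : Type*} [Fintype A] [Fintype B] (σ : FreeMonoid A →* FreeMonoid B)
    (hσ : NonErasing σ) : Prop :=
  ∀ x : ℤ → A, IsRIETCoding x → IsRIETCoding (biImage σ hσ x)

end RIET

/-!
The codings of regular interval exchanges (RIETs) have two properties that are easy to test on
words.

* They are *order compatible*: for every word `w`, the pairs `(a, b)` such that `a w b` is a factor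
  are monotone for the two orders of the exchange (`orderCompatible_of_isCodingOf`), because the
  transformation acts by translations along `w`. In particular no extension graph contains a cycle
  of length four (`OrderCompatible.not_square`).
* Over an alphabet `A` they have at least `(|A| - 1) n + 1` factors of length `n`
  (`IsRegular.le_ncard_language`), because the orbits are dense (`IsRegular.exists_mem_Ioo`) and the
  preimages of the discontinuities are pairwise distinct.

The test words are codings of irrational rotations of small angle, cut at the points `i / k` and at
`1 - θ`; the letters can be placed on the intervals in any order (`rotation`,
`exists_rotation_word`). Their factors of a given length are factors of finitely many eventually
constant words, so that their images have at most `(|A| - 1) n + O(1)` factors of length `n`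
(`ncard_imageLanguage_le`). Hence a morphism from `A` to `B` that preserves the codings satisfies
`|B| ≤ |A|` (`RIETPreserving.card_le`).

Suppose that `|A| ≥ 3` and that `σ` preserves the codings. Up to conjugation, which does not change
the factors of the images, the words `σ(a)` start with letters `f a` that are not all equal, and
around some word `Q` all the words `l s Q f r` occur as soon as `s r` occurs, where the letters
`l s` are not all equal either (`exists_conj_head`, `exists_conj_last`). The order condition,
applied to well-chosen placements of the letters on the rotation, forces `f` and `l` to be injective
(`injective_of_rotationPairs`), hence bijective since `|B| ≤ |A|`; it forces `Q` to be empty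
(`eq_nil_of_rotationPairs`), and excludes that a fixed word of length two occurs for all placements
(`not_forall_mem_of_rotationPairs`). So the images have length one.

Suppose that `|A| = 2`. Both conditions, preserving the codings and being Sturmian, are equivalent
to being a product of a bijection of the letters and of elementary substitutions `c ↦ c`, `d ↦ c d`
or `c ↦ c`, `d ↦ d c`. Indeed `|B| = 2`, the images of the two letters do not commute, and the
images of test words have no cycle of length four in their extension graphs; the test words are
codings of rotations in one case, and the dendric words `⋯ p p q p p ⋯` in the other. This allows an
elementary substitution to be factored out as long as the images are not single letters
(`NoSquareImages.isElementaryProduct`). Conversely, elementary substitutions preserve dendric words,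
since `L(v) c` has the same extension graph as `v`, the remaining factors having trivial ones
(`IsElementaryProduct.isDendric`). They preserve codings as well, since the codings of regular
exchanges of two intervals are the words read from the integer parts `⌊ρ + n θ⌋`, with `θ`
irrational, and an elementary substitution only changes `ρ` and `θ`
(`IsFloorCoding.of_elemLeft_self`, `IsFloorCoding.of_elemLeft_other`,
`IsElementaryProduct.isRIETCoding`). -/

/-! ### Factors of bi-infinite words -/

namespace RIET

section Words

variable {A B C : Type*}

@[simp] theorem window_length (x : ℤ → A) (i : ℤ) (n : ℕ) : (window x i n).length = n := by
  simp [window]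

theorem window_getElem (x : ℤ → A) (i : ℤ) (n j : ℕ) (h : j < (window x i n).length) :
    (window x i n)[j] = x (i + j) := by
  simp [window]

@[simp] theorem window_zero (x : ℤ → A) (i : ℤ) : window x i 0 = [] := by simp [window]

theorem window_eq_iff {x : ℤ → A} {y : ℤ → A} {i j : ℤ} {n : ℕ} :
    window x i n = window y j n ↔ ∀ k : ℕ, k < n → x (i + k) = y (j + k) := by
  constructor
  · intro h k hk
    have := window_getElem x i n k (by simpa)
    rw [← this, ← window_getElem y j n k (by simpa)]
    simp [h]
  · intro h
    refine List.ext_getElem (by simp) fun k h1 h2 => ?_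
    rw [window_getElem, window_getElem]
    exact h k (by simpa using h1)

theorem window_add (x : ℤ → A) (i : ℤ) (m n : ℕ) :
    window x i (m + n) = window x i m ++ window x (i + m) n := by
  refine List.ext_getElem (by simp) fun k h1 h2 => ?_
  rw [window_getElem, List.getElem_append]
  split
  · rw [window_getElem]
  · rename_i h
    simp only [window_length] at h
    rw [window_getElem]
    congr 1
    push_cast [window_length, Nat.cast_sub (not_lt.1 h)]
    ring

@[simp] theorem window_one (x : ℤ → A) (i : ℤ) : window x i 1 = [x i] := by
  simp [window]

theorem window_succ (x : ℤ → A) (i : ℤ) (n : ℕ) :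
    window x i (n + 1) = x i :: window x (i + 1) n := by
  rw [add_comm, window_add]; simp

theorem window_succ' (x : ℤ → A) (i : ℤ) (n : ℕ) :
    window x i (n + 1) = window x i n ++ [x (i + n)] := by
  rw [window_add]; simp

theorem window_mem_language (x : ℤ → A) (i : ℤ) (n : ℕ) : window x i n ∈ language x :=
  ⟨i, n, rfl⟩

theorem mem_language_iff {x : ℤ → A} {w : List A} :
    w ∈ language x ↔ ∃ i, window x i w.length = w := by
  constructor
  · rintro ⟨i, n, rfl⟩
    exact ⟨i, by simp⟩
  · rintro ⟨i, h⟩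
    exact ⟨i, _, h.symm⟩

theorem language_of_infix {x : ℤ → A} {v w : List A} (h : w <:+: v) (hv : v ∈ language x) :
    w ∈ language x := by
  obtain ⟨s, t, rfl⟩ := h
  obtain ⟨i, hi⟩ := mem_language_iff.1 hv
  rw [List.length_append, List.length_append, window_add, window_add] at hi
  have h1 := List.append_inj hi (by simp)
  have h2 := List.append_inj h1.1 (by simp)
  exact mem_language_iff.2 ⟨_, h2.2⟩

theorem exists_extension {x : ℤ → A} {w : List A} (hw : w ∈ language x) (m n : ℕ) :
    ∃ l r : List A, l.length = m ∧ r.length = n ∧ l ++ w ++ r ∈ language x := by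
  obtain ⟨i, hi⟩ := mem_language_iff.1 hw
  refine ⟨window x (i - m) m, window x (i + w.length) n, by simp, by simp, ?_⟩
  have : window x (i - m) (m + w.length + n) =
      window x (i - m) m ++ w ++ window x (i + w.length) n := by
    rw [window_add, window_add]
    congr 2
    · rw [← hi]; congr 1 <;> simp
    · push_cast; ring
  rw [← this]
  exact window_mem_language _ _ _

theorem exists_extension_right {x : ℤ → A} {w : List A} (hw : w ∈ language x) :
    ∃ b, w ++ [b] ∈ language x := by
  obtain ⟨l, r, hl, hr, h⟩ := exists_extension hw 0 1
  obtain ⟨b, rfl⟩ := List.length_eq_one_iff.1 hr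
  obtain rfl := List.length_eq_zero_iff.1 hl
  exact ⟨b, by simpa using h⟩

theorem exists_extension_left {x : ℤ → A} {w : List A} (hw : w ∈ language x) :
    ∃ a, a :: w ∈ language x := by
  obtain ⟨l, r, hl, hr, h⟩ := exists_extension hw 1 0
  obtain ⟨b, rfl⟩ := List.length_eq_one_iff.1 hl
  obtain rfl := List.length_eq_zero_iff.1 hr
  exact ⟨b, by simpa using h⟩

theorem biextension_mem_language {x : ℤ → A} {w : List A} {a b : A} :
    a :: (w ++ [b]) ∈ language x ↔
      ∃ i, x i = a ∧ window x (i + 1) w.length = w ∧ x (i + 1 + w.length) = b := by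
  rw [mem_language_iff]
  refine exists_congr fun i => ?_
  simp only [List.length_cons, List.length_append, List.length_nil, zero_add]
  rw [window_succ, window_succ', List.cons_eq_cons]
  refine and_congr_right fun _ => ⟨fun h => ?_, fun h => by rw [h.1, h.2]⟩
  have := List.append_inj' h rfl
  exact ⟨this.1, List.singleton_injective this.2⟩

theorem singleton_mem_language (x : ℤ → A) (i : ℤ) : [x i] ∈ language x :=
  ⟨i, 1, by simp⟩

/-! ### Images of bi-infinite words -/

/-- `y` is the image of the bi-infinite word `x` under the substitution `a ↦ u a`: the cut
sequence `s` gives the positions at which the images of the successive letters of `x` start. -/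
def IsImage (u : A → List B) (x : ℤ → A) (y : ℤ → B) : Prop :=
  ∃ s : ℤ → ℤ, s 0 = 0 ∧ (∀ n, s (n + 1) = s n + (u (x n)).length) ∧
    ∀ n, window y (s n) (u (x n)).length = u (x n)

/-- The factors of the words `u(v)`, for `v` a factor of `x`. -/
def imageLanguage (u : A → List B) (x : ℤ → A) : Set (List B) :=
  {w | ∃ v ∈ language x, w <:+: v.flatMap u}

/-- The images of the letters under a morphism of free monoids, as lists. -/
def letterImage (σ : FreeMonoid A →* FreeMonoid B) (a : A) : List B :=
  FreeMonoid.toList (σ (FreeMonoid.of a))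

theorem toList_map (σ : FreeMonoid A →* FreeMonoid B) (w : List A) :
    FreeMonoid.toList (σ (FreeMonoid.ofList w)) = w.flatMap (letterImage σ) := by
  induction w with
  | nil => simp
  | cons a w ih =>
    rw [FreeMonoid.ofList_cons, map_mul, FreeMonoid.toList_mul, ih]
    rfl

theorem NonErasing.letterImage_ne_nil {σ : FreeMonoid A →* FreeMonoid B} (hσ : NonErasing σ)
    (a : A) : letterImage σ a ≠ [] :=
  fun h => hσ a (FreeMonoid.toList.injective h)

theorem length_le_length_flatMap {u : A → List B} (hu : ∀ a, u a ≠ []) (w : List A) :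
    w.length ≤ (w.flatMap u).length := by
  induction w with
  | nil => simp
  | cons a w ih =>
    have := List.length_pos_iff.2 (hu a)
    simp only [List.flatMap_cons, List.length_cons, List.length_append]
    omega

/-- A cut sequence is compatible with the images of all the factors of `x`. -/
theorem cut_add {u : A → List B} {x : ℤ → A} {y : ℤ → B} {s : ℤ → ℤ}
    (hs : ∀ n, s (n + 1) = s n + (u (x n)).length)
    (hy : ∀ n, window y (s n) (u (x n)).length = u (x n)) (i : ℤ) (n : ℕ) :
    s (i + n) = s i + ((window x i n).flatMap u).length ∧
      window y (s i) ((window x i n).flatMap u).length = (window x i n).flatMap u := by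
  induction n with
  | zero => simp
  | succ n ih =>
    constructor
    · rw [window_succ', List.flatMap_append, List.length_append]
      push_cast
      rw [← add_assoc, hs, ih.1]
      simp [add_assoc]
    · rw [window_succ', List.flatMap_append, List.length_append, window_add, ih.2, ← ih.1]
      simp [hy]

theorem cut_strictMono {u : A → List B} (hu : ∀ a, u a ≠ []) {x : ℤ → A} {s : ℤ → ℤ}
    (hs : ∀ n, s (n + 1) = s n + (u (x n)).length) : StrictMono s := by
  refine strictMono_int_of_lt_succ fun n => ?_
  have := List.length_pos_iff.2 (hu (x n))
  rw [hs]
  omega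

theorem exists_cut_le_lt {s : ℤ → ℤ} (hs : StrictMono s) (m : ℤ) :
    ∃ n, s n ≤ m ∧ m < s (n + 1) := by
  have h1 : ∀ n : ℕ, s 0 + n ≤ s n := by
    intro n
    induction n with
    | zero => simp
    | succ n ih =>
      have := hs (show (n : ℤ) < n + 1 by omega)
      push_cast at *
      omega
  have h2 : ∀ n : ℕ, s (-n) ≤ s 0 - n := by
    intro n
    induction n with
    | zero => simp
    | succ n ih =>
      have := hs (show -((n : ℤ) + 1) < -n by omega)
      push_cast at *
      omega
  -- `s` grows at least as fast as the identity, so the `n` with `s n ≤ m` have a greatest element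
  obtain ⟨n, hn, hmax⟩ := Int.exists_greatest_of_bdd (P := fun n => s n ≤ m)
    ⟨(m - s 0).toNat, fun z hz => by
      by_contra hlt
      have h3 := h1 (m - s 0).toNat
      have h4 := hs (not_le.1 hlt)
      have h5 : m - s 0 ≤ ((m - s 0).toNat : ℤ) := Int.self_le_toNat _
      omega⟩
    ⟨-((s 0 - m).toNat : ℤ), by
      have h3 := h2 (s 0 - m).toNat
      have h5 : s 0 - m ≤ ((s 0 - m).toNat : ℤ) := Int.self_le_toNat _
      omega⟩
  refine ⟨n, hn, ?_⟩
  by_contra h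
  have := hmax (n + 1) (not_lt.1 h)
  omega

/-- The normalization `s 0 = 0` of the cut sequence determines the image. -/
theorem IsImage.unique {u : A → List B} (hu : ∀ a, u a ≠ []) {x : ℤ → A} {y z : ℤ → B}
    (hy : IsImage u x y) (hz : IsImage u x z) : y = z := by
  obtain ⟨s, hs0, hs, hsy⟩ := hy
  obtain ⟨t, ht0, ht, htz⟩ := hz
  have hst : ∀ n, s n = t n := by
    intro n
    induction n using Int.induction_on with
    | zero => rw [hs0, ht0]
    | succ n ih => rw [hs, ht, ih]
    | pred n ih =>
      have h1 := hs (-(n : ℤ) - 1)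
      have h2 := ht (-(n : ℤ) - 1)
      rw [sub_add_cancel] at h1 h2
      omega
  funext m
  obtain ⟨n, h1, h2⟩ := exists_cut_le_lt (cut_strictMono hu hs) m
  have h3 : window y (s n) (u (x n)).length = window z (s n) (u (x n)).length := by
    rw [hsy, hst, htz]
  have h4 := window_eq_iff.1 h3 (m - s n).toNat (by rw [hs] at h2; omega)
  rwa [show s n + ((m - s n).toNat : ℤ) = m by omega] at h4

/-- The image defined position by position is the one described by a cut sequence. -/
theorem biImage_isImage (σ : FreeMonoid A →* FreeMonoid B) (hσ : NonErasing σ) (x : ℤ → A) :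
    IsImage (letterImage σ) x (biImage σ hσ x) := by
  set u := letterImage σ with hu_def
  have hu : ∀ a, u a ≠ [] := hσ.letterImage_ne_nil
  set y := biImage σ hσ x with hy_def
  have hpos : ∀ m : ℕ, ∀ h, y m = ((window x 0 (m + 1)).flatMap u)[m]'h := by
    intro m h
    have : y m = (FreeMonoid.toList (σ (FreeMonoid.ofList (window x 0 (m + 1)))))[m]'(
      hσ.lt_length x 0 m) := rfl
    rw [this]
    simp only [toList_map]
    rfl
  have hneg : ∀ m : ℕ, ∀ h, y (Int.negSucc m) =
      ((window x (Int.negSucc m) (m + 1)).flatMap u).reverse[m]'h := by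
    intro m h
    have : y (Int.negSucc m) = (FreeMonoid.toList
      (σ (FreeMonoid.ofList (window x (Int.negSucc m) (m + 1))))).reverse[m]'(by
          rw [List.length_reverse]; exact hσ.lt_length x (Int.negSucc m) m) := rfl
    rw [this]
    simp only [toList_map]
    rfl
  -- the words read to the right and to the left of the origin do not depend on the number of
  -- letters of `x` used to compute them
  have hR : ∀ n : ℕ, window y 0 ((window x 0 n).flatMap u).length = (window x 0 n).flatMap u := by
    intro n
    refine List.ext_getElem (by simp) fun m h1 h2 => ?_
    rw [window_getElem, zero_add]
    have hl := length_le_length_flatMap hu (window x 0 (m + 1))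
    rw [window_length] at hl
    rw [hpos m (by omega)]
    rcases le_total n (m + 1) with h | h
    · obtain ⟨k, hk⟩ := Nat.exists_eq_add_of_le h
      simp only [hk, window_add x 0 n k, List.flatMap_append]
      rw [List.getElem_append_left h2]
    · obtain ⟨k, hk⟩ := Nat.exists_eq_add_of_le h
      simp only [hk, window_add x 0 (m + 1) k, List.flatMap_append]
      rw [List.getElem_append_left]
  have hL : ∀ n : ℕ, window y (-(((window x (-n) n).flatMap u).length : ℤ))
      ((window x (-n) n).flatMap u).length = (window x (-n) n).flatMap u := by
    intro n
    refine List.ext_getElem (by simp) fun j h1 h2 => ?_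
    rw [window_getElem]
    set N := ((window x (-n) n).flatMap u).length with hN
    obtain ⟨m, hm⟩ : ∃ m, N = j + m + 1 := ⟨N - j - 1, by omega⟩
    have hidx : -(N : ℤ) + j = Int.negSucc m := by rw [Int.negSucc_eq]; omega
    have hl := length_le_length_flatMap hu (window x (Int.negSucc m) (m + 1))
    rw [window_length] at hl
    rw [hidx, hneg m (by rw [List.length_reverse]; omega)]
    have h3 : ((window x (-n) n).flatMap u)[j] = ((window x (-n) n).flatMap u).reverse[m]'(by
        rw [List.length_reverse]; omega) := by
      rw [List.getElem_reverse]
      congr 1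
      omega
    rw [h3]
    rcases le_total n (m + 1) with h | h
    · obtain ⟨k, hk⟩ := Nat.exists_eq_add_of_le' h
      have h5 : window x (Int.negSucc m) (m + 1) =
          window x (Int.negSucc m) k ++ window x (-n) n := by
        rw [hk, window_add]
        congr 2
        rw [Int.negSucc_eq]; omega
      simp only [h5, List.flatMap_append, List.reverse_append]
      rw [List.getElem_append_left]
    · obtain ⟨k, hk⟩ := Nat.exists_eq_add_of_le' h
      have h5 : window x (-n) n =
          window x (-n) k ++ window x (Int.negSucc m) (m + 1) := by
        conv_lhs => rw [hk, window_add]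
        rw [hk]
        congr 2
        rw [Int.negSucc_eq]; push_cast; ring
      simp only [h5, List.flatMap_append, List.reverse_append]
      rw [List.getElem_append_left]
  refine ⟨fun n => ((window x 0 n.toNat).flatMap u).length -
    ((window x n (-n).toNat).flatMap u).length, by simp, fun n => ?_, fun n => ?_⟩ <;> beta_reduce
  · rcases le_or_gt 0 n with h | h
    · lift n to ℕ using h
      rw [show ((n : ℤ) + 1).toNat = n + 1 by omega, window_succ', List.flatMap_append,
        show (-((n : ℤ) + 1)).toNat = 0 by omega, show (-(n : ℤ)).toNat = 0 by omega]
      simp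
    · obtain ⟨m, rfl⟩ := Int.eq_negSucc_of_lt_zero h
      rw [show (Int.negSucc m).toNat = 0 by omega, show (Int.negSucc m + 1).toNat = 0 by omega,
        show (-Int.negSucc m).toNat = m + 1 by omega,
        show (-(Int.negSucc m + 1)).toNat = m by omega,
        window_succ, List.flatMap_cons, List.length_append]
      push_cast
      ring
  · rcases le_or_gt 0 n with h | h
    · lift n to ℕ using h
      have h1 := hR (n + 1)
      rw [window_succ', List.flatMap_append, List.length_append, window_add, hR n] at h1
      have h2 := List.append_cancel_left h1
      simpa using h2
    · obtain ⟨m, rfl⟩ := Int.eq_negSucc_of_lt_zero h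
      have h1 := hL (m + 1)
      rw [show (-((m + 1 : ℕ) : ℤ)) = Int.negSucc m by rw [Int.negSucc_eq]; push_cast; ring] at h1
      conv at h1 =>
        lhs
        arg 3
        rw [window_succ, List.flatMap_cons, List.length_append]
      rw [window_add] at h1
      conv at h1 =>
        rhs
        rw [window_succ, List.flatMap_cons]
      have h3 := (List.append_inj h1 (by simp)).1
      rw [show (-Int.negSucc m).toNat = m + 1 by omega, show (Int.negSucc m).toNat = 0 by omega]
      simpa using h3

/-- A factor of an image starts inside the image of some letter and is covered by the images of
the letters that follow. -/
theorem IsImage.exists_cover {u : A → List B} (hu : ∀ a, u a ≠ []) {x : ℤ → A} {y : ℤ → B}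
    (h : IsImage u x y) {w : List B} (hw : w ∈ language y) :
    ∃ (p : ℤ) (k : ℕ), k < (u (x p)).length ∧
      w <+: ((window x p (w.length + 1)).flatMap u).drop k := by
  obtain ⟨s, -, hs, hy⟩ := h
  obtain ⟨i, hi⟩ := mem_language_iff.1 hw
  obtain ⟨n, h1, h2⟩ := exists_cut_le_lt (cut_strictMono hu hs) i
  obtain ⟨k, hk⟩ := Int.eq_ofNat_of_zero_le (show 0 ≤ i - s n by omega)
  rw [hs] at h2
  refine ⟨n, k, by omega, ?_⟩
  have h3 := cut_add hs hy n (w.length + 1)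
  have h4 := length_le_length_flatMap hu (window x (n + 1) w.length)
  rw [window_length] at h4
  obtain ⟨m, hm⟩ : ∃ m, ((window x n (w.length + 1)).flatMap u).length = k + w.length + m := by
    refine ⟨((window x n (w.length + 1)).flatMap u).length - (k + w.length), ?_⟩
    rw [window_succ, List.flatMap_cons, List.length_append]
    omega
  rw [← h3.2, hm, window_add, window_add, show s n + (k : ℤ) = i by omega, hi, List.append_assoc,
    List.drop_left' (by simp)]
  exact List.prefix_append _ _

theorem IsImage.language_eq {u : A → List B} (hu : ∀ a, u a ≠ []) {x : ℤ → A} {y : ℤ → B}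
    (h : IsImage u x y) : language y = imageLanguage u x := by
  ext w
  constructor
  · intro hw
    obtain ⟨p, k, -, hk⟩ := h.exists_cover hu hw
    exact ⟨_, window_mem_language _ _ _, hk.isInfix.trans (List.drop_suffix _ _).isInfix⟩
  · rintro ⟨v, hv, hw⟩
    obtain ⟨s, -, hs, hy⟩ := h
    obtain ⟨i, hi⟩ := mem_language_iff.1 hv
    refine language_of_infix hw ?_
    have h3 := (cut_add hs hy i v.length).2
    rw [hi] at h3
    exact ⟨_, _, h3.symm⟩

theorem language_biImage (σ : FreeMonoid A →* FreeMonoid B) (hσ : NonErasing σ) (x : ℤ → A) :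
    language (biImage σ hσ x) = imageLanguage (letterImage σ) x :=
  (biImage_isImage σ hσ x).language_eq hσ.letterImage_ne_nil

theorem letterImage_lift (u : A → List B) :
    letterImage (FreeMonoid.lift fun a => FreeMonoid.ofList (u a)) = u := by
  funext a
  simp [letterImage]

theorem nonErasing_lift {u : A → List B} (hu : ∀ a, u a ≠ []) :
    NonErasing (FreeMonoid.lift fun a => FreeMonoid.ofList (u a)) := fun a h =>
  hu a (by rw [← congrFun (letterImage_lift u) a, letterImage, h]; rfl)

theorem exists_isImage {u : A → List B} (hu : ∀ a, u a ≠ []) (x : ℤ → A) : ∃ y, IsImage u x y := by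
  have := biImage_isImage _ (nonErasing_lift hu) x
  rw [letterImage_lift] at this
  exact ⟨_, this⟩

theorem IsImage.comp {u : A → List B} {v : B → List C} {x : ℤ → A} {y : ℤ → B} {z : ℤ → C}
    (h : IsImage u x y) (h' : IsImage v y z) : IsImage (fun a => (u a).flatMap v) x z := by
  obtain ⟨s, hs0, hs, hy⟩ := h
  obtain ⟨t, ht0, ht, hz⟩ := h'
  refine ⟨fun n => t (s n), by simp [hs0, ht0], fun n => ?_, fun n => ?_⟩ <;> beta_reduce
  · have := (cut_add ht hz (s n) (u (x n)).length).1
    rw [hy] at this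
    rw [hs, this]
  · have := (cut_add ht hz (s n) (u (x n)).length).2
    rwa [hy] at this

/-- Conjugating a substitution by a word `P` shifts the images. -/
theorem IsImage.conj {u v : A → List B} {P : List B} (h : ∀ a, P ++ v a = u a ++ P)
    (hu : ∀ a, u a ≠ []) {x : ℤ → A} {y : ℤ → B} (hy : IsImage u x y) :
    IsImage v x fun n => y (n + P.length) := by
  have hlen : ∀ a, (v a).length = (u a).length := fun a => by
    have := congrArg List.length (h a)
    simp only [List.length_append] at this
    omega
  have hconj : ∀ w : List A, P ++ w.flatMap v = w.flatMap u ++ P := by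
    intro w
    induction w with
    | nil => simp
    | cons a w ih => simp only [List.flatMap_cons, ← List.append_assoc, h]; simp [ih]
  obtain ⟨s, hs0, hs, hy⟩ := hy
  refine ⟨s, hs0, fun n => by rw [hs, hlen], fun n => ?_⟩
  -- the images of the letters that follow position `n` start with `P`
  obtain ⟨N, hN⟩ : ∃ N : ℕ, P.length = N := ⟨_, rfl⟩
  have h1 := (cut_add hs hy n (N + 1)).2
  have h2 := length_le_length_flatMap hu (window x (n + 1) N)
  rw [window_length] at h2
  have h3 : P <+: (window x (n + 1) N).flatMap u := by
    refine List.prefix_of_prefix_length_le (l₃ := (window x (n + 1) N).flatMap u ++ P) ?_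
      (List.prefix_append _ _) (by omega)
    rw [← hconj]
    exact List.prefix_append _ _
  obtain ⟨Q, hQ⟩ := h3
  rw [window_succ, List.flatMap_cons, ← hQ, ← List.append_assoc, ← h] at h1
  rw [List.length_append, List.length_append, window_add, window_add] at h1
  have h4 := (List.append_inj (List.append_inj h1 (by simp)).1 (by simp)).2
  refine Eq.trans (window_eq_iff.2 fun k _ => ?_) h4
  congr 1
  ring

/-- Conjugate substitutions produce the same factors: `P` is a prefix of the long images under `u`
and a suffix of the long images under `v`, so that the words `P ++ v(t) = u(t) ++ P` are factors of
images of both kinds. -/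
theorem imageLanguage_conj {u v : A → List B} {P : List B} (h : ∀ a, P ++ v a = u a ++ P)
    (hu : ∀ a, u a ≠ []) (x : ℤ → A) : imageLanguage v x = imageLanguage u x := by
  have hlen : ∀ w : List A, (w.flatMap v).length = (w.flatMap u).length := fun w => by
    induction w with
    | nil => rfl
    | cons a w ih =>
      have := congrArg List.length (h a)
      simp only [List.length_append, List.flatMap_cons] at *
      omega
  have hconj : ∀ w : List A, P ++ w.flatMap v = w.flatMap u ++ P := by
    intro w
    induction w with
    | nil => simp
    | cons a w ih => simp only [List.flatMap_cons, ← List.append_assoc, h]; simp [ih]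
  ext w
  constructor
  · rintro ⟨t, ht, hw⟩
    -- `v(t)` is a suffix of `P ++ v(t) = u(t) ++ P`, itself a prefix of `u(t r)` for long `r`
    obtain ⟨l, r, hl, hr, hx⟩ := exists_extension ht 0 P.length
    obtain rfl := List.length_eq_zero_iff.1 hl
    rw [List.nil_append] at hx
    refine ⟨_, hx, hw.trans ?_⟩
    have h1 := length_le_length_flatMap hu r
    have h2 : P ++ t.flatMap v <+: (t ++ r).flatMap u := by
      refine List.prefix_of_prefix_length_le (l₃ := (t ++ r).flatMap u ++ P) ?_
        (List.prefix_append _ _) (by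
          have := hlen t
          simp only [List.length_append, List.flatMap_append]; omega)
      rw [← hconj, List.flatMap_append, ← List.append_assoc]
      exact List.prefix_append _ _
    exact (List.suffix_append _ _).isInfix.trans h2.isInfix
  · rintro ⟨t, ht, hw⟩
    obtain ⟨l, r, hl, hr, hx⟩ := exists_extension ht P.length 0
    obtain rfl := List.length_eq_zero_iff.1 hr
    rw [List.append_nil] at hx
    refine ⟨_, hx, hw.trans ?_⟩
    have h1 := length_le_length_flatMap hu l
    have h2 : t.flatMap u ++ P <:+ (l ++ t).flatMap v := by
      refine List.suffix_of_suffix_length_le (l₃ := P ++ (l ++ t).flatMap v) ?_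
        (List.suffix_append _ _) (by
          have := hlen t
          have := hlen l
          simp only [List.length_append, List.flatMap_append]; omega)
      rw [hconj, List.flatMap_append, List.append_assoc]
      exact List.suffix_append _ _
    exact (List.prefix_append _ _).isInfix.trans h2.isInfix

theorem imageLanguage_of_infix {u : A → List B} {x : ℤ → A} {v w : List B} (h : w <:+: v)
    (hv : v ∈ imageLanguage u x) : w ∈ imageLanguage u x := by
  obtain ⟨t, ht, hvt⟩ := hv
  exact ⟨t, ht, h.trans hvt⟩

end Words

end RIET

/-! ### Interval exchange transformations: local behaviour -/

namespace RIET

/-- A language is compatible with the orders `L` and `R` when, for every word `w`, the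
bi-extensions `a w b` are monotone: a larger left extension (for `L`) forces a larger or equal
right extension (for `R`). -/
def OrderCompatible {A : Type*} (𝓛 : Set (List A)) (L R : LinearOrder A) : Prop :=
  ∀ (w : List A) (a a' b b' : A), a :: (w ++ [b]) ∈ 𝓛 → a' :: (w ++ [b']) ∈ 𝓛 →
    L.lt a a' → R.le b b'

namespace IntervalExchange

variable {A : Type*} [Fintype A] (D : IntervalExchange A)

theorem exists_mem_I (z : Set.Ico (0 : ℝ) 1) : ∃ a, z ∈ D.I a :=
  exists_mem_interval D.ord D.len_sum z.2.1 z.2.2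

theorem le_of_mem_I {a b : A} {z z' : Set.Ico (0 : ℝ) 1} (hz : z ∈ D.I a) (hz' : z' ∈ D.I b)
    (h : z ≤ z') : D.ord.le a b := by
  by_contra hab
  have hlt : D.ord.lt b a := by
    let _ := D.ord
    exact not_le.1 hab
  have h1 := leftEnd_add_le_of_lt D.ord D.len_pos hlt
  have h2 : (z : ℝ) ≤ z' := h
  linarith [hz.1, hz'.2]

theorem eq_of_mem_I {a b : A} {z : Set.Ico (0 : ℝ) 1} (hz : z ∈ D.I a) (hz' : z ∈ D.I b) :
    a = b :=
  D.ord.le_antisymm _ _ (D.le_of_mem_I hz hz' le_rfl) (D.le_of_mem_I hz' hz le_rfl)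

theorem leftPoint_mem_I (a : A) : D.leftPoint a ∈ D.I a :=
  ⟨le_rfl, lt_add_of_pos_right _ (D.len_pos a)⟩

theorem leftPoint_injective : Function.Injective D.leftPoint := fun a b h =>
  D.eq_of_mem_I (D.leftPoint_mem_I a) (h ▸ D.leftPoint_mem_I b)

theorem coe_leftPoint (a : A) : (D.leftPoint a : ℝ) = leftEnd D.ord D.len a := rfl

/-- The interval exchange with the two orders swapped. -/
def swap : IntervalExchange A := ⟨D.ord', D.ord, D.len, D.len_pos, D.len_sum⟩

/-- Swapping the two orders inverts the transformation. -/
theorem swap_T : D.swap.T = D.T⁻¹ := rfl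

theorem T_mem_swap_I {a : A} {z : Set.Ico (0 : ℝ) 1} (hz : z ∈ D.I a) : D.T z ∈ D.swap.I a := by
  have h := D.T_apply hz
  constructor
  · change leftEnd D.ord' D.len a ≤ _
    linarith [hz.1]
  · change _ < leftEnd D.ord' D.len a + D.len a
    linarith [hz.2]

theorem T_leftPoint (a : A) : D.T (D.leftPoint a) = D.swap.leftPoint a := by
  refine Subtype.ext ?_
  rw [D.T_apply (D.leftPoint_mem_I a), coe_leftPoint]
  change _ = leftEnd D.ord' D.len a
  ring

theorem T_sub_of_mem_I {a : A} {z z' : Set.Ico (0 : ℝ) 1} (hz : z ∈ D.I a) (hz' : z' ∈ D.I a) :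
    (D.T z' : ℝ) - D.T z = z' - z := by
  rw [D.T_apply hz, D.T_apply hz']; ring

/-- The discontinuity candidates of an interval exchange: the non-zero left ends. -/
def marks : Set (Set.Ico (0 : ℝ) 1) := {m | (m : ℝ) ≠ 0 ∧ ∃ a, D.leftPoint a = m}

theorem marks_finite : D.marks.Finite :=
  (Set.finite_range D.leftPoint).subset fun _ h => h.2

theorem eq_leftPoint_or_exists_lt {z : Set.Ico (0 : ℝ) 1} {a : A} (h : z ∈ D.I a) :
    D.leftPoint a = z ∨ leftEnd D.ord D.len a < z := by
  rcases h.1.eq_or_lt with h1 | h1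
  · exact Or.inl (Subtype.ext h1)
  · exact Or.inr h1

theorem mem_I_of_no_mark {z z' : Set.Ico (0 : ℝ) 1} (hzz : z ≤ z')
    (h : ∀ m ∈ D.marks, ¬ (z < m ∧ m ≤ z')) {a : A} (ha : z' ∈ D.I a) : z ∈ D.I a := by
  have hle : (z : ℝ) ≤ z' := hzz
  refine ⟨?_, by linarith [ha.2]⟩
  by_contra hlt
  rw [not_le] at hlt
  refine h (D.leftPoint a) ⟨?_, a, rfl⟩ ⟨hlt, ha.1⟩
  rw [coe_leftPoint]
  linarith [z.2.1]

theorem T_sub {z z' : Set.Ico (0 : ℝ) 1} (hzz : z ≤ z')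
    (h : ∀ m ∈ D.marks, ¬ (z < m ∧ m ≤ z')) : (D.T z' : ℝ) - D.T z = z' - z := by
  obtain ⟨a, ha⟩ := D.exists_mem_I z'
  exact D.T_sub_of_mem_I (D.mem_I_of_no_mark hzz h ha) ha

/-- `T ^ n` is a translation on the intervals that contain no preimage of a mark by
`T ^ i`, `i < n`. -/
theorem T_pow_sub (n : ℕ) {z z' : Set.Ico (0 : ℝ) 1} (hzz : z ≤ z')
    (h : ∀ i < n, ∀ c, (D.T ^ i) c ∈ D.marks → ¬ (z < c ∧ c ≤ z')) :
    ((D.T ^ n) z' : ℝ) - (D.T ^ n) z = z' - z := by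
  induction n generalizing z' with
  | zero => simp
  | succ n ih =>
    have ih' : ∀ v : Set.Ico (0 : ℝ) 1, z ≤ v → v ≤ z' →
        ((D.T ^ n) v : ℝ) - (D.T ^ n) z = v - z := fun v hv hv' =>
      ih hv fun i hi c hc hcv => h i (by omega) c hc ⟨hcv.1, hcv.2.trans hv'⟩
    have h0 := ih' z' hzz le_rfl
    have hle : (z : ℝ) ≤ z' := hzz
    rw [pow_succ', Equiv.Perm.mul_apply, Equiv.Perm.mul_apply, D.T_sub, h0]
    · change ((D.T ^ n) z : ℝ) ≤ (D.T ^ n) z'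
      linarith
    · rintro m hm ⟨h1, h2⟩
      have h1' : ((D.T ^ n) z : ℝ) < m := h1
      have h2' : (m : ℝ) ≤ (D.T ^ n) z' := h2
      -- the point at the same distance of `z` as `m` is of `T ^ n z`
      let v : Set.Ico (0 : ℝ) 1 := ⟨z + (m - (D.T ^ n) z), by linarith [z.2.1],
        by linarith [z'.2.2]⟩
      have hv1 : z < v := by
        change (z : ℝ) < z + (m - (D.T ^ n) z)
        linarith
      have hv2 : v ≤ z' := by
        change (z : ℝ) + (m - (D.T ^ n) z) ≤ z'
        linarith
      have hv : (D.T ^ n) v = m := by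
        refine Subtype.ext ?_
        have := ih' v hv1.le hv2
        have h3 : (v : ℝ) = z + (m - (D.T ^ n) z) := rfl
        linarith
      exact h n (by omega) v (hv ▸ hm) ⟨hv1, hv2⟩

theorem coding_shift {z : Set.Ico (0 : ℝ) 1} {x : ℤ → A} (h : D.IsCodingOf z x) (k : ℤ) :
    D.IsCodingOf ((D.T ^ k) z) fun n => x (n + k) := fun n a => by
  rw [h, zpow_add, Equiv.Perm.mul_apply]

theorem IsCodingOf.mem_I {D : IntervalExchange A} {z : Set.Ico (0 : ℝ) 1} {x : ℤ → A}
    (h : D.IsCodingOf z x) (n : ℤ) : (D.T ^ n) z ∈ D.I (x n) :=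
  (h n _).1 rfl

theorem zpow_add_one_apply (n : ℤ) (z : Set.Ico (0 : ℝ) 1) :
    (D.T ^ (n + 1)) z = D.T ((D.T ^ n) z) := by
  rw [add_comm, zpow_add, Equiv.Perm.mul_apply, zpow_one]

/-- The codings of an interval exchange are compatible with its two orders. The letter before an
occurrence of `w` determines, through the second order, the relative position of the points at which
`w` starts; these points then undergo the same translations along `w`, and the first order reads
the letter that follows. -/
theorem orderCompatible_of_isCodingOf {z : Set.Ico (0 : ℝ) 1} {x : ℤ → A}
    (h : D.IsCodingOf z x) : OrderCompatible (language x) D.ord' D.ord := by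
  intro w a a' b b' h1 h2 hlt
  obtain ⟨i, hia, hiw, hib⟩ := biextension_mem_language.1 h1
  obtain ⟨j, hja, hjw, hjb⟩ := biextension_mem_language.1 h2
  have key : ∀ k : ℕ, k ≤ w.length →
      (((D.T ^ (i + 1 + k)) z : Set.Ico (0 : ℝ) 1) : ℝ) < (D.T ^ (j + 1 + k)) z := by
    intro k
    induction k with
    | zero =>
      intro _
      have hi := D.T_mem_swap_I (h.mem_I i)
      have hj := D.T_mem_swap_I (h.mem_I j)
      rw [← zpow_add_one_apply, hia] at hi
      rw [← zpow_add_one_apply, hja] at hj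
      have h3 : leftEnd D.ord' D.len a + D.len a ≤ leftEnd D.ord' D.len a' :=
        leftEnd_add_le_of_lt D.ord' D.len_pos hlt
      have h4 : _ < leftEnd D.ord' D.len a + D.len a := hi.2
      have h5 : leftEnd D.ord' D.len a' ≤ _ := hj.1
      simp only [Nat.cast_zero, add_zero]
      linarith
    | succ k ih =>
      intro hk
      have hik := h.mem_I (i + 1 + k)
      have hjk := h.mem_I (j + 1 + k)
      have h3 : x (i + 1 + k) = x (j + 1 + k) :=
        window_eq_iff.1 (hiw.trans hjw.symm) k (by omega)
      rw [← h3] at hjk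
      have h4 := D.T_sub_of_mem_I hik hjk
      have h5 := ih (by omega)
      push_cast
      rw [← add_assoc, ← add_assoc, zpow_add_one_apply, zpow_add_one_apply]
      linarith
  have hi := h.mem_I (i + 1 + w.length)
  have hj := h.mem_I (j + 1 + w.length)
  rw [hib] at hi
  rw [hjb] at hj
  exact D.le_of_mem_I hi hj (key _ le_rfl).le

/-! ### Regular interval exchange transformations are minimal -/

section Regular

variable {D}

/-- In a regular interval exchange, two marks never lie on the same orbit, and no mark is
periodic. -/
theorem IsRegular.eq_of_zpow (hD : D.IsRegular) {m m' : Set.Ico (0 : ℝ) 1} (hm : m ∈ D.marks)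
    (hm' : m' ∈ D.marks) {n : ℤ} (h : (D.T ^ n) m = m') : n = 0 := by
  obtain ⟨h0, a, rfl⟩ := hm
  obtain ⟨h0', b, rfl⟩ := hm'
  by_cases hab : a = b
  · subst hab
    by_contra hn
    refine hD.1 a h0 (((Set.finite_Ico (0 : ℤ) |n|).image
      fun k => (D.T ^ k) (D.leftPoint a)).subset ?_)
    rintro _ ⟨k, rfl⟩
    refine ⟨k % n, ⟨Int.emod_nonneg _ hn, Int.emod_lt_abs _ hn⟩, ?_⟩
    have h1 : (D.T ^ (n * (k / n))) (D.leftPoint a) = D.leftPoint a := by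
      rw [zpow_mul]
      exact Equiv.Perm.zpow_apply_eq_self_of_apply_eq_self h _
    change _ = (D.T ^ k) _
    conv_rhs => rw [← Int.emod_add_mul_ediv k n, zpow_add, Equiv.Perm.mul_apply, h1]
  · exact absurd ⟨n, h⟩ (Set.disjoint_right.1 (hD.2 a b hab h0 h0') ⟨0, by simp⟩)

variable (D) in
/-- The second interval starts where the first one, that of `a`, ends. -/
theorem exists_leftEnd_eq_len [Nontrivial A] {a : A} (h : leftEnd D.ord D.len a = 0) :
    ∃ c, c ≠ a ∧ leftEnd D.ord D.len c = D.len a := by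
  have hmin : ∀ c, c ≠ a → D.len a ≤ leftEnd D.ord D.len c := by
    intro c hc
    rcases @lt_or_gt_of_ne _ D.ord _ _ hc with hlt | hlt
    · have := leftEnd_add_le_of_lt D.ord D.len_pos hlt
      linarith [leftEnd_nonneg D.ord D.len_pos c, D.len_pos c]
    · have := leftEnd_add_le_of_lt D.ord D.len_pos hlt
      linarith
  obtain ⟨c, hc⟩ := exists_ne a
  obtain ⟨b, hb⟩ := D.exists_mem_I ⟨D.len a, (D.len_pos a).le, by
    linarith [hmin c hc, leftEnd_add_le_one D.ord D.len_pos D.len_sum c, D.len_pos c]⟩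
  have hba : b ≠ a := by
    rintro rfl
    have := hb.2
    simp only [h] at this
    linarith
  exact ⟨b, hba, le_antisymm hb.1 (hmin b hba)⟩

/-- In a regular interval exchange the origin is the image of a mark. -/
theorem IsRegular.exists_mark_T_eq_zero [Nontrivial A] (hD : D.IsRegular) :
    ∃ m ∈ D.marks, (D.T m : ℝ) = 0 := by
  obtain ⟨b, hb⟩ := D.swap.exists_mem_I ⟨0, le_rfl, one_pos⟩
  have hb0 : leftEnd D.swap.ord D.swap.len b = 0 :=
    le_antisymm hb.1 (leftEnd_nonneg _ D.len_pos b)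
  refine ⟨D.leftPoint b, ⟨fun h => ?_, b, rfl⟩, ?_⟩
  · -- otherwise both orders start with `b`, and the second letters produce a connection
    obtain ⟨c, hc, hc1⟩ := D.exists_leftEnd_eq_len h
    obtain ⟨c', hc', hc1'⟩ := D.swap.exists_leftEnd_eq_len hb0
    have hT : (D.T ^ (1 : ℤ)) (D.leftPoint c') = D.leftPoint c := by
      rw [zpow_one, T_leftPoint]
      exact Subtype.ext (hc1'.trans hc1.symm)
    refine one_ne_zero (hD.eq_of_zpow ⟨fun h' => hc' ?_, c', rfl⟩ ⟨?_, c, rfl⟩ hT)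
    · exact D.leftPoint_injective (Subtype.ext (h'.trans h.symm))
    · rw [coe_leftPoint, hc1]
      exact (D.len_pos b).ne'
  · rw [T_leftPoint]
    exact hb0

/-- A regular interval exchange on at least two letters has no periodic point. -/
theorem IsRegular.pow_apply_ne [Nontrivial A] (hD : D.IsRegular) {n : ℕ} (hn : n ≠ 0)
    (p : Set.Ico (0 : ℝ) 1) : (D.T ^ n) p ≠ p := by
  intro hp
  -- the points at which `T ^ n` may fail to be a translation
  set cuts : Set (Set.Ico (0 : ℝ) 1) := ⋃ i ∈ {i : ℕ | i < n}, (D.T ^ i) ⁻¹' D.marks with hcuts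
  have hfin : cuts.Finite := (Set.finite_lt_nat n).biUnion fun i _ =>
    D.marks_finite.preimage (D.T ^ i).injective.injOn
  -- the last cut point to the left of `p` is periodic as well
  obtain ⟨q, ⟨hq, hqp⟩, hmax⟩ := Set.exists_max_image
    ({c | c ∈ insert ⟨0, le_rfl, one_pos⟩ cuts ∧ c ≤ p}) id
    ((hfin.insert _).subset fun c hc => hc.1) ⟨⟨0, le_rfl, one_pos⟩, Or.inl rfl, p.2.1⟩
  have hTq : (D.T ^ n) q = q := by
    have := D.T_pow_sub n hqp fun i hi c hc hcv =>
      absurd (hmax c ⟨Or.inr (Set.mem_biUnion (show i ∈ {i : ℕ | i < n} from hi) hc), hcv.2⟩)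
        (not_le.2 hcv.1)
    rw [hp] at this
    exact Subtype.ext (by linarith)
  rcases hq with rfl | hq
  · -- when `q` is the origin, the mark that is mapped to the origin is periodic
    obtain ⟨m, hm, hm0⟩ := hD.exists_mark_T_eq_zero
    have hm0' : D.T m = ⟨0, le_rfl, one_pos⟩ := Subtype.ext hm0
    refine hn (Int.natCast_eq_zero.1 (hD.eq_of_zpow hm hm (n := n) ?_))
    rw [← hm0', ← Equiv.Perm.mul_apply, (Commute.pow_self D.T n).eq, Equiv.Perm.mul_apply] at hTq
    rw [zpow_natCast]
    exact D.T.injective hTq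
  · obtain ⟨i, -, hi⟩ := Set.mem_iUnion₂.1 hq
    refine hn (Int.natCast_eq_zero.1 (hD.eq_of_zpow hi hi (n := n) ?_))
    rw [zpow_natCast, ← Equiv.Perm.mul_apply, (Commute.pow_pow_self D.T n i).eq,
      Equiv.Perm.mul_apply, hTq]

theorem IsRegular.zpow_injective [Nontrivial A] (hD : D.IsRegular) (p : Set.Ico (0 : ℝ) 1) :
    Function.Injective fun n : ℤ => (D.T ^ n) p := by
  have key : ∀ m n : ℤ, m < n → (D.T ^ m) p ≠ (D.T ^ n) p := by
    intro m n hmn h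
    obtain ⟨k, hk⟩ := Int.eq_ofNat_of_zero_le (show 0 ≤ n - m by omega)
    refine hD.pow_apply_ne (n := k) (by omega) ((D.T ^ m) p) ?_
    rw [← zpow_natCast, ← Equiv.Perm.mul_apply, ← zpow_add, h]
    congr 2
    omega
  intro m n h
  by_contra hne
  rcases lt_or_gt_of_ne hne with h1 | h1
  · exact key m n h1 h
  · exact key n m h1 h.symm

end Regular

end IntervalExchange
end RIET

/-! ### Density of the orbits -/

namespace RIET
namespace IntervalExchange

variable {A : Type*} [Fintype A] {D : IntervalExchange A} {O : Set (Set.Ico (0 : ℝ) 1)}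

/-- `t` is a limit of points of `O` lying to the right of `t`, or a point of `O`. -/
def RightLimit (O : Set (Set.Ico (0 : ℝ) 1)) (t : Set.Ico (0 : ℝ) 1) : Prop :=
  ∀ ε > 0, ∃ o ∈ O, (t : ℝ) ≤ o ∧ (o : ℝ) < t + ε

/-- The open interval of length `g` on the left of `t` contains no point of `O`. -/
def LeftGap (O : Set (Set.Ico (0 : ℝ) 1)) (t : Set.Ico (0 : ℝ) 1) (g : ℝ) : Prop :=
  0 < g ∧ g ≤ t ∧ ∀ o ∈ O, ¬ ((t : ℝ) - g < o ∧ o < t)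

/-- A limit from the right cannot lie inside a gap. -/
theorem RightLimit.le_sub {t t' : Set.Ico (0 : ℝ) 1} (ht : RightLimit O t) {g : ℝ}
    (hg : LeftGap O t' g) (h : (t : ℝ) < t') : (t : ℝ) ≤ t' - g := by
  by_contra hlt
  rw [not_le] at hlt
  obtain ⟨o, ho, h1, h2⟩ := ht (t' - t) (by linarith)
  exact hg.2.2 o ho ⟨by linarith, by change (o : ℝ) < t'; linarith⟩

theorem RightLimit.map (hO : ∀ o, D.T o ∈ O ↔ o ∈ O) {t : Set.Ico (0 : ℝ) 1}
    (ht : RightLimit O t) : RightLimit O (D.T t) := by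
  intro ε hε
  obtain ⟨a, ha⟩ := D.exists_mem_I t
  obtain ⟨o, ho, h1, h2⟩ := ht (min ε (leftEnd D.ord D.len a + D.len a - t))
    (lt_min hε (by linarith [ha.2]))
  have hoa : o ∈ D.I a := ⟨ha.1.trans h1, by
    have := min_le_right ε (leftEnd D.ord D.len a + D.len a - t)
    linarith⟩
  have := D.T_sub_of_mem_I ha hoa
  exact ⟨D.T o, (hO o).2 ho, by linarith, by
    linarith [min_le_left ε (leftEnd D.ord D.len a + D.len a - t)]⟩

theorem LeftGap.map (hO : ∀ o, D.T o ∈ O ↔ o ∈ O) {t : Set.Ico (0 : ℝ) 1} {g : ℝ}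
    (hg : LeftGap O t g) {a : A} (ha : t ∈ D.I a) (hga : leftEnd D.ord D.len a ≤ t - g) :
    LeftGap O (D.T t) g := by
  have hTt := D.T_apply ha
  have h0 := leftEnd_nonneg D.ord' D.len_pos a
  refine ⟨hg.1, by linarith, fun o ho ⟨h1, h2⟩ => ?_⟩
  have h2' : (o : ℝ) < D.T t := h2
  -- pull the point `o` back by the translation
  let v : Set.Ico (0 : ℝ) 1 := ⟨t - (D.T t - o), by linarith [hg.2.1], by linarith [t.2.2]⟩
  have hv : (v : ℝ) = t - (D.T t - o) := rfl
  have hva : v ∈ D.I a := ⟨by linarith, by linarith [ha.2]⟩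
  have hTv : D.T v = o := Subtype.ext (by linarith [D.T_apply hva])
  exact hg.2.2 v ((hO v).1 (hTv ▸ ho)) ⟨by linarith, by change (v : ℝ) < t; linarith⟩

/-- A gap that contains no mark, and whose right end is not one, keeps its length. -/
theorem LeftGap.map_of_no_mark (hO : ∀ o, D.T o ∈ O ↔ o ∈ O) {t : Set.Ico (0 : ℝ) 1} {g : ℝ}
    (hg : LeftGap O t g) (h : ∀ m ∈ D.marks, ¬ ((t : ℝ) - g < m ∧ m ≤ t)) :
    LeftGap O (D.T t) g := by
  obtain ⟨a, ha⟩ := D.exists_mem_I t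
  refine hg.map hO ha ?_
  by_contra hlt
  rw [not_le] at hlt
  exact h (D.leftPoint a) ⟨by rw [coe_leftPoint]; linarith [hg.2.1], a, rfl⟩ ⟨hlt, ha.1⟩

/-- When the right end of a gap is not a mark, the part of the gap inside the interval of this end
is mapped to a gap. -/
theorem LeftGap.exists_map (hO : ∀ o, D.T o ∈ O ↔ o ∈ O) {t : Set.Ico (0 : ℝ) 1} {g : ℝ}
    (hg : LeftGap O t g) (ht : t ∉ D.marks) : ∃ g', LeftGap O (D.T t) g' := by
  obtain ⟨a, ha⟩ := D.exists_mem_I t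
  rcases D.eq_leftPoint_or_exists_lt ha with h | h
  · exact absurd ⟨by linarith [hg.1, hg.2.1], a, h⟩ ht
  · have hg' : LeftGap O t (min g (t - leftEnd D.ord D.len a)) :=
      ⟨lt_min hg.1 (by linarith), (min_le_left _ _).trans hg.2.1, fun o ho h' =>
        hg.2.2 o ho ⟨by linarith [h'.1, min_le_left g (t - leftEnd D.ord D.len a)], h'.2⟩⟩
    exact ⟨_, hg'.map hO ha (by linarith [min_le_right g (t - leftEnd D.ord D.len a)])⟩

/-- A gap of an invariant set cannot have a right end whose forward orbit avoids the marks: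
eventually the gaps at the successive images of this end would be disjoint intervals of
non-decreasing lengths. -/
theorem not_leftGap_of_forward (hper : ∀ t, Function.Injective fun n : ℕ => (D.T ^ n) t)
    (hO : ∀ o, D.T o ∈ O ↔ o ∈ O) {t : Set.Ico (0 : ℝ) 1} (ht : RightLimit O t)
    (hm : ∀ n : ℕ, (D.T ^ n) t ∉ D.marks) (g : ℝ) : ¬ LeftGap O t g := by
  intro hg
  have hsucc : ∀ n : ℕ, (D.T ^ (n + 1)) t = D.T ((D.T ^ n) t) := fun n => by
    rw [pow_succ', Equiv.Perm.mul_apply]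
  have hR : ∀ n : ℕ, RightLimit O ((D.T ^ n) t) := by
    intro n
    induction n with
    | zero => simpa
    | succ n ih => rw [hsucc]; exact ih.map hO
  have hG : ∀ n : ℕ, ∃ g, LeftGap O ((D.T ^ n) t) g := by
    intro n
    induction n with
    | zero => exact ⟨g, by simpa⟩
    | succ n ih => rw [hsucc]; exact ih.choose_spec.exists_map hO (hm n)
  -- each mark lies in the gap of at most one iterate
  have hbad : {n : ℕ | ∃ m ∈ D.marks, ∃ g, LeftGap O ((D.T ^ n) t) g ∧
      (((D.T ^ n) t : Set.Ico (0 : ℝ) 1) : ℝ) - g < m ∧ m ≤ (D.T ^ n) t}.Finite := by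
    have : {n : ℕ | ∃ m ∈ D.marks, ∃ g, LeftGap O ((D.T ^ n) t) g ∧
      (((D.T ^ n) t : Set.Ico (0 : ℝ) 1) : ℝ) - g < m ∧ m ≤ (D.T ^ n) t} =
      ⋃ m ∈ D.marks, {n : ℕ | ∃ g, LeftGap O ((D.T ^ n) t) g ∧
        (((D.T ^ n) t : Set.Ico (0 : ℝ) 1) : ℝ) - g < m ∧ m ≤ (D.T ^ n) t} := by
      ext n; simp
    rw [this]
    refine D.marks_finite.biUnion fun m _ => Set.Subsingleton.finite ?_
    have key : ∀ n k : ℕ, (((D.T ^ n) t : Set.Ico (0 : ℝ) 1) : ℝ) < (D.T ^ k) t →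
        ∀ g, LeftGap O ((D.T ^ k) t) g → (((D.T ^ k) t : Set.Ico (0 : ℝ) 1) : ℝ) - g < m →
        m ≤ (D.T ^ n) t → False := by
      intro n k h g' hg' h1 h2
      have := (hR n).le_sub hg' h
      have h2' : (m : ℝ) ≤ (D.T ^ n) t := h2
      linarith
    rintro n ⟨g1, h1, h2, h3⟩ k ⟨g2, h4, h5, h6⟩
    rcases lt_trichotomy (((D.T ^ n) t : Set.Ico (0 : ℝ) 1) : ℝ) ((D.T ^ k) t) with h | h | h
    · exact (key n k h g2 h4 h5 h3).elim
    · exact hper t (Subtype.ext h)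
    · exact (key k n h g1 h1 h2 h6).elim
  obtain ⟨N, hN⟩ := hbad.bddAbove
  obtain ⟨γ, hγ⟩ := hG (N + 1)
  have hγn : ∀ k : ℕ, LeftGap O ((D.T ^ (N + 1 + k)) t) γ := by
    intro k
    induction k with
    | zero => exact hγ
    | succ k ih =>
      rw [← add_assoc, hsucc]
      refine ih.map_of_no_mark hO fun m hm' hmm => ?_
      have : N + 1 + k ≤ N := hN ⟨m, hm', γ, ih, hmm⟩
      omega
  have hγ0 := hγ.1
  -- infinitely many disjoint intervals of the same length `γ` inside `[0, 1[`
  have hinj : Function.Injective fun k : ℕ =>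
      ⌊(((D.T ^ (N + 1 + k)) t : Set.Ico (0 : ℝ) 1) : ℝ) / γ⌋₊ := by
    have key : ∀ k l : ℕ, (((D.T ^ (N + 1 + k)) t : Set.Ico (0 : ℝ) 1) : ℝ) <
        (D.T ^ (N + 1 + l)) t → ⌊(((D.T ^ (N + 1 + k)) t : Set.Ico (0 : ℝ) 1) : ℝ) / γ⌋₊ ≠
        ⌊(((D.T ^ (N + 1 + l)) t : Set.Ico (0 : ℝ) 1) : ℝ) / γ⌋₊ := by
      intro k l h heq
      have h1 := (hR _).le_sub (hγn l) h
      have h2 : (((D.T ^ (N + 1 + k)) t : Set.Ico (0 : ℝ) 1) : ℝ) / γ + 1 ≤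
          (((D.T ^ (N + 1 + l)) t : Set.Ico (0 : ℝ) 1) : ℝ) / γ := by
        rw [div_add_one hγ0.ne']
        exact div_le_div_of_nonneg_right (by linarith) hγ0.le
      have h3 := Nat.floor_le_floor h2
      rw [Nat.floor_add_one (div_nonneg ((D.T ^ (N + 1 + k)) t).2.1 hγ0.le)] at h3
      omega
    intro k l h
    rcases lt_trichotomy (((D.T ^ (N + 1 + k)) t : Set.Ico (0 : ℝ) 1) : ℝ)
      ((D.T ^ (N + 1 + l)) t) with h' | h' | h'
    · exact absurd h (key k l h')
    · have := hper t (Subtype.ext h')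
      omega
    · exact absurd h.symm (key l k h')
  refine Set.infinite_univ (((Set.finite_Iic ⌊1 / γ⌋₊).preimage hinj.injOn).subset fun k _ => ?_)
  refine Nat.floor_le_floor (div_le_div_of_nonneg_right ?_ hγ0.le)
  exact ((D.T ^ (N + 1 + k)) t).2.2.le

/-- In a regular interval exchange, a limit from the right of points of an invariant set is not the
right end of a gap: its forward orbit avoids the marks of `T`, or its backward orbit avoids the
marks of the inverse of `T`. -/
theorem IsRegular.not_leftGap [Nontrivial A] (hD : D.IsRegular)
    (hO : ∀ o, D.T o ∈ O ↔ o ∈ O) {t : Set.Ico (0 : ℝ) 1} (ht : RightLimit O t) (g : ℝ) :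
    ¬ LeftGap O t g := by
  by_cases hf : ∀ n : ℕ, (D.T ^ n) t ∉ D.marks
  · exact not_leftGap_of_forward
      (fun p m n h => Nat.cast_injective (R := ℤ) (hD.zpow_injective p (by simpa using h)))
      hO ht hf g
  by_cases hb : ∀ n : ℕ, (D.swap.T ^ n) t ∉ D.swap.marks
  · refine not_leftGap_of_forward (D := D.swap)
      (fun p m n h => ?_) (fun o => ?_) ht hb g
    · rw [swap_T] at h
      have h' : (D.T ^ (-(m : ℤ))) p = (D.T ^ (-(n : ℤ))) p := by simpa using h
      have := hD.zpow_injective p h'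
      omega
    · rw [swap_T, ← hO]
      simp
  -- both directions are blocked: this is a connection between two marks
  exfalso
  push Not at hf hb
  obtain ⟨n, hn⟩ := hf
  obtain ⟨k, hk0, b, hkb⟩ := hb
  rw [swap_T, ← T_leftPoint] at hkb
  obtain ⟨m, hm, j, hj, hmj⟩ : ∃ m ∈ D.marks, ∃ j : ℤ, 1 ≤ j ∧
      (D.T ^ j) m = D.T (D.leftPoint b) := by
    by_cases h0 : (D.leftPoint b : ℝ) = 0
    · obtain ⟨m, hm, hm0⟩ := hD.exists_mark_T_eq_zero
      refine ⟨m, hm, 2, by norm_num, ?_⟩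
      have h1 : D.T m = D.leftPoint b := Subtype.ext (hm0.trans h0.symm)
      rw [← h1]
      rfl
    · exact ⟨_, ⟨h0, b, rfl⟩, 1, le_rfl, by simp⟩
  have h1 : t = (D.T ^ (k + j)) m := by
    rw [zpow_add, Equiv.Perm.mul_apply, hmj, hkb]
    simp
  rw [← zpow_natCast, h1, ← Equiv.Perm.mul_apply, ← zpow_add] at hn
  have := hD.eq_of_zpow hm hn rfl
  omega

/-- Every orbit of a regular interval exchange is dense. -/
theorem IsRegular.exists_mem_Ioo [Nontrivial A] (hD : D.IsRegular) (z : Set.Ico (0 : ℝ) 1)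
    {p q : ℝ} (hp : 0 ≤ p) (hpq : p < q) (hq : q ≤ 1) :
    ∃ n : ℤ, p < (D.T ^ n) z ∧ ((D.T ^ n) z : ℝ) < q := by
  set O := D.orbit z with hOdef
  have hO : ∀ o, D.T o ∈ O ↔ o ∈ O := by
    intro o
    constructor
    · rintro ⟨n, hn⟩
      refine ⟨n - 1, D.T.injective ?_⟩
      change D.T ((D.T ^ (n - 1)) z) = _
      rw [← zpow_add_one_apply, sub_add_cancel]
      exact hn
    · rintro ⟨n, rfl⟩
      exact ⟨n + 1, D.zpow_add_one_apply n z⟩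
  have hzO : z ∈ O := ⟨0, by simp⟩
  -- an empty interval followed by a point of the orbit leads to the right end of a gap
  have hgap : ∀ p q : ℝ, 0 ≤ p → p < q → (∀ o ∈ O, ¬ (p < o ∧ (o : ℝ) < q)) →
      ∀ o ∈ O, (o : ℝ) < q := by
    intro p q hp hpq hno o ho
    by_contra hoq
    rw [not_lt] at hoq
    set S : Set ℝ := {r | q ≤ r ∧ ∃ o ∈ O, (o : ℝ) = r} with hS
    have hSne : S.Nonempty := ⟨o, hoq, o, ho, rfl⟩
    have hSb : BddBelow S := ⟨q, fun r hr => hr.1⟩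
    have hqt : q ≤ sInf S := le_csInf hSne fun r hr => hr.1
    have hto : sInf S ≤ o := csInf_le hSb ⟨hoq, o, ho, rfl⟩
    refine hD.not_leftGap hO (t := ⟨sInf S, by linarith, by linarith [o.2.2]⟩) ?_ (sInf S - p) ?_
    · intro ε hε
      obtain ⟨r, ⟨hr0, o', ho', rfl⟩, hr⟩ := exists_lt_of_csInf_lt hSne
        (show sInf S < sInf S + ε by linarith)
      exact ⟨o', ho', csInf_le hSb ⟨hr0, o', ho', rfl⟩, hr⟩
    · refine ⟨by linarith, by change _ ≤ sInf S; linarith, fun o' ho' h' => ?_⟩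
      have h1 : sInf S - (sInf S - p) < o' := h'.1
      have h2 : (o' : ℝ) < sInf S := h'.2
      rcases lt_or_ge (o' : ℝ) q with h3 | h3
      · exact hno o' ho' ⟨by linarith, h3⟩
      · linarith [csInf_le hSb ⟨h3, o', ho', rfl⟩]
  by_contra hcon
  push Not at hcon
  have hcon' : ∀ o ∈ O, ¬ (p < o ∧ (o : ℝ) < q) := by
    rintro _ ⟨n, rfl⟩ ⟨h1, h2⟩
    exact absurd (hcon n h1) (not_le.2 h2)
  -- it remains to exclude that the orbit is dense in a proper initial segment `[0, s]`
  have hOq := hgap p q hp hpq hcon'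
  have hOp : ∀ o ∈ O, (o : ℝ) ≤ p := fun o ho => by
    by_contra h
    exact hcon' o ho ⟨not_le.1 h, hOq o ho⟩
  set S : Set ℝ := {r | ∃ o ∈ O, (o : ℝ) = r} with hS
  have hSne : S.Nonempty := ⟨z, z, hzO, rfl⟩
  set s := sSup S with hs
  have F1 : ∀ o ∈ O, (o : ℝ) ≤ s := fun o ho =>
    le_csSup ⟨p, by rintro _ ⟨o, ho, rfl⟩; exact hOp o ho⟩ ⟨o, ho, rfl⟩
  have F2 : ∀ ε > 0, ∃ o ∈ O, s - ε < (o : ℝ) := fun ε hε => by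
    obtain ⟨_, ⟨o, ho, rfl⟩, hr⟩ := exists_lt_of_lt_csSup hSne (show s - ε < s by linarith)
    exact ⟨o, ho, hr⟩
  -- the orbit is dense in `[0, s]`
  have F3 : ∀ p q : ℝ, 0 ≤ p → p < q → q ≤ s → ∃ o ∈ O, p < (o : ℝ) ∧ (o : ℝ) < q := by
    intro p q hp hpq hqs
    by_contra hno
    push Not at hno
    obtain ⟨o, ho, h1⟩ := F2 (s - (p + q) / 2) (by linarith)
    have := hgap p ((p + q) / 2) hp (by linarith) (fun o ho h' => by
      linarith [hno o ho h'.1, h'.2]) o ho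
    linarith
  have hs1 : s < 1 := lt_of_le_of_lt (csSup_le hSne (by rintro _ ⟨o, ho, rfl⟩; exact hOp o ho))
    (by linarith)
  have hnfix : ∀ v, D.T v ≠ v := fun v h => hD.pow_apply_ne one_ne_zero v (by simpa using h)
  have hs0 : 0 < s := by
    refine lt_of_le_of_ne (z.2.1.trans (F1 z hzO)) fun h0 => hnfix z (Subtype.ext ?_)
    have h1 := F1 _ ((hO z).2 hzO)
    have h2 := F1 z hzO
    linarith [z.2.1, (D.T z).2.1]
  set t : Set.Ico (0 : ℝ) 1 := ⟨s, hs0.le, hs1⟩ with ht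
  have hts : (t : ℝ) = s := rfl
  obtain ⟨a, ha⟩ := D.exists_mem_I t
  -- in both cases a point of the orbit has a preimage beyond `s`
  rcases D.eq_leftPoint_or_exists_lt ha with hmark | hlt
  · -- `s` is a mark: then its preimage `u` is inside an interval and greater than `s`, so that the
    -- preimages of the points of the orbit on the left of `s` are beyond `s`
    have htm : t ∈ D.marks := ⟨hs0.ne', a, hmark⟩
    set u := D.T.symm t with hu
    have hTu : D.T u = t := by simp [hu]
    obtain ⟨c, hc⟩ := D.exists_mem_I u
    have hsu : s ≤ u := by
      by_contra hus
      rw [not_le] at hus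
      obtain ⟨o, ho, h1, h2⟩ := F3 u (min s (leftEnd D.ord D.len c + D.len c)) u.2.1
        (lt_min hus hc.2) (min_le_left _ _)
      have hoc : o ∈ D.I c := ⟨hc.1.trans h1.le, h2.trans_le (min_le_right _ _)⟩
      have h3 := D.T_sub_of_mem_I hc hoc
      have h4 := F1 _ ((hO o).2 ho)
      rw [hTu] at h3
      linarith
    have hsu' : s < u := lt_of_le_of_ne hsu fun h => hnfix t (by
      have : t = u := Subtype.ext h
      rw [← this] at hTu
      exact hTu)
    rcases D.eq_leftPoint_or_exists_lt hc with h | h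
    · exact one_ne_zero (hD.eq_of_zpow (n := 1) ⟨by linarith, c, h⟩ htm (by simpa using hTu))
    · obtain ⟨o, ho, h1⟩ := F2 (min (u - leftEnd D.ord D.len c) (u - s))
        (lt_min (by linarith) (by linarith))
      have h2 := min_le_left (u - leftEnd D.ord D.len c) (u - s)
      have h3 := min_le_right (u - leftEnd D.ord D.len c) (u - s)
      have h4 := F1 o ho
      let v : Set.Ico (0 : ℝ) 1 := ⟨u - (s - o), by linarith, by linarith [u.2.2]⟩
      have hv : (v : ℝ) = u - (s - o) := rfl
      have hvc : v ∈ D.I c := ⟨by linarith, by linarith [hc.2]⟩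
      have h5 := D.T_sub_of_mem_I hc hvc
      rw [hTu] at h5
      have hTv : D.T v = o := Subtype.ext (by linarith)
      have h6 := F1 v ((hO v).1 (hTv ▸ ho))
      linarith
  · -- `s` is inside an interval: then `T s < s`, and the preimages of the points of the orbit on
    -- the right of `T s` are beyond `s`
    have hTt : (D.T t : ℝ) ≤ s := by
      refine le_of_forall_pos_le_add fun ε hε => ?_
      obtain ⟨o, ho, h1⟩ := F2 (min ε (s - leftEnd D.ord D.len a)) (lt_min hε (by linarith))
      have h2 := min_le_left ε (s - leftEnd D.ord D.len a)
      have h3 := min_le_right ε (s - leftEnd D.ord D.len a)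
      have h4 := F1 o ho
      have hoa : o ∈ D.I a := ⟨by linarith, by linarith [ha.2]⟩
      have h5 := D.T_sub_of_mem_I ha hoa
      have h6 := F1 _ ((hO o).2 ho)
      linarith
    have hTt' : (D.T t : ℝ) < s := lt_of_le_of_ne hTt fun h => hnfix t (Subtype.ext h)
    obtain ⟨o, ho, h1, h2⟩ := F3 (D.T t)
      (D.T t + min (s - D.T t) (leftEnd D.ord D.len a + D.len a - s)) (D.T t).2.1
      (lt_add_of_pos_right _ (lt_min (by linarith) (by linarith [ha.2])))
      (by linarith [min_le_left (s - (D.T t : ℝ)) (leftEnd D.ord D.len a + D.len a - s)])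
    have h3 := min_le_right (s - (D.T t : ℝ)) (leftEnd D.ord D.len a + D.len a - s)
    let v : Set.Ico (0 : ℝ) 1 := ⟨s + (o - D.T t), by linarith, by
      linarith [leftEnd_add_le_one D.ord D.len_pos D.len_sum a]⟩
    have hv : (v : ℝ) = s + (o - D.T t) := rfl
    have hva : v ∈ D.I a := ⟨by linarith, by linarith⟩
    have h5 := D.T_sub_of_mem_I ha hva
    have hTv : D.T v = o := Subtype.ext (by linarith)
    have h6 := F1 v ((hO v).1 (hTv ▸ ho))
    linarith

/-! ### Counting the factors of a coding -/

/-- The number of factors of length `n` of a coding of a regular interval exchange: the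
preimages of the marks by `T ^ i`, `i < n`, are pairwise distinct and separate the points of an
orbit according to their codings of length `n`. -/
theorem IsRegular.le_ncard_language [Nontrivial A] (hD : D.IsRegular) {z : Set.Ico (0 : ℝ) 1}
    {x : ℤ → A} (hx : D.IsCodingOf z x) (n : ℕ) :
    (Fintype.card A - 1) * n + 1 ≤ {w ∈ language x | w.length = n}.ncard := by
  classical
  -- the cut points
  set M : Finset (Set.Ico (0 : ℝ) 1) := D.marks_finite.toFinset with hM
  have hMcard : Fintype.card A - 1 ≤ M.card := by
    have h1 : (Finset.univ.image D.leftPoint) ⊆ insert ⟨0, le_rfl, one_pos⟩ M := by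
      intro m hm
      obtain ⟨a, -, rfl⟩ := Finset.mem_image.1 hm
      by_cases h : (D.leftPoint a : ℝ) = 0
      · exact Finset.mem_insert.2 (Or.inl (Subtype.ext h))
      · exact Finset.mem_insert_of_mem (D.marks_finite.mem_toFinset.2 ⟨h, a, rfl⟩)
    have h2 := Finset.card_le_card h1
    rw [Finset.card_image_of_injective _ D.leftPoint_injective, Finset.card_univ] at h2
    have h3 := Finset.card_insert_le (⟨0, le_rfl, one_pos⟩ : Set.Ico (0 : ℝ) 1) M
    omega
  set f : Set.Ico (0 : ℝ) 1 × ℕ → Set.Ico (0 : ℝ) 1 := fun c => (D.T ^ (-(c.2 : ℤ))) c.1 with hf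
  set C : Finset (Set.Ico (0 : ℝ) 1) := (M ×ˢ Finset.range n).image f with hC
  have hCcard : C.card = M.card * n := by
    rw [hC, Finset.card_image_of_injOn, Finset.card_product, Finset.card_range]
    rintro ⟨m, i⟩ hm ⟨m', j⟩ hm' h
    simp only [Finset.coe_product, Set.mem_prod, Finset.mem_coe, hM, Set.Finite.mem_toFinset]
      at hm hm'
    have h1 : (D.T ^ ((j : ℤ) - i)) m = m' := by
      rw [sub_eq_add_neg, zpow_add, Equiv.Perm.mul_apply]
      change (D.T ^ (j : ℤ)) (f (m, i)) = m'
      rw [h]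
      simp [hf]
    have h2 := hD.eq_of_zpow hm.1 hm'.1 h1
    rw [h2] at h1
    have h3 : i = j := by omega
    subst h3
    simpa using h1
  have hCmem : ∀ c, c ∈ C ↔ ∃ i < n, (D.T ^ i) c ∈ D.marks := by
    intro c
    simp only [hC, hf, Finset.mem_image, Finset.mem_product, Finset.mem_range, Prod.exists, hM,
      Set.Finite.mem_toFinset]
    constructor
    · rintro ⟨m, i, ⟨hm, hi⟩, rfl⟩
      refine ⟨i, hi, ?_⟩
      simpa using hm
    · rintro ⟨i, hi, hc⟩
      exact ⟨_, i, ⟨hc, hi⟩, by simp⟩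
  have h0C : (⟨0, le_rfl, one_pos⟩ : Set.Ico (0 : ℝ) 1) ∉ C := by
    intro h
    obtain ⟨i, -, hi⟩ := (hCmem _).1 h
    obtain ⟨m, hm, hm0⟩ := hD.exists_mark_T_eq_zero
    have hm0' : D.T m = ⟨0, le_rfl, one_pos⟩ := Subtype.ext hm0
    rw [← hm0', ← Equiv.Perm.mul_apply, ← pow_succ] at hi
    have h := hD.eq_of_zpow hm hi (n := (i + 1 : ℕ)) (by rw [zpow_natCast])
    omega
  -- a point of the orbit in each of the intervals delimited by the cut points
  have hpt : ∀ c : Set.Ico (0 : ℝ) 1, ∃ k : ℤ, c < (D.T ^ k) z ∧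
      ∀ c' ∈ C, c < c' → (D.T ^ k) z < c' := by
    intro c
    obtain ⟨q, hq1, hq2⟩ : ∃ q : ℝ, (c < q ∧ q ≤ 1) ∧ ∀ c' ∈ C, c < c' → q ≤ c' := by
      by_cases hne : (C.filter fun c' => c < c').Nonempty
      · obtain ⟨q, hq, hmin⟩ := Finset.exists_min_image _ id hne
        rw [Finset.mem_filter] at hq
        exact ⟨q, ⟨hq.2, q.2.2.le⟩, fun c' hc' h => hmin c' (Finset.mem_filter.2 ⟨hc', h⟩)⟩
      · refine ⟨1, ⟨c.2.2, le_rfl⟩, fun c' hc' h => ?_⟩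
        exact absurd ⟨c', Finset.mem_filter.2 ⟨hc', h⟩⟩ hne
    obtain ⟨k, hk1, hk2⟩ := hD.exists_mem_Ioo z c.2.1 hq1.1 hq1.2
    exact ⟨k, hk1, fun c' hc' h => Subtype.coe_lt_coe.1 (hk2.trans_le (hq2 c' hc' h))⟩
  choose k hk1 hk2 using hpt
  -- two points separated by a cut point have different codings
  have hsep : ∀ (i j : ℤ) (c : Set.Ico (0 : ℝ) 1), c ∈ C → (D.T ^ i) z < c → c ≤ (D.T ^ j) z →
      window x i n ≠ window x j n := by
    intro i j c hc hic hcj heq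
    obtain ⟨l, hl, hcl⟩ := (hCmem c).1 hc
    have hex : ∃ l, ∃ c, (D.T ^ l) c ∈ D.marks ∧ (D.T ^ i) z < c ∧ c ≤ (D.T ^ j) z :=
      ⟨l, c, hcl, hic, hcj⟩
    obtain ⟨d, hd, hid, hdj⟩ := Nat.find_spec hex
    have hle : Nat.find hex ≤ l := Nat.find_min' hex ⟨c, hcl, hic, hcj⟩
    -- up to the first time `r` at which a mark separates the two points, `T ^ r` is a translation
    set r := Nat.find hex with hr
    have hno : ∀ r' < r, ∀ c, (D.T ^ r') c ∈ D.marks → ¬ ((D.T ^ i) z < c ∧ c ≤ (D.T ^ j) z) :=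
      fun r' hr' c hc h => Nat.find_min hex hr' ⟨c, hc, h⟩
    have h1 := D.T_pow_sub r (hid.trans_le hdj).le hno
    have h2 := D.T_pow_sub r hid.le fun r' hr' c hc h => hno r' hr' c hc ⟨h.1, h.2.trans hdj⟩
    have hid' : ((D.T ^ i) z : ℝ) < d := hid
    have hdj' : (d : ℝ) ≤ (D.T ^ j) z := hdj
    obtain ⟨b, hb⟩ := hd.2
    have hxi := hx.mem_I (i + r)
    have hxj := hx.mem_I (j + r)
    rw [← window_eq_iff.1 heq r (by omega)] at hxj
    have hpow : ∀ i : ℤ, (D.T ^ (i + r)) z = (D.T ^ r) ((D.T ^ i) z) := fun i => by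
      rw [add_comm, zpow_add, Equiv.Perm.mul_apply, zpow_natCast]
    rw [hpow] at hxi hxj
    have hdI : (D.T ^ r) d ∈ D.I (x (i + r)) :=
      ⟨by linarith [hxi.1], by linarith [hxj.2]⟩
    have hbI := D.leftPoint_mem_I b
    rw [hb] at hbI
    have hbx := D.eq_of_mem_I hdI hbI
    rw [← hb, ← hbx, coe_leftPoint] at h2
    linarith [hxi.1]
  have hinj : Set.InjOn (fun c => window x (k c) n)
      (insert (⟨0, le_rfl, one_pos⟩ : Set.Ico (0 : ℝ) 1) C : Finset (Set.Ico (0 : ℝ) 1)) := by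
    have key : ∀ c ∈ insert (⟨0, le_rfl, one_pos⟩ : Set.Ico (0 : ℝ) 1) C,
        ∀ c' ∈ insert (⟨0, le_rfl, one_pos⟩ : Set.Ico (0 : ℝ) 1) C, c < c' →
        window x (k c) n ≠ window x (k c') n := by
      intro c _ c' hc' hlt
      have hc'C : c' ∈ C := by
        rcases Finset.mem_insert.1 hc' with rfl | h
        · exact absurd hlt (not_lt.2 c.2.1)
        · exact h
      exact hsep _ _ c' hc'C (hk2 c c' hc'C hlt) (hk1 c').le
    intro c hc c' hc' h
    rcases lt_trichotomy c c' with h' | h' | h'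
    · exact absurd h (key c hc c' hc' h')
    · exact h'
    · exact absurd h.symm (key c' hc' c hc h')
  have hfin : {w ∈ language x | w.length = n}.Finite :=
    (List.finite_length_eq A n).subset fun w hw => hw.2
  calc (Fintype.card A - 1) * n + 1 ≤ M.card * n + 1 := by gcongr
    _ = (insert (⟨0, le_rfl, one_pos⟩ : Set.Ico (0 : ℝ) 1) C).card := by
        rw [Finset.card_insert_of_notMem h0C, hCcard]
    _ = ((insert (⟨0, le_rfl, one_pos⟩ : Set.Ico (0 : ℝ) 1) C).image
          fun c => window x (k c) n).card := (Finset.card_image_of_injOn hinj).symm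
    _ ≤ _ := by
        rw [← Set.ncard_coe_finset]
        refine Set.ncard_le_ncard ?_ hfin
        intro w hw
        obtain ⟨c, -, rfl⟩ := Finset.mem_image.1 (Finset.mem_coe.1 hw)
        exact ⟨window_mem_language _ _ _, window_length _ _ _⟩

end IntervalExchange
end RIET

/-! ### Rotations as interval exchange transformations -/

namespace RIET

theorem leftEnd_lift {A ι : Type*} [Fintype A] [LinearOrder ι] {g : A → ι}
    (hg : Function.Injective g) (len : A → ℝ) (a : A) :
    leftEnd (LinearOrder.lift' g hg) len a = ∑ b, if g b < g a then len b else 0 := by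
  rw [leftEnd, Finset.sum_filter]
  refine Finset.sum_congr rfl fun b _ => ?_
  by_cases h : g b < g a
  · rw [if_pos h]
    exact if_pos h
  · rw [if_neg h]
    exact if_neg h

theorem fract_fract_add (a b : ℝ) : Int.fract (Int.fract a + b) = Int.fract (a + b) := by
  rw [Int.fract_eq_fract]
  exact ⟨-⌊a⌋, by rw [Int.fract]; push_cast; ring⟩

theorem eq_zero_of_irrational {θ : ℝ} (hθ : Irrational θ) {a b : ℤ} (h : (a : ℝ) * θ = b) :
    a = 0 ∧ b = 0 := by
  have ha : a = 0 := by
    by_contra ha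
    exact (hθ.intCast_mul ha).ne_int b h
  refine ⟨ha, ?_⟩
  rw [ha] at h
  simpa using h.symm

namespace IntervalExchange

/-- The division points `0, 1/k, …, (k-1)/k, 1 - θ, 1` of the unit interval. -/
noncomputable def rotMark (k : ℕ) (θ : ℝ) (i : ℕ) : ℝ :=
  if i < k then i / k else if i = k then 1 - θ else 1

theorem rotMark_of_lt {k : ℕ} (θ : ℝ) {i : ℕ} (h : i < k) : rotMark k θ i = i / k := if_pos h

theorem rotMark_self (k : ℕ) (θ : ℝ) : rotMark k θ k = 1 - θ := by simp [rotMark]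

theorem rotMark_succ (k : ℕ) (θ : ℝ) : rotMark k θ (k + 1) = 1 := by simp [rotMark]

theorem rotMark_zero {k : ℕ} (hk : 0 < k) (θ : ℝ) : rotMark k θ 0 = 0 := by
  simp [rotMark, hk]

/-- The first `k` intervals have length at least `1 / k - θ`. -/
theorem rotMark_gap {k : ℕ} {θ : ℝ} (h0 : 0 < θ) {i : ℕ} (h : i < k) :
    rotMark k θ i + (1 / k - θ) ≤ rotMark k θ (i + 1) := by
  have hk : (k : ℝ) ≠ 0 := by
    have : 0 < k := by omega
    positivity
  rw [rotMark_of_lt θ h]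
  rcases Nat.lt_or_ge (i + 1) k with h' | h'
  · rw [rotMark_of_lt θ h']
    push_cast
    rw [add_div]
    linarith
  · obtain rfl : k = i + 1 := by omega
    rw [rotMark_self]
    push_cast at *
    field_simp
    linarith

variable {A : Type*} [Fintype A] {k : ℕ}

/-- The length of the `i`-th interval delimited by the division points. -/
noncomputable def rotLen (k : ℕ) (θ : ℝ) (i : ℕ) : ℝ := rotMark k θ (i + 1) - rotMark k θ i

theorem rotLen_pos {θ : ℝ} (h0 : 0 < θ) (h1 : k * θ < 1) {i : ℕ} (hi : i < k + 1) :
    0 < rotLen k θ i := by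
  rcases Nat.lt_succ_iff_lt_or_eq.1 hi with h | rfl
  · have hk : (0 : ℝ) < k := by
      have : 0 < k := by omega
      positivity
    have h2 := rotMark_gap h0 h
    have h3 : θ < 1 / k := by rw [lt_div_iff₀ hk]; linarith
    rw [rotLen]
    linarith
  · rw [rotLen, rotMark_succ, rotMark_self]
    linarith

theorem sum_rotLen (hk : 0 < k) (θ : ℝ) {i : ℕ} (hi : i ≤ k + 1) :
    (∑ j : Fin (k + 1), if (j : ℕ) < i then rotLen k θ j else 0) = rotMark k θ i := by
  rw [Fin.sum_univ_eq_sum_range (fun j => if j < i then rotLen k θ j else 0) (k + 1),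
    ← Finset.sum_filter]
  have : (Finset.range (k + 1)).filter (· < i) = Finset.range i := by
    ext j
    simp only [Finset.mem_filter, Finset.mem_range]
    omega
  rw [this]
  change ∑ j ∈ Finset.range i, (rotMark k θ (j + 1) - rotMark k θ j) = _
  rw [Finset.sum_range_sub, rotMark_zero hk, sub_zero]

/-- The rank of the letters in the second order of the rotation: the last letter becomes the
first one. -/
def rotRank (k : ℕ) (i : Fin (k + 1)) : ℤ := if (i : ℕ) = k then -1 else i

theorem rotRank_injective : Function.Injective (rotRank k) := by
  intro i j h
  unfold rotRank at h
  refine Fin.ext ?_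
  split_ifs at h <;> omega

/-- The rotation of angle `θ` of the circle, as an interval exchange on the letters `e i`: the
`i`-th interval is delimited by the division points `rotMark k θ i` and `rotMark k θ (i + 1)`. -/
noncomputable def rotation (hk : 0 < k) {θ : ℝ} (h0 : 0 < θ) (h1 : k * θ < 1)
    (e : Fin (k + 1) ≃ A) : IntervalExchange A where
  ord := LinearOrder.lift' e.symm e.symm.injective
  ord' := LinearOrder.lift' (fun a => rotRank k (e.symm a))
    (rotRank_injective.comp e.symm.injective)
  len a := rotLen k θ (e.symm a)
  len_pos a := rotLen_pos h0 h1 (e.symm a).2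
  len_sum := by
    rw [← Equiv.sum_comp e, ← rotMark_succ k θ, ← sum_rotLen hk θ le_rfl]
    refine Finset.sum_congr rfl fun j _ => ?_
    rw [if_pos j.2, Equiv.symm_apply_apply]

variable {hk : 0 < k} {θ : ℝ} {h0 : 0 < θ} {h1 : k * θ < 1} {e : Fin (k + 1) ≃ A}

theorem rotation_len (i : Fin (k + 1)) : (rotation hk h0 h1 e).len (e i) = rotLen k θ i := by
  simp [rotation]

theorem rotation_leftEnd (i : Fin (k + 1)) :
    leftEnd (rotation hk h0 h1 e).ord (rotation hk h0 h1 e).len (e i) = rotMark k θ i := by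
  change leftEnd (LinearOrder.lift' e.symm e.symm.injective) _ _ = _
  rw [leftEnd_lift, ← Equiv.sum_comp e, ← sum_rotLen hk θ i.2.le]
  refine Finset.sum_congr rfl fun j _ => ?_
  simp [rotation_len]

/-- In the second order, the last interval comes first and pushes the others by its length `θ`. -/
theorem rotation_leftEnd' (i : Fin (k + 1)) :
    leftEnd (rotation hk h0 h1 e).ord' (rotation hk h0 h1 e).len (e i) =
      if (i : ℕ) = k then 0 else rotMark k θ i + θ := by
  change leftEnd (LinearOrder.lift' (fun a => rotRank k (e.symm a))
    (rotRank_injective.comp e.symm.injective)) _ _ = _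
  rw [leftEnd_lift, ← Equiv.sum_comp e]
  simp only [Equiv.symm_apply_apply, rotation_len]
  split_ifs with hi
  · refine Finset.sum_eq_zero fun j _ => if_neg ?_
    simp only [rotRank, hi, if_true]
    split_ifs <;> omega
  · rw [← sum_rotLen hk θ i.2.le, Fin.sum_univ_castSucc, Fin.sum_univ_castSucc]
    have h2 : rotLen k θ (Fin.last k) = θ := by
      rw [rotLen, Fin.val_last, rotMark_succ, rotMark_self]; ring
    rw [h2, if_pos (by simp [rotRank, hi]; omega), if_neg (by simp; omega), add_zero]
    congr 1
    refine Finset.sum_congr rfl fun j _ => ?_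
    have hj : (j : ℕ) ≠ k := j.2.ne
    simp [rotRank, hi, hj]

theorem mem_rotation_I {i : Fin (k + 1)} {z : Set.Ico (0 : ℝ) 1} :
    z ∈ (rotation hk h0 h1 e).I (e i) ↔ rotMark k θ i ≤ z ∧ (z : ℝ) < rotMark k θ (i + 1) := by
  change leftEnd _ _ _ ≤ (z : ℝ) ∧ (z : ℝ) < leftEnd _ _ _ + _ ↔ _
  rw [rotation_leftEnd, rotation_len, rotLen, add_sub_cancel]

theorem rotMark_mono (h0 : 0 < θ) (h1 : k * θ < 1) {i j : ℕ} (hij : i ≤ j) (hj : j ≤ k + 1) :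
    rotMark k θ i ≤ rotMark k θ j := by
  induction j, hij using Nat.le_induction with
  | base => exact le_rfl
  | succ j hij ih =>
    have := rotLen_pos h0 h1 (i := j) (by omega)
    rw [rotLen] at this
    linarith [ih (by omega)]

theorem rotation_T (z : Set.Ico (0 : ℝ) 1) :
    ((rotation hk h0 h1 e).T z : ℝ) = Int.fract ((z : ℝ) + θ) := by
  obtain ⟨a, ha⟩ := (rotation hk h0 h1 e).exists_mem_I z
  obtain ⟨i, rfl⟩ := e.surjective a
  rw [T_apply _ ha, rotation_leftEnd, rotation_leftEnd']
  rw [mem_rotation_I] at ha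
  split_ifs with hi
  · rw [hi, rotMark_self] at ha
    have hk1 : (1 : ℝ) ≤ k := by exact_mod_cast hk
    rw [hi, rotMark_self, eq_comm, Int.fract_eq_iff]
    exact ⟨by linarith [ha.1], by nlinarith [z.2.2], 1, by push_cast; ring⟩
  · have h2 := rotMark_mono h0 h1 (show (i : ℕ) + 1 ≤ k by omega) (by omega)
    rw [rotMark_self] at h2
    rw [eq_comm, Int.fract_eq_iff]
    exact ⟨by linarith [z.2.1, h0], by linarith [ha.2], 0, by push_cast; ring⟩

/-- The iterates, positive and negative, of a transformation that acts as a rotation. -/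
theorem zpow_eq_fract {D : IntervalExchange A} (hT : ∀ z, (D.T z : ℝ) = Int.fract ((z : ℝ) + θ))
    (n : ℤ) (z : Set.Ico (0 : ℝ) 1) : ((D.T ^ n) z : ℝ) = Int.fract ((z : ℝ) + n * θ) := by
  induction n using Int.induction_on with
  | zero => simp [Int.fract_eq_self.2 z.2]
  | succ n ih =>
    rw [zpow_add_one_apply, hT, ih, fract_fract_add]
    congr 1; push_cast; ring
  | pred n ih =>
    let v : Set.Ico (0 : ℝ) 1 := ⟨Int.fract ((z : ℝ) + ((-(n : ℤ) - 1 : ℤ) : ℝ) * θ),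
      Int.fract_nonneg _, Int.fract_lt_one _⟩
    suffices h : (D.T ^ (-(n : ℤ) - 1)) z = v by rw [h]
    apply D.T.injective
    rw [← zpow_add_one_apply, sub_add_cancel]
    refine Subtype.ext ?_
    rw [ih, hT, fract_fract_add]
    congr 1; push_cast; ring

theorem rotation_zpow (n : ℤ) (z : Set.Ico (0 : ℝ) 1) :
    (((rotation hk h0 h1 e).T ^ n) z : ℝ) = Int.fract ((z : ℝ) + n * θ) :=
  zpow_eq_fract rotation_T n z

/-- Two division points, other than `0` and `1`, are never on the same orbit of the rotation: the
points `i / k` are rational, and `1 - θ` is on the orbit of the origin. -/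
theorem rotMark_connection (hθ : Irrational θ) {i j : ℕ} (hi : 0 < i) (hi' : i ≤ k) (hj : 0 < j)
    (hj' : j ≤ k) {n m : ℤ}
    (h : Int.fract (rotMark k θ i + n * θ) = Int.fract (rotMark k θ j + m * θ)) :
    i = j ∧ n = m := by
  obtain ⟨N, hN⟩ := Int.fract_eq_fract.1 h
  have hk0 : (k : ℝ) ≠ 0 := by
    have : 0 < k := by omega
    positivity
  rcases hi'.lt_or_eq with hik | rfl <;> rcases hj'.lt_or_eq with hjk | rfl
  · rw [rotMark_of_lt θ hik, rotMark_of_lt θ hjk] at hN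
    obtain ⟨h2, h3⟩ := eq_zero_of_irrational hθ (a := (n - m) * k) (b := N * k - i + j) (by
      field_simp at hN
      push_cast
      linarith)
    have h4 : n - m = 0 := by
      rcases mul_eq_zero.1 h2 with h | h
      · exact h
      · omega
    have h5 : N * k = i - j := by linarith
    have h6 : N = 0 := by
      by_contra hN0
      have h7 := abs_mul N (k : ℤ)
      rw [h5] at h7
      have h8 := Int.one_le_abs hN0
      have h9 : |(i : ℤ) - j| < k := abs_lt.2 ⟨by omega, by omega⟩
      rw [h7, Nat.abs_cast] at h9
      nlinarith
    rw [h6] at h5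
    omega
  · rw [rotMark_of_lt θ hik, rotMark_self] at hN
    obtain ⟨h2, h3⟩ := eq_zero_of_irrational hθ (a := (n - m + 1) * j) (b := (N + 1) * j - i) (by
      field_simp at hN
      push_cast
      linarith)
    have h5 : (N + 1) * j = i := by linarith
    exfalso
    have : 0 < N + 1 := by
      by_contra h
      nlinarith
    nlinarith
  · rw [rotMark_of_lt θ hjk, rotMark_self] at hN
    obtain ⟨h2, h3⟩ := eq_zero_of_irrational hθ (a := (n - m - 1) * i) (b := (N - 1) * i + j) (by
      field_simp at hN
      push_cast
      linarith)
    have h5 : (1 - N) * i = j := by linarith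
    exfalso
    have : 0 < 1 - N := by
      by_contra h
      nlinarith
    nlinarith
  · obtain ⟨h2, h3⟩ := eq_zero_of_irrational hθ (a := n - m) (b := N) (by push_cast; linarith)
    exact ⟨rfl, by omega⟩

theorem rotation_isRegular (hθ : Irrational θ) : (rotation hk h0 h1 e).IsRegular := by
  have hpos : ∀ i : Fin (k + 1), ((rotation hk h0 h1 e).leftPoint (e i) : ℝ) ≠ 0 → 0 < (i : ℕ) := by
    intro i hi
    rw [coe_leftPoint, rotation_leftEnd] at hi
    by_contra h
    rw [not_lt, nonpos_iff_eq_zero] at h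
    rw [h, rotMark_zero hk] at hi
    exact hi rfl
  have key : ∀ (i j : Fin (k + 1)), ((rotation hk h0 h1 e).leftPoint (e i) : ℝ) ≠ 0 →
      ((rotation hk h0 h1 e).leftPoint (e j) : ℝ) ≠ 0 → ∀ n m : ℤ,
      ((rotation hk h0 h1 e).T ^ n) ((rotation hk h0 h1 e).leftPoint (e i)) =
      ((rotation hk h0 h1 e).T ^ m) ((rotation hk h0 h1 e).leftPoint (e j)) → i = j ∧ n = m := by
    intro i j hi hj n m h
    have h' := congrArg Subtype.val h
    rw [rotation_zpow, rotation_zpow, coe_leftPoint, coe_leftPoint, rotation_leftEnd,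
      rotation_leftEnd] at h'
    have := rotMark_connection hθ (hpos i hi) (by omega) (hpos j hj) (by omega) h'
    exact ⟨Fin.ext this.1, this.2⟩
  constructor
  · intro a ha
    obtain ⟨i, rfl⟩ := e.surjective a
    exact Set.infinite_range_of_injective fun n m h => (key i i ha ha n m h).2
  · intro a b hab ha hb
    obtain ⟨i, rfl⟩ := e.surjective a
    obtain ⟨j, rfl⟩ := e.surjective b
    rw [Set.disjoint_left]
    rintro _ ⟨n, rfl⟩ ⟨m, h⟩
    exact hab (congrArg e (key j i hb ha m n h).1.symm)

theorem exists_isCodingOf (D : IntervalExchange A) (z : Set.Ico (0 : ℝ) 1) :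
    ∃ x, D.IsCodingOf z x := by
  choose x hx using fun n : ℤ => D.exists_mem_I ((D.T ^ n) z)
  exact ⟨x, fun n a => ⟨fun h => h ▸ hx n, fun h => D.eq_of_mem_I (hx n) h⟩⟩

end IntervalExchange
end RIET

/-! ### Factors of the codings of rotations of small angle -/

namespace RIET

/-- The bi-infinite word `⋯ a a . b c c ⋯`. -/
def stepWord {A : Type*} (a b c : A) (n : ℤ) : A := if n < 0 then a else if n = 0 then b else c

namespace IntervalExchange

variable {A : Type*} [Fintype A] {k : ℕ} {hk : 0 < k} {θ : ℝ} {h0 : 0 < θ} {h1 : k * θ < 1}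
  {e : Fin (k + 1) ≃ A} {z : Set.Ico (0 : ℝ) 1} {x : ℤ → A}

theorem rotation_letter (hx : (rotation hk h0 h1 e).IsCodingOf z x) {n : ℤ} {i : Fin (k + 1)}
    {r : ℝ} (hr : (((rotation hk h0 h1 e).T ^ n) z : ℝ) = r) (hi : rotMark k θ i ≤ r)
    (hi' : r < rotMark k θ (i + 1)) : x n = e i :=
  (hx n _).2 (mem_rotation_I.2 (by rw [hr]; exact ⟨hi, hi'⟩))

/-- The words read along the rotation from a point of a non-empty interval. -/
theorem exists_rotation_start (hθ : Irrational θ) {p q : ℝ} (hp : 0 ≤ p) (hpq : p < q)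
    (hq : q ≤ 1) (z : Set.Ico (0 : ℝ) 1) : ∃ (n : ℤ) (r : ℝ), p < r ∧ r < q ∧
      ∀ t : ℕ, (((rotation hk h0 h1 e).T ^ (n + t)) z : ℝ) = Int.fract (r + t * θ) := by
  have : Nontrivial A := by
    rw [← Fintype.one_lt_card_iff_nontrivial, ← Fintype.card_congr e, Fintype.card_fin]
    omega
  obtain ⟨n, h2, h3⟩ := (rotation_isRegular (hk := hk) (h0 := h0) (h1 := h1) (e := e)
    hθ).exists_mem_Ioo z hp hpq hq
  refine ⟨n, _, h2, h3, fun t => ?_⟩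
  rw [rotation_zpow, rotation_zpow, fract_fract_add]
  congr 1; push_cast; ring

theorem theta_lt_one (hk : 0 < k) (h1 : k * θ < 1) : θ < 1 := by
  have hk1 : (1 : ℝ) ≤ k := by exact_mod_cast hk
  by_contra h
  nlinarith

/-- The words of length two of the coding of a rotation of small angle. -/
theorem rotation_pairs (hθ : Irrational θ) (h2 : 2 * k * θ < 1)
    (hx : (rotation hk h0 h1 e).IsCodingOf z x) :
    (∀ i : Fin k, [e i.castSucc, e i.castSucc] ∈ language x) ∧
    (∀ i : Fin k, [e i.castSucc, e i.succ] ∈ language x) ∧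
    [e (Fin.last k), e 0] ∈ language x := by
  have hpair : ∀ (n : ℤ) (r : ℝ) (i j : Fin (k + 1)),
      (∀ t : ℕ, (((rotation hk h0 h1 e).T ^ (n + t)) z : ℝ) = Int.fract (r + t * θ)) →
      0 ≤ r → r < 1 → rotMark k θ i ≤ r → r < rotMark k θ (i + 1) →
      rotMark k θ j ≤ Int.fract (r + θ) → Int.fract (r + θ) < rotMark k θ (j + 1) →
      [e i, e j] ∈ language x := by
    intro n r i j hn hr0 hr1 hi hi' hj hj'
    refine ⟨n, 2, ?_⟩
    have e1 := rotation_letter hx (n := n) (r := r)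
      (by have := hn 0; simpa [Int.fract_eq_self.2 ⟨hr0, hr1⟩] using this) hi hi'
    have e2 := rotation_letter hx (n := n + 1) (r := Int.fract (r + θ))
      (by have := hn 1; simpa using this) hj hj'
    rw [window_succ, window_one, e1, e2]
  have hk0 : (0 : ℝ) < k := by exact_mod_cast hk
  have hgap : 2 * θ < 1 / k := by rw [lt_div_iff₀ hk0]; linarith
  have hnn : ∀ i : ℕ, i ≤ k + 1 → 0 ≤ rotMark k θ i := fun i hi => by
    rw [← rotMark_zero hk θ]; exact rotMark_mono h0 h1 (Nat.zero_le _) hi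
  have hle : ∀ i : ℕ, i ≤ k → rotMark k θ i ≤ 1 - θ := fun i hi => by
    rw [← rotMark_self k θ]; exact rotMark_mono h0 h1 hi (by omega)
  -- the interval of the starting points is, in the first case, what remains of the `i`-th interval
  -- after removing its last `θ`, and in the second case this last part
  refine ⟨fun i => ?_, fun i => ?_, ?_⟩
  · have hi := i.2
    have hg := rotMark_gap h0 hi
    obtain ⟨n, r, hr1, hr2, hn⟩ := exists_rotation_start (hk := hk) (h0 := h0) (h1 := h1) (e := e)
      hθ (p := rotMark k θ i) (q := rotMark k θ (i + 1) - θ) (hnn i (by omega)) (by linarith)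
      (by linarith [hle (i + 1) hi]) z
    have hf : Int.fract (r + θ) = r + θ :=
      Int.fract_eq_self.2 ⟨by linarith [hnn i (by omega)], by linarith [hle (i + 1) hi]⟩
    exact hpair n r _ _ hn (by linarith [hnn i (by omega)]) (by linarith [hle (i + 1) hi])
      (by simpa using hr1.le) (by simp; linarith) (by rw [hf]; simp; linarith)
      (by rw [hf]; simp; linarith)
  · have hi := i.2
    have hg := rotMark_gap h0 hi
    have hnext : rotMark k θ (i + 1) + θ ≤ rotMark k θ (i + 1 + 1) := by
      rcases Nat.lt_or_ge (i + 1 : ℕ) k with h | h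
      · linarith [rotMark_gap h0 h]
      · rw [show (i + 1 : ℕ) = k by omega, rotMark_self, rotMark_succ]; linarith
    obtain ⟨n, r, hr1, hr2, hn⟩ := exists_rotation_start (hk := hk) (h0 := h0) (h1 := h1) (e := e)
      hθ (p := rotMark k θ (i + 1) - θ) (q := rotMark k θ (i + 1))
      (by linarith [hnn i (by omega)]) (by linarith) (by linarith [hle (i + 1) hi]) z
    have hf : Int.fract (r + θ) = r + θ :=
      Int.fract_eq_self.2 ⟨by linarith [hnn i (by omega)], by linarith [hle (i + 1) hi]⟩
    exact hpair n r _ _ hn (by linarith [hnn i (by omega)]) (by linarith [hle (i + 1) hi])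
      (by simp; linarith) (by simpa using hr2) (by rw [hf]; simp; linarith)
      (by rw [hf]; simp; linarith)
  · obtain ⟨n, r, hr1, hr2, hn⟩ := exists_rotation_start (hk := hk) (h0 := h0) (h1 := h1) (e := e)
      hθ (p := 1 - θ) (q := 1) (by linarith [theta_lt_one hk h1]) (by linarith) le_rfl z
    have hf : Int.fract (r + θ) = r + θ - 1 :=
      Int.fract_eq_iff.2 ⟨by linarith, by linarith [theta_lt_one hk h1], 1, by push_cast; ring⟩
    have hg := rotMark_gap h0 hk
    rw [rotMark_zero hk] at hg
    exact hpair n r _ _ hn (by linarith [theta_lt_one hk h1]) hr2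
      (by rw [Fin.val_last, rotMark_self]; exact hr1.le)
      (by rw [Fin.val_last, rotMark_succ]; exact hr2)
      (by rw [hf, Fin.val_zero, rotMark_zero hk]; linarith)
      (by rw [hf, Fin.val_zero]; linarith)

/-- The short factors of the coding of a rotation of small angle contain at most one change of
letter, or two when they run through the short last interval. -/
theorem rotation_window {m : ℕ} (h2 : k * ((m + 2) * θ) < 1)
    (hx : (rotation hk h0 h1 e).IsCodingOf z x) (j : ℤ) :
    ∃ (i : Fin k) (s : ℤ), window x j m = window (stepWord (e i.castSucc) (e i.succ)
      (if (i : ℕ) + 1 = k then e 0 else e i.succ)) s m := by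
  have hk0 : (0 : ℝ) < k := by exact_mod_cast hk
  have hgap : (m + 2) * θ < 1 / k := by rw [lt_div_iff₀ hk0]; linarith
  have hnn : ∀ i : ℕ, i ≤ k + 1 → 0 ≤ rotMark k θ i := fun i hi => by
    rw [← rotMark_zero hk θ]; exact rotMark_mono h0 h1 (Nat.zero_le _) hi
  have hle : ∀ i : ℕ, i ≤ k → rotMark k θ i ≤ 1 - θ := fun i hi => by
    rw [← rotMark_self k θ]; exact rotMark_mono h0 h1 hi (by omega)
  set v : ℝ := (((rotation hk h0 h1 e).T ^ j) z : ℝ) with hv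
  have hv0 : 0 ≤ v := (((rotation hk h0 h1 e).T ^ j) z).2.1
  have hv1 : v < 1 := (((rotation hk h0 h1 e).T ^ j) z).2.2
  have hT : ∀ t : ℕ, (((rotation hk h0 h1 e).T ^ (j + t)) z : ℝ) = Int.fract (v + t * θ) := by
    intro t
    rw [hv, rotation_zpow, rotation_zpow, fract_fract_add]
    congr 1; push_cast; ring
  have htm : ∀ t : ℕ, t < m → (t : ℝ) * θ ≤ m * θ := fun t ht => by
    have : (t : ℝ) ≤ m := by exact_mod_cast ht.le
    nlinarith
  have hlow : ∀ t : ℕ, v + t * θ < 1 →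
      (((rotation hk h0 h1 e).T ^ (j + t)) z : ℝ) = v + t * θ := fun t ht => by
    rw [hT, Int.fract_eq_self]
    exact ⟨by positivity, ht⟩
  obtain ⟨a, ha⟩ := (rotation hk h0 h1 e).exists_mem_I (((rotation hk h0 h1 e).T ^ j) z)
  obtain ⟨i, rfl⟩ := e.surjective a
  rw [mem_rotation_I, ← hv] at ha
  -- the time of the first passage beyond `b` becomes the origin of the eventually constant word
  have hceil : ∀ (b : ℝ) (t : ℕ), (-(⌈(b - v) / θ⌉₊ : ℤ) + t < 0 ↔ v + t * θ < b) := by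
    intro b t
    rw [show (-(⌈(b - v) / θ⌉₊ : ℤ) + t < 0 ↔ t < ⌈(b - v) / θ⌉₊) by omega, Nat.lt_ceil,
      lt_div_iff₀ h0]
    constructor <;> intro h <;> linarith
  rcases Nat.lt_or_ge (i + 1 : ℕ) k with hi | hi
  · refine ⟨⟨i, by omega⟩, -⌈(rotMark k θ (i + 1) - v) / θ⌉₊, window_eq_iff.2 fun t ht => ?_⟩
    have hg := rotMark_gap h0 hi
    have h3 := hle (i + 1 + 1) hi
    have h4 := htm t ht
    have hl := hlow t (by linarith [ha.2])
    rw [if_neg (by simpa using hi.ne)]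
    unfold stepWord
    simp only [hceil]
    have hc : (⟨i, by omega⟩ : Fin k).castSucc = i := rfl
    split_ifs with h5 h6
    · rw [hc]
      exact rotation_letter hx hl (by have : 0 ≤ (t : ℝ) * θ := by positivity
                                      linarith [ha.1]) h5
    all_goals exact rotation_letter hx hl (by simpa using h5) (by simp; linarith [ha.2])
  · refine ⟨⟨k - 1, by omega⟩, -⌈(1 - θ - v) / θ⌉₊, window_eq_iff.2 fun t ht => ?_⟩
    have h4 := htm t ht
    rw [if_pos (by simp; omega)]
    unfold stepWord
    simp only [hceil]
    have hgk := rotMark_gap h0 (show k - 1 < k by omega)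
    rw [show k - 1 + 1 = k by omega, rotMark_self] at hgk
    have hge : rotMark k θ (k - 1) ≤ v :=
      (rotMark_mono h0 h1 (by omega) (by omega)).trans ha.1
    split_ifs with h5 h6
    · have hl := hlow t (by linarith)
      refine rotation_letter hx hl ?_ ?_
      · have : 0 ≤ (t : ℝ) * θ := by positivity
        simp; linarith
      · simp only [Fin.val_castSucc, show k - 1 + 1 = k by omega, rotMark_self]; exact h5
    · -- the unique position in the last interval
      have h7 : v + t * θ < 1 := by
        rcases Nat.eq_zero_or_pos t with rfl | htpos
        · simpa using hv1
        · have := (hceil (1 - θ) (t - 1)).1 (by push_cast [Nat.cast_sub htpos]; omega)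
          push_cast [Nat.cast_sub htpos] at this
          linarith
      refine rotation_letter hx (hlow t h7) ?_ ?_
      · simp only [Fin.val_succ, show k - 1 + 1 = k by omega, rotMark_self]; linarith
      · simp only [Fin.val_succ, show k - 1 + 1 = k by omega, rotMark_succ]; exact h7
    · have h7 : 1 ≤ v + t * θ := by
        have hpos : 0 < -(⌈(1 - θ - v) / θ⌉₊ : ℤ) + t := by
          rcases lt_trichotomy (-(⌈(1 - θ - v) / θ⌉₊ : ℤ) + t) 0 with h | h | h
          · exact absurd ((hceil _ _).1 h) h5
          · exact absurd h h6
          · exact h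
        have htpos : 1 ≤ t := by omega
        have := (not_congr (hceil (1 - θ) (t - 1))).1 (by push_cast [Nat.cast_sub htpos]; omega)
        push_cast [Nat.cast_sub htpos] at this
        linarith
      have h8 : v + t * θ < 1 + (1 / k - θ) := by
        have h9 : rotMark k θ 1 ≤ 1 - θ := hle 1 hk
        have hg0 := rotMark_gap h0 hk
        rw [rotMark_zero hk] at hg0
        linarith
      have hg := rotMark_gap h0 hk
      rw [rotMark_zero hk] at hg
      have hf : Int.fract (v + t * θ) = v + t * θ - 1 :=
        Int.fract_eq_iff.2 ⟨by linarith, by linarith [hle 1 hk], 1, by push_cast; ring⟩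
      refine rotation_letter hx ((hT t).trans hf) ?_ ?_
      · rw [Fin.val_zero, rotMark_zero hk]; linarith
      · rw [Fin.val_zero]; simp only [zero_add] at *; linarith

/-- The words of length three of the coding of a two-letter rotation of small angle. -/
theorem rotation_triples (hθ : Irrational θ) {p q : A} {e : Fin (1 + 1) ≃ A} (hp : e 0 = p)
    (hq : e 1 = q) {h1 : (1 : ℕ) * θ < 1} (h4 : 4 * θ < 1)
    (hx : (rotation one_pos h0 h1 e).IsCodingOf z x) :
    [p, p, p] ∈ language x ∧ [p, p, q] ∈ language x ∧ [q, p, p] ∈ language x ∧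
      [p, q, p] ∈ language x := by
  have hm0 : rotMark 1 θ 0 = 0 := rotMark_zero one_pos θ
  have hm1 : rotMark 1 θ 1 = 1 - θ := rotMark_self 1 θ
  have hm2 : rotMark 1 θ (1 + 1) = 1 := rotMark_succ 1 θ
  have hP : ∀ (n : ℤ) (r : ℝ), (((rotation one_pos h0 h1 e).T ^ n) z : ℝ) = r → r < 1 - θ →
      x n = p := fun n r hr h => by
    rw [rotation_letter hx (i := 0) rfl, hp]
    · rw [Fin.val_zero, hm0]; exact (((rotation one_pos h0 h1 e).T ^ n) z).2.1
    · rw [Fin.val_zero, zero_add, hm1, hr]; exact h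
  have hQ : ∀ (n : ℤ) (r : ℝ), (((rotation one_pos h0 h1 e).T ^ n) z : ℝ) = r → 1 - θ ≤ r →
      x n = q := fun n r hr h => by
    rw [rotation_letter hx (i := 1) rfl, hq]
    · rw [Fin.val_one, hm1, hr]; exact h
    · rw [Fin.val_one, hm2]; exact (((rotation one_pos h0 h1 e).T ^ n) z).2.2
  have hword : ∀ (n : ℤ) (a b c : A), x n = a → x (n + 1) = b → x (n + 2) = c →
      [a, b, c] ∈ language x := by
    rintro n a b c rfl rfl rfl
    exact ⟨n, 3, by rw [window_succ, window_succ, window_one]; simp [add_assoc]⟩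
  have hfr : ∀ r : ℝ, 0 ≤ r → r < 1 → Int.fract r = r := fun r h h' => Int.fract_eq_self.2 ⟨h, h'⟩
  have hfr1 : ∀ r : ℝ, 1 ≤ r → r < 2 → Int.fract r = r - 1 := fun r h h' =>
    Int.fract_eq_iff.2 ⟨by linarith, by linarith, 1, by push_cast; ring⟩
  have hstart := fun (p q : ℝ) (hp : 0 ≤ p) (hpq : p < q) (hq : q ≤ 1) =>
    exists_rotation_start (hk := one_pos) (h0 := h0) (h1 := h1) (e := e) hθ hp hpq hq z
  have hsplit : ∀ (n : ℤ) (r : ℝ), (∀ t : ℕ, (((rotation one_pos h0 h1 e).T ^ (n + t)) z : ℝ) =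
      Int.fract (r + t * θ)) → (((rotation one_pos h0 h1 e).T ^ n) z : ℝ) = Int.fract r ∧
      (((rotation one_pos h0 h1 e).T ^ (n + 1)) z : ℝ) = Int.fract (r + θ) ∧
      (((rotation one_pos h0 h1 e).T ^ (n + 2)) z : ℝ) = Int.fract (r + 2 * θ) := fun n r h =>
    ⟨by simpa using h 0, by simpa using h 1, by simpa using h 2⟩
  refine ⟨?_, ?_, ?_, ?_⟩
  · obtain ⟨n, r, hr1, hr2, hn⟩ := hstart 0 (1 - 3 * θ) le_rfl (by linarith) (by linarith)
    obtain ⟨e0, e1, e2⟩ := hsplit n r hn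
    rw [hfr _ (by linarith) (by linarith)] at e0 e1 e2
    exact hword n _ _ _ (hP _ _ e0 (by linarith)) (hP _ _ e1 (by linarith))
      (hP _ _ e2 (by linarith))
  · obtain ⟨n, r, hr1, hr2, hn⟩ := hstart (1 - 3 * θ) (1 - 2 * θ) (by linarith) (by linarith)
      (by linarith)
    obtain ⟨e0, e1, e2⟩ := hsplit n r hn
    rw [hfr _ (by linarith) (by linarith)] at e0 e1 e2
    exact hword n _ _ _ (hP _ _ e0 (by linarith)) (hP _ _ e1 (by linarith))
      (hQ _ _ e2 (by linarith))
  · obtain ⟨n, r, hr1, hr2, hn⟩ := hstart (1 - θ) 1 (by linarith) (by linarith) le_rfl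
    obtain ⟨e0, e1, e2⟩ := hsplit n r hn
    rw [hfr _ (by linarith) (by linarith)] at e0
    rw [hfr1 _ (by linarith) (by linarith)] at e1 e2
    exact hword n _ _ _ (hQ _ _ e0 (by linarith)) (hP _ _ e1 (by linarith))
      (hP _ _ e2 (by linarith))
  · obtain ⟨n, r, hr1, hr2, hn⟩ := hstart (1 - 2 * θ) (1 - θ) (by linarith) (by linarith)
      (by linarith)
    obtain ⟨e0, e1, e2⟩ := hsplit n r hn
    rw [hfr _ (by linarith) (by linarith)] at e0 e1
    rw [hfr1 _ (by linarith) (by linarith)] at e2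
    exact hword n _ _ _ (hP _ _ e0 (by linarith)) (hQ _ _ e1 (by linarith))
      (hP _ _ e2 (by linarith))

end IntervalExchange
end RIET

/-! ### Counting the factors of images -/

namespace RIET

section Counting

variable {A B : Type*}

/-- To the right of the image of `b`, the image of `⋯ a a . b c c ⋯` is periodic. -/
theorem IsImage.stepWord_right {u : A → List B} (hu : ∀ a, u a ≠ []) {a b c : A} {y : ℤ → B}
    (h : IsImage u (stepWord a b c) y) {m : ℤ} (hm : (u b).length ≤ m) :
    y (m + (u c).length) = y m := by
  obtain ⟨s, hs0, hs, hy⟩ := h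
  have hmono := cut_strictMono hu hs
  obtain ⟨n, h1, h2⟩ := exists_cut_le_lt hmono m
  have hs1 : s 1 = (u b).length := by
    have := hs 0
    simpa [hs0, stepWord] using this
  have hn : 1 ≤ n := by
    by_contra hn
    have := hmono.monotone (show n + 1 ≤ 1 by omega)
    omega
  have hx : ∀ n : ℤ, 1 ≤ n → stepWord a b c n = c := fun n hn => by
    simp [stepWord, show ¬ n < 0 by omega, show n ≠ 0 by omega]
  have e1 := hy n
  have e2 := hy (n + 1)
  have e3 := hs n
  rw [hx n hn] at e1 e3
  rw [hx (n + 1) (by omega)] at e2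
  have := window_eq_iff.1 (e2.trans e1.symm) (m - s n).toNat (by omega)
  rw [e3] at this
  rwa [show s n + (u c).length + ((m - s n).toNat : ℤ) = m + (u c).length by omega,
    show s n + ((m - s n).toNat : ℤ) = m by omega] at this

/-- To the left of the origin, the image of `⋯ a a . b c c ⋯` is periodic. -/
theorem IsImage.stepWord_left {u : A → List B} (hu : ∀ a, u a ≠ []) {a b c : A} {y : ℤ → B}
    (h : IsImage u (stepWord a b c) y) {m : ℤ} (hm : m + (u a).length < 0) :
    y (m + (u a).length) = y m := by
  obtain ⟨s, hs0, hs, hy⟩ := h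
  have hmono := cut_strictMono hu hs
  obtain ⟨n, h1, h2⟩ := exists_cut_le_lt hmono m
  have hx : ∀ n : ℤ, n < 0 → stepWord a b c n = a := fun n hn => if_pos hn
  have hn : n < 0 := by
    by_contra hn
    have := hmono.monotone (show 0 ≤ n by omega)
    omega
  have e1 := hy n
  have e3 := hs n
  rw [hx n hn] at e1 e3
  have hn' : n + 1 < 0 := by
    by_contra hn
    have := hmono.monotone (show 0 ≤ n + 1 by omega)
    omega
  have e2 := hy (n + 1)
  rw [hx (n + 1) hn'] at e2
  have := window_eq_iff.1 (e2.trans e1.symm) (m - s n).toNat (by omega)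
  rw [e3] at this
  rwa [show s n + (u a).length + ((m - s n).toNat : ℤ) = m + (u a).length by omega,
    show s n + ((m - s n).toNat : ℤ) = m by omega] at this

/-- The image of an eventually constant word has all its factors of length `n` near the origin. -/
theorem IsImage.stepWord_window {u : A → List B} (hu : ∀ a, u a ≠ []) {a b c : A} {y : ℤ → B}
    (h : IsImage u (stepWord a b c) y) {K : ℕ} (hK : ∀ a, (u a).length ≤ K) (n : ℕ) (j : ℤ) :
    ∃ j' ∈ Finset.Icc (-(n : ℤ) - K) (2 * K), window y j' n = window y j n := by
  -- outside of the given interval, a period brings the factor closer to the origin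
  induction hN : j.natAbs using Nat.strong_induction_on generalizing j with
  | _ N ih =>
    by_cases hj : j ∈ Finset.Icc (-(n : ℤ) - K) (2 * K)
    · exact ⟨j, hj, rfl⟩
    rw [Finset.mem_Icc, not_and_or, not_le, not_le] at hj
    have ha := List.length_pos_iff.2 (hu a)
    have hc := List.length_pos_iff.2 (hu c)
    have hKa := hK a
    have hKb := hK b
    have hKc := hK c
    rcases hj with hj | hj
    · obtain ⟨j', hj', hw⟩ := ih _ (by omega) (j + (u a).length) rfl
      refine ⟨j', hj', hw.trans (window_eq_iff.2 fun k hk => ?_)⟩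
      rw [← h.stepWord_left hu (m := j + k) (by omega)]
      congr 1; ring
    · obtain ⟨j', hj', hw⟩ := ih _ (by omega) (j - (u c).length) rfl
      refine ⟨j', hj', hw.trans (window_eq_iff.2 fun k hk => ?_)⟩
      rw [← h.stepWord_right hu (m := j - (u c).length + k) (by omega)]
      congr 1; ring

/-- If the short factors of `x` are factors of one of finitely many eventually constant words,
the number of factors of length `n` of its images is at most linear in `n`. -/
theorem ncard_imageLanguage_le {ι : Type*} [Fintype ι] {u : A → List B} (hu : ∀ a, u a ≠ [])
    {K : ℕ} (hK : ∀ a, (u a).length ≤ K) {x : ℤ → A} (a b c : ι → A) (n : ℕ)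
    (hx : ∀ j, ∃ (i : ι) (s : ℤ),
      window x j (n + 1) = window (stepWord (a i) (b i) (c i)) s (n + 1)) :
    {w ∈ imageLanguage u x | w.length = n}.ncard ≤ Fintype.card ι * (n + 3 * K + 1) := by
  classical
  obtain ⟨y, hy⟩ := exists_isImage hu x
  choose Y hY using fun i => exists_isImage hu (stepWord (a i) (b i) (c i))
  set F : Finset (List B) := ((Finset.univ : Finset ι) ×ˢ Finset.Icc (-(n : ℤ) - K) (2 * K)).image
    fun p => window (Y p.1) p.2 n with hF
  have hsub : {w ∈ imageLanguage u x | w.length = n} ⊆ (F : Set (List B)) := by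
    rintro w ⟨hw, rfl⟩
    rw [← hy.language_eq hu] at hw
    obtain ⟨p, k, -, hk⟩ := hy.exists_cover hu hw
    obtain ⟨i, s, his⟩ := hx p
    rw [his] at hk
    have hwY : w ∈ language (Y i) := by
      rw [(hY i).language_eq hu]
      exact ⟨_, window_mem_language _ _ _, hk.isInfix.trans (List.drop_suffix _ _).isInfix⟩
    obtain ⟨j, hj⟩ := mem_language_iff.1 hwY
    obtain ⟨j', hj', hjj⟩ := (hY i).stepWord_window hu hK w.length j
    rw [Finset.mem_coe, hF, Finset.mem_image]
    exact ⟨(i, j'), by simpa using Finset.mem_Icc.1 hj', hjj.trans hj⟩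
  refine (Set.ncard_le_ncard hsub F.finite_toSet).trans ?_
  rw [Set.ncard_coe_finset]
  refine Finset.card_image_le.trans ?_
  rw [Finset.card_product, Finset.card_univ, Int.card_Icc]
  refine Nat.mul_le_mul_left _ ?_
  omega

/-- If arbitrarily long words `P` are prefixes of all the words `u(a) P`, the images under `u`
have boundedly many factors of each length. -/
theorem ncard_imageLanguage_le_of_prefix {u : A → List B} (hu : ∀ a, u a ≠ []) {K : ℕ}
    (hK : ∀ a, (u a).length ≤ K)
    (hP : ∀ N, ∃ P : List B, N ≤ P.length ∧ ∀ a, P <+: u a ++ P) (x : ℤ → A) (n : ℕ) :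
    {w ∈ imageLanguage u x | w.length = n}.ncard ≤ K := by
  classical
  obtain ⟨y, hy⟩ := exists_isImage hu x
  -- every image, continued by `P`, starts with `P`: a factor of length `n` is read in `P`, at a
  -- position smaller than the length of the image of a letter
  obtain ⟨P, hPl, hP⟩ := hP (K + n)
  have hPv : ∀ v : List A, P <+: v.flatMap u ++ P := by
    intro v
    induction v with
    | nil => simp
    | cons a v ih =>
      rw [List.flatMap_cons, List.append_assoc]
      exact (hP a).trans ((List.prefix_append_right_inj _).2 ih)
  set F : Finset (List B) := (Finset.range K).image fun k => (P.drop k).take n with hF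
  have hsub : {w ∈ imageLanguage u x | w.length = n} ⊆ (F : Set (List B)) := by
    rintro w ⟨hw, rfl⟩
    rw [← hy.language_eq hu] at hw
    obtain ⟨p, k, hkl, hk⟩ := hy.exists_cover hu hw
    have hkK := hkl.trans_le (hK _)
    rw [Finset.mem_coe, hF, Finset.mem_image]
    refine ⟨k, Finset.mem_range.2 hkK, ?_⟩
    set v := (window x p (w.length + 1)).flatMap u with hv
    have h1 : w <+: (v ++ P).drop k := by
      refine hk.trans ?_
      rw [List.drop_append]
      exact List.prefix_append _ _
    have h2 : P.drop k <+: (v ++ P).drop k := (hPv _).drop k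
    have h3 := List.prefix_of_prefix_length_le h1 h2 (by rw [List.length_drop]; omega)
    exact (List.prefix_iff_eq_take.1 h3).symm
  refine (Set.ncard_le_ncard hsub F.finite_toSet).trans ?_
  rw [Set.ncard_coe_finset]
  exact Finset.card_image_le.trans (by simp)

theorem exists_length_le [Fintype A] (u : A → List B) : ∃ K, ∀ a, (u a).length ≤ K :=
  ⟨Finset.univ.sup fun a => (u a).length, fun a => Finset.le_sup (f := fun a => (u a).length)
    (Finset.mem_univ a)⟩

theorem card_le_of_linear_bounds {b k C : ℕ} (h : ∀ n, (b - 1) * n + 1 ≤ k * (n + C)) :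
    b ≤ k + 1 := by
  by_contra hlt
  have h1 := h (k * C)
  have h2 : (k + 1) * (k * C) ≤ (b - 1) * (k * C) := Nat.mul_le_mul_right _ (by omega)
  nlinarith

end Counting

end RIET

/-! ### Conjugating a substitution to separate first and last letters -/

namespace RIET

section Marked

variable {A B : Type*}

/-- Conjugating by the longest word `P` that is a prefix of all the `u(a) P` produces images whose
first letters are not all equal. -/
theorem exists_conj_head [Nonempty A] {u : A → List B} (hu : ∀ a, u a ≠ [])
    (hP : ¬ ∀ N, ∃ P : List B, N ≤ P.length ∧ ∀ a, P <+: u a ++ P) :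
    ∃ (P : List B) (v : A → List B) (f : A → B), (∀ a, P ++ v a = u a ++ P) ∧
      (∀ a, ∃ t, v a = f a :: t) ∧ ∃ a b, f a ≠ f b := by
  push Not at hP
  obtain ⟨N, hN⟩ := hP
  set S : Set ℕ := {n | ∃ P : List B, P.length = n ∧ ∀ a, P <+: u a ++ P} with hS
  have hSb : BddAbove S := ⟨N, by
    rintro _ ⟨P, rfl, hP⟩
    by_contra h
    obtain ⟨a, ha⟩ := hN P (by omega)
    exact ha (hP a)⟩
  -- a common prefix of maximal length
  obtain ⟨P, hPl, hP⟩ := Nat.sSup_mem (s := S) ⟨0, [], rfl, fun a => by simp⟩ hSb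
  choose v hv using hP
  have hvne : ∀ a, v a ≠ [] := fun a h => by
    have h1 := congrArg List.length (hv a)
    simp only [h, List.append_nil, List.length_append] at h1
    have := List.length_pos_iff.2 (hu a)
    omega
  choose f t ht using fun a => List.exists_cons_of_ne_nil (hvne a)
  refine ⟨P, v, f, hv, fun a => ⟨t a, ht a⟩, ?_⟩
  by_contra hconst
  push Not at hconst
  obtain ⟨a₀⟩ := ‹Nonempty A›
  have hmem : P.length + 1 ∈ S := by
    refine ⟨P ++ [f a₀], by simp, fun a => ⟨t a ++ [f a₀], ?_⟩⟩
    rw [← List.append_assoc (u a), ← hv a, ht a, hconst a₀ a]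
    simp
  have := le_csSup hSb hmem
  omega

/-- Conjugating in the other direction, by the longest word `Q` that is a suffix of all the
`Q v(a)`, produces images whose last letters are not all equal. -/
theorem exists_conj_last {v : A → List B} {f : A → B} (hf : ∀ a, ∃ t, v a = f a :: t)
    (hne : ∃ a b, f a ≠ f b) :
    ∃ (Q : List B) (g : A → List B) (l : A → B), (∀ a, Q ++ v a = g a ++ Q) ∧
      (∀ a, ∃ t, g a = t ++ [l a]) ∧ ∃ a b, l a ≠ l b := by
  obtain ⟨a₀, b₀, hab⟩ := hne
  set S : Set ℕ := {n | ∃ Q : List B, Q.length = n ∧ ∀ a, Q <:+ Q ++ v a} with hS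
  have hSb : BddAbove S := ⟨(v a₀ ++ v b₀).length, by
    rintro _ ⟨Q, rfl, hQ⟩
    by_contra h
    -- otherwise `v a₀` and `v b₀` commute, although their first letters are different
    have h1 : ∀ a b, Q <:+ Q ++ (v a ++ v b) := fun a b => by
      rw [← List.append_assoc]
      exact (hQ b).trans ((List.suffix_append_self_iff).2 (hQ a))
    have h2 : v a₀ ++ v b₀ <:+ Q := List.suffix_of_suffix_length_le
      (List.suffix_append Q _) (h1 a₀ b₀) (by omega)
    have h3 : v b₀ ++ v a₀ <:+ Q := List.suffix_of_suffix_length_le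
      (List.suffix_append Q _) (h1 b₀ a₀) (by simp only [List.length_append] at *; omega)
    have h4 := (List.suffix_of_suffix_length_le h2 h3 (by simp [add_comm])).eq_of_length
      (by simp [add_comm])
    obtain ⟨t, ht⟩ := hf a₀
    obtain ⟨t', ht'⟩ := hf b₀
    rw [ht, ht'] at h4
    simp only [List.cons_append, List.cons.injEq] at h4
    exact hab h4.1⟩
  obtain ⟨Q, hQl, hQ⟩ := Nat.sSup_mem (s := S) ⟨0, [], rfl, fun a => by simp⟩ hSb
  choose g hg using hQ
  have hgne : ∀ a, g a ≠ [] := fun a h => by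
    have h1 := congrArg List.length (hg a)
    obtain ⟨t, ht⟩ := hf a
    simp [h, ht] at h1
  choose t l ht using fun a => List.eq_nil_or_concat' (g a) |>.resolve_left (hgne a)
  refine ⟨Q, g, l, fun a => (hg a).symm, fun a => ⟨t a, ht a⟩, ?_⟩
  by_contra hconst
  push Not at hconst
  have hmem : Q.length + 1 ∈ S := by
    refine ⟨l a₀ :: Q, by simp, fun a => ⟨l a₀ :: t a, ?_⟩⟩
    rw [List.cons_append, List.cons_append, ← hg a, ht a, hconst a₀ a]
    simp
  have := le_csSup hSb hmem
  omega

/-- Around the common suffix `Q`, the image of `x` reproduces the words of length two of `x`. -/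
theorem cons_append_mem_imageLanguage {v g : A → List B} {f l : A → B} {Q : List B}
    (hf : ∀ a, ∃ t, v a = f a :: t) (hg : ∀ a, Q ++ v a = g a ++ Q)
    (hl : ∀ a, ∃ t, g a = t ++ [l a]) {x : ℤ → A} {s r : A} (h : [s, r] ∈ language x) :
    l s :: (Q ++ [f r]) ∈ imageLanguage v x := by
  have hv : ∀ a, v a ≠ [] := fun a h => by
    obtain ⟨t, ht⟩ := hf a
    simp [ht] at h
  obtain ⟨p, q, hp, hq, hx⟩ := exists_extension h Q.length 0
  obtain rfl := List.length_eq_zero_iff.1 hq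
  have hsuf : ∀ w : List A, Q <:+ Q ++ w.flatMap v := by
    intro w
    induction w using List.reverseRecOn with
    | nil => simp
    | append_singleton w a ih =>
      rw [List.flatMap_append, ← List.append_assoc]
      refine List.IsSuffix.trans ⟨g a, ?_⟩ ((List.suffix_append_self_iff).2 ih)
      rw [← hg]
      simp
  have h1 := length_le_length_flatMap hv p
  obtain ⟨X, hX⟩ := List.suffix_of_suffix_length_le (hsuf p) (List.suffix_append Q _) (by omega)
  obtain ⟨t, ht⟩ := hf r
  obtain ⟨t', ht'⟩ := hl s
  refine ⟨_, hx, X ++ t', t, ?_⟩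
  have h2 := hg s
  rw [ht'] at h2
  simp only [List.append_nil, List.flatMap_append, List.flatMap_cons, List.flatMap_nil, ← hX, ht]
  rw [show X ++ Q ++ (v s ++ f r :: t) = X ++ (Q ++ v s) ++ f r :: t by simp, h2]
  simp

end Marked

/-! ### Consequences of the order condition -/

section Order

variable {A B : Type*}

theorem OrderCompatible.dual {𝓛 : Set (List B)} {L R : LinearOrder B}
    (h : OrderCompatible 𝓛 L R) :
    OrderCompatible 𝓛 (@OrderDual.instLinearOrder B L) (@OrderDual.instLinearOrder B R) :=
  fun w a a' b b' h1 h2 hlt => h w a' a b' b h2 h1 hlt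

/-- The extension graphs of an order compatible language contain no cycle of length four. -/
theorem OrderCompatible.not_square {𝓛 : Set (List B)} {L R : LinearOrder B}
    (h : OrderCompatible 𝓛 L R) (w : List B) {a a' b b' : B} (ha : a ≠ a') (hb : b ≠ b')
    (h1 : a :: (w ++ [b]) ∈ 𝓛) (h2 : a :: (w ++ [b']) ∈ 𝓛) (h3 : a' :: (w ++ [b]) ∈ 𝓛)
    (h4 : a' :: (w ++ [b']) ∈ 𝓛) : False := by
  rcases @lt_or_gt_of_ne _ L _ _ ha with hlt | hlt
  · exact hb (R.le_antisymm _ _ (h w _ _ _ _ h1 h4 hlt) (h w _ _ _ _ h2 h3 hlt))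
  · exact hb (R.le_antisymm _ _ (h w _ _ _ _ h3 h2 hlt) (h w _ _ _ _ h4 h1 hlt))

theorem exists_equiv_of_three {ι A : Type*} [DecidableEq A] (e₀ : ι ≃ A) {i₁ i₂ i₃ : ι}
    {a₁ a₂ a₃ : A} (h12 : i₁ ≠ i₂) (h13 : i₁ ≠ i₃) (h23 : i₂ ≠ i₃) (g12 : a₁ ≠ a₂) (g13 : a₁ ≠ a₃)
    (g23 : a₂ ≠ a₃) : ∃ e : ι ≃ A, e i₁ = a₁ ∧ e i₂ = a₂ ∧ e i₃ = a₃ := by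
  set e₁ : ι ≃ A := e₀.trans (Equiv.swap (e₀ i₁) a₁) with he₁
  have h1 : e₁ i₁ = a₁ := by simp [he₁]
  set e₂ : ι ≃ A := e₁.trans (Equiv.swap (e₁ i₂) a₂) with he₂
  have h21 : e₂ i₁ = a₁ := by
    rw [he₂, Equiv.trans_apply, h1, Equiv.swap_apply_of_ne_of_ne _ g12]
    rw [← h1]; exact e₁.injective.ne h12
  have h22 : e₂ i₂ = a₂ := by simp [he₂]
  refine ⟨e₂.trans (Equiv.swap (e₂ i₃) a₃), ?_, ?_, by simp⟩
  · rw [Equiv.trans_apply, h21, Equiv.swap_apply_of_ne_of_ne _ g13]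
    rw [← h21]; exact e₂.injective.ne h13
  · rw [Equiv.trans_apply, h22, Equiv.swap_apply_of_ne_of_ne _ g23]
    rw [← h22]; exact e₂.injective.ne h23

/-- The relation `E` holds between the letters that follow each other in a rotation of small
angle in which the intervals of the letters are in the order `e 0, e 1, …`, the last of them being
too short for its letter to follow itself. -/
structure RotationPairs {k : ℕ} (e : Fin (k + 1) ≃ A) (E : A → A → Prop) : Prop where
  self : ∀ i : Fin k, E (e i.castSucc) (e i.castSucc)
  succ : ∀ i : Fin k, E (e i.castSucc) (e i.succ)
  last : E (e (Fin.last k)) (e 0)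

variable {k : ℕ} {f l : A → B} {Q : List B} {𝓛 : (Fin (k + 1) ≃ A) → Set (List B)}

/-- The first letters `f` after `Q`, and the last letters `l` before `Q`, are pairwise distinct:
two letters with the same `f`, or the same `l`, can be placed in the rotation so as to produce a
cycle of length four in the extension graph of `Q`. -/
theorem injective_of_rotationPairs (hk : 2 ≤ k) (e₀ : Fin (k + 1) ≃ A)
    (hO : ∀ e, ∃ L R, OrderCompatible (𝓛 e) L R)
    (hE : ∀ e, RotationPairs e fun s r => l s :: (Q ++ [f r]) ∈ 𝓛 e)
    (hf : ∃ a b, f a ≠ f b) (hl : ∃ a b, l a ≠ l b) :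
    Function.Injective f ∧ Function.Injective l := by
  classical
  obtain ⟨j, rfl⟩ : ∃ j, k = j + 2 := ⟨k - 2, by omega⟩
  -- two letters with the same `f`, at distance two in the rotation
  have claim1 : ∀ p q m, f p = f q → p ≠ q → m ≠ p → m ≠ q → f m = f p ∨ l m = l p := by
    intro p q m hpq h1 h2 h3
    obtain ⟨e, rfl, rfl, rfl⟩ := exists_equiv_of_three e₀ (i₁ := 0) (i₂ := 1)
      (i₃ := Fin.succ 1) (by simp) (Fin.succ_ne_zero _).symm
      ((Fin.succ_injective _).ne (show (0 : Fin (j + 2)) ≠ 1 by simp))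
      h2.symm h1 h3
    obtain ⟨L, R, h⟩ := hO e
    have E1 := (hE e).self 0
    have E2 := (hE e).succ 0
    have E3 := (hE e).self 1
    have E4 := (hE e).succ 1
    change l (e 0) :: (Q ++ [f (e 0)]) ∈ _ at E1
    change l (e 0) :: (Q ++ [f (e 1)]) ∈ _ at E2
    change l (e 1) :: (Q ++ [f (e 1)]) ∈ _ at E3
    change l (e 1) :: (Q ++ [f (e (Fin.succ 1))]) ∈ _ at E4
    rw [← hpq] at E4
    by_contra hcon
    push Not at hcon
    exact h.not_square Q hcon.2.symm hcon.1.symm E1 E2 E4 E3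
  -- two letters with the same `l`, the first one in the last interval
  have claim2 : ∀ p m n, l p = l m → p ≠ m → n ≠ p → n ≠ m → l n = l p ∨ f n = f m := by
    intro p m n hpm h1 h2 h3
    obtain ⟨e, rfl, rfl, rfl⟩ := exists_equiv_of_three e₀ (i₁ := Fin.last (j + 2)) (i₂ := 0)
      (i₃ := 1) (by simp [Fin.ext_iff]) (by simp [Fin.ext_iff]) (by simp)
      h2.symm h1 h3
    obtain ⟨L, R, h⟩ := hO e
    have E1 := (hE e).last
    have E2 := (hE e).self 0
    have E3 := (hE e).succ 0
    have E4 := (hE e).self 1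
    change l (e 0) :: (Q ++ [f (e 0)]) ∈ _ at E2
    change l (e 0) :: (Q ++ [f (e 1)]) ∈ _ at E3
    change l (e 1) :: (Q ++ [f (e 1)]) ∈ _ at E4
    rw [hpm] at E1
    by_contra hcon
    push Not at hcon
    rw [hpm] at hcon
    exact h.not_square Q hcon.1 hcon.2 E2 E3 E1 E4
  have hfi : Function.Injective f := by
    intro p q hpq
    by_contra hne
    obtain ⟨m, hm⟩ : ∃ m, f m ≠ f p := by
      by_contra hall
      push Not at hall
      obtain ⟨a, b, hab⟩ := hf
      exact hab ((hall a).trans (hall b).symm)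
    have hmp : m ≠ p := fun h => hm (by rw [h])
    have hmq : m ≠ q := fun h => hm (by rw [h, hpq])
    have hlp : l m = l p := (claim1 p q m hpq hne hmp hmq).resolve_left hm
    have hlc : ∀ n, l n = l p := by
      intro n
      by_cases h1 : n = p
      · rw [h1]
      by_cases h2 : n = m
      · rw [h2, hlp]
      rcases claim2 p m n hlp.symm hmp.symm h1 h2 with h | h
      · exact h
      · rcases claim2 m p n hlp hmp h2 h1 with h' | h'
        · exact h'.trans hlp
        · exact absurd (h.symm.trans h') hm
    obtain ⟨a, b, hab⟩ := hl
    exact hab ((hlc a).trans (hlc b).symm)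
  refine ⟨hfi, fun p q hpq => ?_⟩
  by_contra hne
  obtain ⟨m, hm⟩ : ∃ m, l m ≠ l p := by
    by_contra hall
    push Not at hall
    obtain ⟨a, b, hab⟩ := hl
    exact hab ((hall a).trans (hall b).symm)
  have hmp : m ≠ p := fun h => hm (by rw [h])
  have hmq : m ≠ q := fun h => hm (by rw [h, hpq])
  exact hmq (hfi ((claim2 p q m hpq hne hmp hmq).resolve_left hm))

/-- If `Q` is not empty, its last letter `l s` is extremal among the left extensions of the empty
word, so that `s` is extremal for the order of the left extensions in the rotation: it cannot be
the letter `e 0`. -/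
theorem eq_nil_of_rotationPairs (hk : 2 ≤ k) (e₀ : Fin (k + 1) ≃ A)
    (hinf : ∀ e v w, w <:+: v → v ∈ 𝓛 e → w ∈ 𝓛 e)
    (hO : ∀ e, ∃ L R, OrderCompatible (𝓛 e) L R)
    (hE : ∀ e, RotationPairs e fun s r => l s :: (Q ++ [f r]) ∈ 𝓛 e)
    (hf : Function.Injective f) (hl : Function.Bijective l) : Q = [] := by
  classical
  obtain ⟨j, rfl⟩ : ∃ j, k = j + 2 := ⟨k - 2, by omega⟩
  by_contra hQ
  obtain ⟨a, t, hat⟩ := List.exists_cons_of_ne_nil hQ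
  obtain ⟨t', b, hbt⟩ := (List.eq_nil_or_concat' Q).resolve_left hQ
  obtain ⟨s, rfl⟩ := hl.2 b
  obtain ⟨e, he⟩ : ∃ e : Fin (j + 2 + 1) ≃ A, e 0 = s :=
    ⟨e₀.trans (Equiv.swap (e₀ 0) s), by simp⟩
  have E0 := (hE e).last
  have E1 := (hE e).self 0
  have E2 := (hE e).succ 0
  have E3 := (hE e).self 1
  change l (e 0) :: (Q ++ [f (e 0)]) ∈ _ at E1
  change l (e 0) :: (Q ++ [f (e 1)]) ∈ _ at E2
  change l (e 1) :: (Q ++ [f (e 1)]) ∈ _ at E3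
  set c := e (Fin.last (j + 2)) with hc
  have hce : c ≠ e 0 := e.injective.ne (by simp [Fin.ext_iff])
  have h10 : e 1 ≠ e 0 := e.injective.ne (by simp)
  -- the letters around the ends of `Q`: the words `l s a`, where `a` is the first letter of `Q`,
  -- and `l (e 0) f r`, since `l (e 0)` is the last letter of `Q`
  have hleft : ∀ s r, l s :: (Q ++ [f r]) ∈ 𝓛 e → [l s, a] ∈ 𝓛 e := fun s r h =>
    hinf e _ _ ⟨[], t ++ [f r], by rw [hat]; simp⟩ h
  have hright : ∀ s' r, l s' :: (Q ++ [f r]) ∈ 𝓛 e → [l (e 0), f r] ∈ 𝓛 e := fun s' r h =>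
    hinf e _ _ ⟨l s' :: t', [], by rw [hbt, he]; simp⟩ h
  have G0 := hright _ _ E1
  have G1 := hright _ _ E2
  have Gc := hleft _ _ E0
  have G1' := hleft _ _ E3
  have key : ∀ L R : LinearOrder B, OrderCompatible (𝓛 e) L R → L.lt (l c) (l (e 0)) → False := by
    intro L R h hlt
    have hne : l (e 1) ≠ l (e 0) := fun h => h10 (hl.1 h)
    -- either the extensions of `Q` are not monotone, or those of the empty word are not
    rcases @lt_or_gt_of_ne _ L _ _ hne with h1 | h1
    · exact h10 (hf (R.le_antisymm _ _ (h Q _ _ _ _ E3 E1 h1) (h Q _ _ _ _ E0 E2 hlt)))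
    · have := (h [] _ _ _ _ G0 G1' h1)
      exact h10 (hf (R.le_antisymm _ _
        (R.le_trans _ _ _ (h [] _ _ _ _ G1 G1' h1) (h [] _ _ _ _ Gc G0 hlt))
        (R.le_trans _ _ _ (h [] _ _ _ _ G0 G1' h1) (h [] _ _ _ _ Gc G1 hlt))))
  obtain ⟨L, R, h⟩ := hO e
  have hne : l c ≠ l (e 0) := fun h => hce (hl.1 h)
  rcases @lt_or_gt_of_ne _ L _ _ hne with h1 | h1
  · exact key L R h h1
  · exact key _ _ h.dual h1

/-- When `Q` is empty, no word of length two is common to all the languages. -/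
theorem not_forall_mem_of_rotationPairs (hk : 2 ≤ k) (e₀ : Fin (k + 1) ≃ A)
    (hO : ∀ e, ∃ L R, OrderCompatible (𝓛 e) L R)
    (hE : ∀ e, RotationPairs e fun s r => [l s, f r] ∈ 𝓛 e)
    (hf : Function.Injective f) (hl : Function.Injective l) (s r : A) :
    ¬ ∀ e, [l s, f r] ∈ 𝓛 e := by
  classical
  obtain ⟨j, rfl⟩ : ∃ j, k = j + 2 := ⟨k - 2, by omega⟩
  intro hall
  by_cases hsr : s = r
  · -- when `s = r`, this letter is placed in the last interval: starting from `e 0`, all the other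
    -- letters are on the same side of it for the order of the left extensions
    subst hsr
    obtain ⟨e, rfl⟩ : ∃ e : Fin (j + 2 + 1) ≃ A, e (Fin.last (j + 2)) = s :=
      ⟨e₀.trans (Equiv.swap (e₀ (Fin.last (j + 2))) s), by simp⟩
    set c := e (Fin.last (j + 2)) with hc
    have Ecc := hall e
    have E0 := (hE e).last
    have hne : ∀ i : Fin (j + 2), e i.castSucc ≠ c := fun i =>
      e.injective.ne (by rw [Ne, Fin.ext_iff, Fin.val_castSucc, Fin.val_last]; exact i.2.ne)
    have key : ∀ L R : LinearOrder B, OrderCompatible (𝓛 e) L R →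
        L.lt (l c) (l (e 0)) → False := by
      intro L R h hlt
      have hi : ∀ i : ℕ, ∀ hi : i < j + 2, L.lt (l c) (l (e (Fin.castSucc ⟨i, hi⟩))) := by
        intro i
        induction i with
        | zero => exact fun _ => hlt
        | succ i ih =>
          intro hi
          have h1 := ih (by omega)
          have h2 := h [] _ _ _ _ Ecc ((hE e).succ ⟨i, by omega⟩) h1
          rcases @lt_or_gt_of_ne _ L _ _ (fun h => hne ⟨i + 1, hi⟩ (hl h)) with h3 | h3
          · have h4 := h [] _ _ _ _ ((hE e).self ⟨i + 1, hi⟩) Ecc h3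
            exact absurd (hf (R.le_antisymm _ _ h4 h2)) (hne ⟨i + 1, hi⟩)
          · exact h3
      have h1 := h [] _ _ _ _ E0 ((hE e).succ ⟨j + 1, by omega⟩) (hi (j + 1) (by omega))
      have h2 := h [] _ _ _ _ Ecc ((hE e).self 0) hlt
      exact hne 0 (hf (R.le_antisymm _ _ h1 h2))
    obtain ⟨L, R, h⟩ := hO e
    rcases @lt_or_gt_of_ne _ L _ _ (fun h => hne 0 (hl h)) with h1 | h1
    · exact key _ _ h.dual h1
    · exact key L R h h1
  · -- otherwise the intervals of `r` and `s` are placed first, which produces a cycle of length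
    -- four
    obtain ⟨e, he0, he1⟩ : ∃ e : Fin (j + 2 + 1) ≃ A, e 0 = r ∧ e 1 = s := by
      set e₁ := e₀.trans (Equiv.swap (e₀ 0) r) with he₁
      have h0 : e₁ 0 = r := by simp [he₁]
      refine ⟨e₁.trans (Equiv.swap (e₁ 1) s), ?_, by simp⟩
      rw [Equiv.trans_apply, h0, Equiv.swap_apply_of_ne_of_ne _ (Ne.symm hsr)]
      rw [← h0]
      exact e₁.injective.ne (by simp)
    have E1 := (hE e).self 0
    have E2 := (hE e).succ 0
    have E3 := (hE e).self 1
    change [l (e 0), f (e 0)] ∈ _ at E1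
    change [l (e 0), f (e 1)] ∈ _ at E2
    change [l (e 1), f (e 1)] ∈ _ at E3
    rw [he0] at E1 E2
    rw [he1] at E2 E3
    obtain ⟨L, R, h⟩ := hO e
    exact h.not_square [] (fun h => hsr (hl h).symm) (fun h => hsr (hf h).symm) E1 E2 (hall e) E3

end Order

/-! ### Morphisms on at least three letters -/

section ThreeLetters

variable {A B : Type*} [Fintype A] [Fintype B]

open IntervalExchange

/-- The rotations of small angle give codings whose words of length two are prescribed by `e`, and
whose words of length `m` are factors of eventually constant words. -/
theorem exists_rotation_word {k : ℕ} (hk : 0 < k) (e : Fin (k + 1) ≃ A) (m : ℕ) :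
    ∃ x : ℤ → A, IsRIETCoding x ∧ RotationPairs e (fun a b => [a, b] ∈ language x) ∧
      ∀ j, ∃ (i : Fin k) (s : ℤ), window x j m = window (stepWord (e i.castSucc) (e i.succ)
        (if (i : ℕ) + 1 = k then e 0 else e i.succ)) s m := by
  have hk0 : (0 : ℝ) < k := by exact_mod_cast hk
  obtain ⟨θ, hθ, h0, h1⟩ := exists_irrational_btwn
    (show (0 : ℝ) < 1 / (k * (m + 2)) by positivity)
  rw [lt_div_iff₀ (by positivity)] at h1
  have hm : (0 : ℝ) ≤ m * (k * θ) := by positivity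
  have hkθ : (0 : ℝ) < k * θ := by positivity
  have h2 : (k : ℝ) * θ < 1 := by nlinarith
  obtain ⟨x, hx⟩ := exists_isCodingOf (rotation hk h0 h2 e) ⟨0, le_rfl, one_pos⟩
  obtain ⟨p1, p2, p3⟩ := rotation_pairs hθ (by nlinarith) hx
  exact ⟨x, ⟨_, rotation_isRegular hθ, _, hx⟩, ⟨p1, p2, p3⟩,
    fun j => rotation_window (by linarith) hx j⟩

theorem IsRIETCoding.exists_orderCompatible {x : ℤ → A} (hx : IsRIETCoding x) :
    ∃ L R, OrderCompatible (language x) L R := by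
  obtain ⟨D, -, z, hz⟩ := hx
  exact ⟨_, _, D.orderCompatible_of_isCodingOf hz⟩

theorem IsRIETCoding.le_ncard [Nontrivial A] {x : ℤ → A} (hx : IsRIETCoding x) (n : ℕ) :
    (Fintype.card A - 1) * n + 1 ≤ {w ∈ language x | w.length = n}.ncard := by
  obtain ⟨D, hD, z, hz⟩ := hx
  exact hD.le_ncard_language hz n

/-- The images of the codings of rotations of small angle have at most `(|A| - 1) n + O(1)` factors
of length `n`, and the codings of regular interval exchanges over `B` have at least
`(|B| - 1) n + 1`. -/
theorem RIETPreserving.card_le [Nontrivial A] [Nontrivial B] {σ : FreeMonoid A →* FreeMonoid B}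
    {hσ : NonErasing σ} (h : RIETPreserving σ hσ) : Fintype.card B ≤ Fintype.card A := by
  have hA : 1 < Fintype.card A := Fintype.one_lt_card
  obtain ⟨k, hk⟩ : ∃ k, Fintype.card A = k + 1 := ⟨Fintype.card A - 1, by omega⟩
  obtain ⟨K, hK⟩ := exists_length_le (letterImage σ)
  rw [hk]
  refine card_le_of_linear_bounds (C := 3 * K + 1) fun n => ?_
  obtain ⟨x, hx, -, hw⟩ := exists_rotation_word (show 0 < k by omega)
    (Fintype.equivFinOfCardEq hk).symm (n + 1)
  refine ((h x hx).le_ncard n).trans ?_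
  rw [language_biImage]
  have := ncard_imageLanguage_le hσ.letterImage_ne_nil hK _ _ _ n hw
  rwa [Fintype.card_fin] at this

/-- Otherwise the images would have boundedly many factors of each length. -/
theorem RIETPreserving.not_prefix [Nontrivial A] [Nontrivial B]
    {σ : FreeMonoid A →* FreeMonoid B} {hσ : NonErasing σ} (h : RIETPreserving σ hσ) :
    ¬ ∀ N, ∃ P : List B, N ≤ P.length ∧ ∀ a, P <+: letterImage σ a ++ P := by
  intro hP
  have hA : 1 < Fintype.card A := Fintype.one_lt_card
  have hB : 1 < Fintype.card B := Fintype.one_lt_card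
  obtain ⟨k, hk⟩ : ∃ k, Fintype.card A = k + 1 := ⟨Fintype.card A - 1, by omega⟩
  obtain ⟨K, hK⟩ := exists_length_le (letterImage σ)
  obtain ⟨x, hx, -⟩ := exists_rotation_word (show 0 < k by omega)
    (Fintype.equivFinOfCardEq hk).symm 0
  have h1 := (h x hx).le_ncard K
  rw [language_biImage] at h1
  have h2 := ncard_imageLanguage_le_of_prefix hσ.letterImage_ne_nil hK hP x K
  have h3 : 1 * K ≤ (Fintype.card B - 1) * K := Nat.mul_le_mul_right _ (by omega)
  omega

/-- After a conjugation the image of a letter `a` starts with `f a`, and `l s Q f r` occurs in the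
image of a word in which `s r` occurs. The order condition, for all the placements of the letters in
a rotation, shows that `f` and `l` are injective, that `Q` is empty, and that the images have a
single letter: two consecutive letters `l s` and `f r` inside the image of a letter would occur for
all the placements. -/
theorem RIETPreserving.isBijectiveCoding [Nontrivial B] {σ : FreeMonoid A →* FreeMonoid B}
    {hσ : NonErasing σ} (h : RIETPreserving σ hσ) (hA : 3 ≤ Fintype.card A) :
    IsBijectiveCoding σ := by
  have : Nontrivial A := Fintype.one_lt_card_iff_nontrivial.1 (by omega)
  obtain ⟨k, hk⟩ : ∃ k, Fintype.card A = k + 1 := ⟨Fintype.card A - 1, by omega⟩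
  have hk2 : 2 ≤ k := by omega
  have hu := hσ.letterImage_ne_nil
  set u := letterImage σ with hu_def
  obtain ⟨P, v, f, hPv, hfv, hfne⟩ := exists_conj_head hu h.not_prefix
  obtain ⟨Q, g, l, hQg, hlg, hlne⟩ := exists_conj_last hfv hfne
  choose x hx hpairs _ using fun e : Fin (k + 1) ≃ A =>
    exists_rotation_word (show 0 < k by omega) e 0
  set e₀ := (Fintype.equivFinOfCardEq hk).symm
  have hlang : ∀ e, imageLanguage v (x e) = language (biImage σ hσ (x e)) := fun e => by
    rw [language_biImage, imageLanguage_conj hPv hu]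
  have hO : ∀ e, ∃ L R, OrderCompatible (imageLanguage v (x e)) L R := fun e => by
    rw [hlang]
    exact (h _ (hx e)).exists_orderCompatible
  have hE : ∀ e, RotationPairs e fun s r => l s :: (Q ++ [f r]) ∈ imageLanguage v (x e) :=
    fun e => ⟨fun i => cons_append_mem_imageLanguage hfv hQg hlg ((hpairs e).self i),
      fun i => cons_append_mem_imageLanguage hfv hQg hlg ((hpairs e).succ i),
      cons_append_mem_imageLanguage hfv hQg hlg (hpairs e).last⟩
  obtain ⟨hf, hl⟩ := injective_of_rotationPairs hk2 e₀ hO hE hfne hlne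
  have hcard : Fintype.card A = Fintype.card B :=
    le_antisymm (Fintype.card_le_of_injective f hf) h.card_le
  have hfb := (Fintype.bijective_iff_injective_and_card f).2 ⟨hf, hcard⟩
  have hlb := (Fintype.bijective_iff_injective_and_card l).2 ⟨hl, hcard⟩
  obtain rfl := eq_nil_of_rotationPairs hk2 e₀ (fun e v w => imageLanguage_of_infix) hO hE hf hlb
  have hv1 : ∀ a, v a = [f a] := by
    intro a
    obtain ⟨t, ht⟩ := hfv a
    cases t with
    | nil => exact ht
    | cons b t =>
      obtain ⟨s, hs⟩ := hlb.2 (f a)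
      obtain ⟨r, hr⟩ := hfb.2 b
      refine absurd (fun e => ?_)
        (not_forall_mem_of_rotationPairs hk2 e₀ hO hE hf hl s r)
      obtain ⟨i, hi⟩ : ∃ i, x e i = a := by
        obtain ⟨j, rfl⟩ := e.surjective a
        have hmem : ∃ w ∈ language (x e), e j ∈ w := by
          rcases Fin.eq_castSucc_or_eq_last j with ⟨i, rfl⟩ | rfl
          · exact ⟨_, (hpairs e).self i, by simp⟩
          · exact ⟨_, (hpairs e).last, by simp⟩
        obtain ⟨_, ⟨i, n, rfl⟩, hw⟩ := hmem
        rw [window, List.mem_ofFn] at hw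
        obtain ⟨m, hm⟩ := hw
        exact ⟨_, hm⟩
      rw [hs, hr]
      refine ⟨[a], hi ▸ singleton_mem_language _ _, ⟨[], t, ?_⟩⟩
      simp [ht]
  have hu1 : ∀ a, (u a).length = 1 := fun a => by
    have := congrArg List.length (hPv a)
    rw [hv1] at this
    simp only [List.length_append, List.length_singleton] at this
    omega
  refine ⟨hu1, fun a b hab => ?_⟩
  have h1 : u a = u b := congrArg FreeMonoid.toList hab
  have h2 := hPv a
  rw [h1, ← hPv b, hv1, hv1] at h2
  exact hf (by simpa using List.append_cancel_left h2)

end ThreeLetters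

end RIET

/-! ### Extension graphs -/

namespace RIET

section Graph

variable {A B : Type*}

theorem mem_leftExt_iff {x : ℤ → A} {w : List A} {a : A} :
    a ∈ leftExt x w ↔ ∃ b, (a, b) ∈ biExt x w :=
  ⟨fun h => exists_extension_right (w := a :: w) h,
    fun ⟨b, h⟩ => language_of_infix ⟨[], [b], by simp⟩ h⟩

theorem mem_rightExt_iff {x : ℤ → A} {w : List A} {b : A} :
    b ∈ rightExt x w ↔ ∃ a, (a, b) ∈ biExt x w :=
  ⟨fun h => exists_extension_left (w := w ++ [b]) h,
    fun ⟨a, h⟩ => language_of_infix ⟨[a], [], by simp⟩ h⟩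

@[simp] theorem extensionGraph_adj_inl_inr {x : ℤ → A} {w : List A} {a : leftExt x w}
    {b : rightExt x w} :
    (extensionGraph x w).Adj (Sum.inl a) (Sum.inr b) ↔ ((a : A), (b : A)) ∈ biExt x w := by
  simp [extensionGraph, SimpleGraph.fromRel_adj]

@[simp] theorem extensionGraph_adj_inr_inl {x : ℤ → A} {w : List A} {a : leftExt x w}
    {b : rightExt x w} :
    (extensionGraph x w).Adj (Sum.inr b) (Sum.inl a) ↔ ((a : A), (b : A)) ∈ biExt x w := by
  rw [SimpleGraph.adj_comm, extensionGraph_adj_inl_inr]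

@[simp] theorem extensionGraph_not_adj_inl {x : ℤ → A} {w : List A} {a a' : leftExt x w} :
    ¬ (extensionGraph x w).Adj (Sum.inl a) (Sum.inl a') := by
  simp [extensionGraph, SimpleGraph.fromRel_adj]

@[simp] theorem extensionGraph_not_adj_inr {x : ℤ → A} {w : List A} {b b' : rightExt x w} :
    ¬ (extensionGraph x w).Adj (Sum.inr b) (Sum.inr b') := by
  simp [extensionGraph, SimpleGraph.fromRel_adj]

/-- The extension graphs of two words are isomorphic when their bi-extensions correspond to each
other under a bijection of the alphabets. -/
theorem extensionGraph_isTree_iff {x : ℤ → A} {y : ℤ → B} {v : List A} {w : List B} (φ : A ≃ B)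
    (h : ∀ a b, (a, b) ∈ biExt x v ↔ (φ a, φ b) ∈ biExt y w) :
    (extensionGraph x v).IsTree ↔ (extensionGraph y w).IsTree := by
  have hl : ∀ a, a ∈ leftExt x v ↔ φ a ∈ leftExt y w := fun a => by
    rw [mem_leftExt_iff, mem_leftExt_iff, ← φ.exists_congr_right]
    exact exists_congr fun b => h a b
  have hr : ∀ b, b ∈ rightExt x v ↔ φ b ∈ rightExt y w := fun b => by
    rw [mem_rightExt_iff, mem_rightExt_iff, ← φ.exists_congr_right]
    exact exists_congr fun a => h a b
  refine SimpleGraph.Iso.isTree_iff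
    ⟨Equiv.sumCongr (φ.subtypeEquiv hl) (φ.subtypeEquiv hr), ?_⟩
  rintro (a | a) (b | b)
  · simp
  · simp [h]
  · simp [h]
  · simp

theorem isDendric_congr {x y : ℤ → A} (h : language x = language y) :
    IsDendric x ↔ IsDendric y := by
  have key : ∀ w, (extensionGraph x w).IsTree ↔ (extensionGraph y w).IsTree := fun w =>
    extensionGraph_isTree_iff (Equiv.refl A) fun a b => by simp [biExt, h]
  simp only [IsDendric, h, key]

/-- A double star is a tree. -/
theorem extensionGraph_isTree_of_doubleStar {x : ℤ → A} {w : List A} {a b : A}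
    (hab : (a, b) ∈ biExt x w) (h : ∀ p ∈ biExt x w, p.1 = a ∨ p.2 = b) :
    (extensionGraph x w).IsTree := by
  set G := extensionGraph x w
  set va : leftExt x w := ⟨a, mem_leftExt_iff.2 ⟨b, hab⟩⟩
  set vb : rightExt x w := ⟨b, mem_rightExt_iff.2 ⟨a, hab⟩⟩
  have hadj : G.Adj (Sum.inl va) (Sum.inr vb) := extensionGraph_adj_inl_inr.2 hab
  -- the other vertices are leaves, adjacent to one of the two centres
  have hL : ∀ (a' : leftExt x w) (v), a' ≠ va → G.Adj (Sum.inl a') v → v = Sum.inr vb := by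
    rintro a' (c | c) hne hc
    · exact absurd hc extensionGraph_not_adj_inl
    · rcases h _ (extensionGraph_adj_inl_inr.1 hc) with h1 | h1
      · exact absurd (Subtype.ext h1) hne
      · exact congrArg Sum.inr (Subtype.ext h1)
  have hR : ∀ (b' : rightExt x w) (v), b' ≠ vb → G.Adj (Sum.inr b') v → v = Sum.inl va := by
    rintro b' (c | c) hne hc
    · rcases h _ (extensionGraph_adj_inr_inl.1 hc) with h1 | h1
      · exact congrArg Sum.inl (Subtype.ext h1)
      · exact absurd (Subtype.ext h1) hne
    · exact absurd hc extensionGraph_not_adj_inr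
  constructor
  · have hreach : ∀ v, G.Reachable (Sum.inl va) v := by
      rintro (a' | b')
      · by_cases ha : a' = va
        · rw [ha]
        · obtain ⟨c, hc⟩ := mem_leftExt_iff.1 a'.2
          have h1 : G.Adj (Sum.inl a') (Sum.inr ⟨c, mem_rightExt_iff.2 ⟨_, hc⟩⟩) :=
            extensionGraph_adj_inl_inr.2 hc
          rw [hL a' _ ha h1] at h1
          exact hadj.reachable.trans h1.symm.reachable
      · by_cases hb : b' = vb
        · rw [hb]
          exact hadj.reachable
        · obtain ⟨c, hc⟩ := mem_rightExt_iff.1 b'.2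
          have h1 : G.Adj (Sum.inr b') (Sum.inl ⟨c, mem_leftExt_iff.2 ⟨_, hc⟩⟩) :=
            extensionGraph_adj_inr_inl.2 hc
          rw [hR b' _ hb h1] at h1
          exact h1.symm.reachable
    have : Nonempty (leftExt x w ⊕ rightExt x w) := ⟨Sum.inl va⟩
    exact SimpleGraph.Connected.mk fun u v => (hreach u).symm.trans (hreach v)
  · intro u p hp
    -- a leaf is not on a cycle, and the two centres alone do not support a cycle
    have hleaf : ∀ v ∈ p.support, ∀ c, ¬ ∀ v', G.Adj v v' → v' = c := by
      intro v hv c hc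
      have h2 := hp.ncard_neighborSet_toSubgraph_eq_two hv
      have h1 : (p.toSubgraph.neighborSet v).ncard ≤ ({c} : Set _).ncard :=
        Set.ncard_le_ncard fun v' hv' => hc v' (p.toSubgraph.adj_sub hv')
      rw [Set.ncard_singleton] at h1
      omega
    have hsub : ∀ v ∈ p.support, v = Sum.inl va ∨ v = Sum.inr vb := by
      rintro (a' | b') hv
      · by_contra hne
        exact hleaf _ hv _ fun v' => hL a' v' fun h => hne (Or.inl (by rw [h]))
      · by_contra hne
        exact hleaf _ hv _ fun v' => hR b' v' fun h => hne (Or.inr (by rw [h]))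
    have hlen := hp.three_le_length
    have hnd := hp.support_nodup
    have hcount : p.support.tail.length ≤ [Sum.inl va, Sum.inr vb].length :=
      (hnd.subperm fun v hv => by simpa using hsub v (List.mem_of_mem_tail hv)).length_le
    rw [List.length_tail, SimpleGraph.Walk.length_support] at hcount
    simp only [List.length_cons, List.length_nil] at hcount
    omega

/-- The extension graphs of a dendric word contain no cycle of length four: it would give two paths
of length two with the same ends. -/
theorem IsDendric.not_square {x : ℤ → A} (h : IsDendric x) (w : List A) {a a' b b' : A}
    (ha : a ≠ a') (hb : b ≠ b') (h1 : a :: (w ++ [b]) ∈ language x)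
    (h2 : a :: (w ++ [b']) ∈ language x) (h3 : a' :: (w ++ [b]) ∈ language x)
    (h4 : a' :: (w ++ [b']) ∈ language x) : False := by
  have hw : w ∈ language x := language_of_infix ⟨[a], [b], by simp⟩ h1
  set va : leftExt x w := ⟨a, mem_leftExt_iff.2 ⟨b, h1⟩⟩
  set va' : leftExt x w := ⟨a', mem_leftExt_iff.2 ⟨b, h3⟩⟩
  set vb : rightExt x w := ⟨b, mem_rightExt_iff.2 ⟨a, h1⟩⟩
  set vb' : rightExt x w := ⟨b', mem_rightExt_iff.2 ⟨a, h2⟩⟩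
  have e1 : (extensionGraph x w).Adj (Sum.inl va) (Sum.inr vb) := extensionGraph_adj_inl_inr.2 h1
  have e2 : (extensionGraph x w).Adj (Sum.inl va) (Sum.inr vb') := extensionGraph_adj_inl_inr.2 h2
  have e3 : (extensionGraph x w).Adj (Sum.inr vb) (Sum.inl va') := extensionGraph_adj_inr_inl.2 h3
  have e4 : (extensionGraph x w).Adj (Sum.inr vb') (Sum.inl va') := extensionGraph_adj_inr_inl.2 h4
  have hva : va ≠ va' := fun h => ha (congrArg Subtype.val h)
  have hvb : vb ≠ vb' := fun h => hb (congrArg Subtype.val h)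
  have hp1 : (SimpleGraph.Walk.cons e1 (SimpleGraph.Walk.cons e3 .nil)).IsPath := by
    simp [SimpleGraph.Walk.cons_isPath_iff, hva]
  have hp2 : (SimpleGraph.Walk.cons e2 (SimpleGraph.Walk.cons e4 .nil)).IsPath := by
    simp [SimpleGraph.Walk.cons_isPath_iff, hva]
  have heq := ((h w hw).isAcyclic.subsingleton_path _ _).elim ⟨_, hp1⟩ ⟨_, hp2⟩
  have h5 := congrArg SimpleGraph.Walk.support (congrArg Subtype.val heq)
  simp [hvb] at h5

/-- A tree with `m` edges has `m + 1` vertices; connectedness is enough for this inequality. -/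
theorem IsDendric.card_ext_le [Finite A] {x : ℤ → A} (h : IsDendric x) {w : List A}
    (hw : w ∈ language x) :
    Nat.card (leftExt x w) + Nat.card (rightExt x w) ≤ Nat.card (biExt x w) + 1 := by
  have h1 := (h w hw).connected.card_vert_le_card_edgeSet_add_one
  rw [Nat.card_sum] at h1
  refine h1.trans (Nat.add_le_add_right ?_ 1)
  let F : biExt x w → (extensionGraph x w).edgeSet := fun p =>
    ⟨s(Sum.inl ⟨p.1.1, mem_leftExt_iff.2 ⟨_, p.2⟩⟩, Sum.inr ⟨p.1.2, mem_rightExt_iff.2 ⟨_, p.2⟩⟩),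
      by rw [SimpleGraph.mem_edgeSet, extensionGraph_adj_inl_inr]; exact p.2⟩
  refine Nat.card_le_card_of_surjective F ?_
  rintro ⟨e, he⟩
  induction e with
  | _ u v =>
    rcases u with a | b <;> rcases v with a' | b'
    · exact absurd he extensionGraph_not_adj_inl
    · exact ⟨⟨(a, b'), extensionGraph_adj_inl_inr.1 he⟩, rfl⟩
    · exact ⟨⟨(a', b), extensionGraph_adj_inr_inl.1 he⟩, Subtype.ext Sym2.eq_swap⟩
    · exact absurd he extensionGraph_not_adj_inr

theorem finite_words [Finite A] (x : ℤ → A) (n : ℕ) : {w ∈ language x | w.length = n}.Finite :=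
  (List.finite_length_eq A n).subset fun _ hw => hw.2

/-- In a dendric word, the number of factors of length `n` is a convex function of `n`. -/
theorem IsDendric.ncard_convex [Finite A] {x : ℤ → A} (h : IsDendric x) (n : ℕ) :
    2 * {w ∈ language x | w.length = n + 1}.ncard ≤
      {w ∈ language x | w.length = n + 2}.ncard + {w ∈ language x | w.length = n}.ncard := by
  set S : ℕ → Set (List A) := fun n => {w ∈ language x | w.length = n} with hS
  change 2 * (S (n + 1)).ncard ≤ (S (n + 2)).ncard + (S n).ncard
  have : ∀ n, Finite (S n) := fun n => (finite_words x n).to_subtype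
  have : Fintype (S n) := Fintype.ofFinite _
  -- a word of length `n + 1`, or `n + 2`, is an extension of one of length `n`
  have hL : (S (n + 1)).ncard = ∑ w : S n, Nat.card (leftExt x w.1) := by
    rw [← Nat.card_coe_set_eq, ← Nat.card_sigma]
    refine Nat.card_congr (Equiv.ofBijective (fun p : Σ w : S n, leftExt x w.1 =>
      (⟨p.2.1 :: p.1.1, p.2.2, by simp [p.1.2.2]⟩ : S (n + 1))) ⟨?_, ?_⟩).symm
    · rintro ⟨⟨w, hw⟩, ⟨a, ha⟩⟩ ⟨⟨w', hw'⟩, ⟨a', ha'⟩⟩ heq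
      simp only [Subtype.mk.injEq, List.cons.injEq] at heq
      obtain ⟨rfl, rfl⟩ := heq
      rfl
    · rintro ⟨_ | ⟨a, w⟩, hv, hl⟩
      · simp at hl
      · exact ⟨⟨⟨w, language_of_infix ⟨[a], [], by simp⟩ hv, by simpa using hl⟩, ⟨a, hv⟩⟩, rfl⟩
  have hR : (S (n + 1)).ncard = ∑ w : S n, Nat.card (rightExt x w.1) := by
    rw [← Nat.card_coe_set_eq, ← Nat.card_sigma]
    refine Nat.card_congr (Equiv.ofBijective (fun p : Σ w : S n, rightExt x w.1 =>
      (⟨p.1.1 ++ [p.2.1], p.2.2, by simp [p.1.2.2]⟩ : S (n + 1))) ⟨?_, ?_⟩).symm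
    · rintro ⟨⟨w, hw⟩, ⟨a, ha⟩⟩ ⟨⟨w', hw'⟩, ⟨a', ha'⟩⟩ heq
      simp only [Subtype.mk.injEq, List.append_singleton_inj] at heq
      obtain ⟨rfl, rfl⟩ := heq
      rfl
    · rintro ⟨v, hv, hl⟩
      rcases List.eq_nil_or_concat' v with rfl | ⟨w, a, rfl⟩
      · simp at hl
      · exact ⟨⟨⟨w, language_of_infix ⟨[], [a], by simp⟩ hv, by simpa using hl⟩, ⟨a, hv⟩⟩, rfl⟩
  have hE : (S (n + 2)).ncard = ∑ w : S n, Nat.card (biExt x w.1) := by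
    rw [← Nat.card_coe_set_eq, ← Nat.card_sigma]
    refine Nat.card_congr (Equiv.ofBijective (fun p : Σ w : S n, biExt x w.1 =>
      (⟨p.2.1.1 :: (p.1.1 ++ [p.2.1.2]), p.2.2, by simp [p.1.2.2]⟩ : S (n + 2))) ⟨?_, ?_⟩).symm
    · rintro ⟨⟨w, hw⟩, ⟨⟨a, b⟩, ha⟩⟩ ⟨⟨w', hw'⟩, ⟨⟨a', b'⟩, ha'⟩⟩ heq
      simp only [Subtype.mk.injEq, List.cons.injEq, List.append_singleton_inj] at heq
      obtain ⟨rfl, rfl, rfl⟩ := heq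
      rfl
    · rintro ⟨_ | ⟨a, v⟩, hv, hl⟩
      · simp at hl
      · rcases List.eq_nil_or_concat' v with rfl | ⟨w, b, rfl⟩
        · simp at hl
        · exact ⟨⟨⟨w, language_of_infix ⟨[a], [b], by simp⟩ hv, by simpa using hl⟩,
            ⟨(a, b), hv⟩⟩, rfl⟩
  have hn : (S n).ncard = ∑ w : S n, 1 := by
    rw [← Nat.card_coe_set_eq, Nat.card_eq_fintype_card, Finset.sum_const, smul_eq_mul, mul_one,
      Finset.card_univ]
  have hsum : ∑ w : S n, (Nat.card (leftExt x w.1) + Nat.card (rightExt x w.1)) ≤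
      ∑ w : S n, (Nat.card (biExt x w.1) + 1) :=
    Finset.sum_le_sum fun w _ => h.card_ext_le w.2.1
  rw [Finset.sum_add_distrib, Finset.sum_add_distrib, ← hL, ← hR, ← hE, ← hn] at hsum
  omega

/-- By convexity, the number of factors of length `n` increases by at least `|A| - 1`, its increase
from length `0` to length `1`. -/
theorem IsDendric.le_ncard [Fintype A] {x : ℤ → A} (h : IsDendric x)
    (hx : Function.Surjective x) (n : ℕ) :
    (Fintype.card A - 1) * n + 1 ≤ {w ∈ language x | w.length = n}.ncard := by
  set p : ℕ → ℕ := fun n => {w ∈ language x | w.length = n}.ncard with hp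
  have h0 : p 0 = 1 := by
    have : {w ∈ language x | w.length = 0} = {[]} := by
      ext w
      simp only [Set.mem_ofPred_eq, List.length_eq_zero_iff, Set.mem_singleton_iff,
        and_iff_right_iff_imp]
      rintro rfl
      exact ⟨0, 0, by simp⟩
    simp only [hp, this, Set.ncard_singleton]
  have h1 : p 1 = Fintype.card A := by
    have : {w ∈ language x | w.length = 1} = Set.range fun a : A => [a] := by
      ext w
      constructor
      · rintro ⟨-, hw⟩
        obtain ⟨a, rfl⟩ := List.length_eq_one_iff.1 hw
        exact ⟨a, rfl⟩
      · rintro ⟨a, rfl⟩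
        obtain ⟨i, rfl⟩ := hx a
        exact ⟨singleton_mem_language x i, rfl⟩
    simp only [hp, this]
    rw [← Nat.card_coe_set_eq, Nat.card_range_of_injective fun a b h => by simpa using h,
      Nat.card_eq_fintype_card]
  have hstep : ∀ n, p n + (Fintype.card A - 1) ≤ p (n + 1) := by
    intro n
    induction n with
    | zero => simp only [zero_add, h0, h1]; have := Fintype.card_pos_iff.2 ⟨x 0⟩; omega
    | succ n ih =>
      have h2 : 2 * p (n + 1) ≤ p (n + 2) + p n := h.ncard_convex n
      change p (n + 1) + _ ≤ p (n + 2)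
      omega
  change _ ≤ p n
  induction n with
  | zero => simp [h0]
  | succ n ih =>
    have := hstep n
    rw [Nat.mul_succ]
    omega

end Graph

end RIET

/-! ### Elementary substitutions on two letters -/

namespace RIET

section Elementary

variable {A B : Type*}

open Classical in
/-- The substitution `c ↦ c`, `d ↦ c d` for `d ≠ c`. -/
noncomputable def elemLeft (c d : B) : List B := if d = c then [c] else [c, d]

open Classical in
/-- The substitution `c ↦ c`, `d ↦ d c` for `d ≠ c`. -/
noncomputable def elemRight (c d : B) : List B := if d = c then [c] else [d, c]

theorem elemLeft_self (c : B) : elemLeft c c = [c] := if_pos rfl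

theorem elemLeft_of_ne {c d : B} (h : d ≠ c) : elemLeft c d = [c, d] := if_neg h

theorem elemLeft_ne_nil (c d : B) : elemLeft c d ≠ [] := by unfold elemLeft; split <;> simp

theorem elemRight_ne_nil (c d : B) : elemRight c d ≠ [] := by unfold elemRight; split <;> simp

theorem elemRight_conj (c d : B) : [c] ++ elemRight c d = elemLeft c d ++ [c] := by
  unfold elemRight elemLeft; split <;> simp

theorem elemLeft_reverse (c d : B) : (elemLeft c d).reverse = elemRight c d := by
  unfold elemRight elemLeft; split <;> simp

theorem flatMap_elemRight_conj (c : B) (w : List B) :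
    [c] ++ w.flatMap (elemRight c) = w.flatMap (elemLeft c) ++ [c] := by
  induction w with
  | nil => simp
  | cons d w ih =>
    rw [List.flatMap_cons, List.flatMap_cons, ← List.append_assoc, elemRight_conj,
      List.append_assoc, ih, List.append_assoc]

theorem exists_elemLeft_eq_append (c d : B) : ∃ t, elemLeft c d = t ++ [d] := by
  by_cases h : d = c
  · exact ⟨[], by rw [h, elemLeft_self]; rfl⟩
  · exact ⟨[c], by rw [elemLeft_of_ne h]; rfl⟩

theorem exists_elemLeft_append_eq (c d : B) (t : List B) :
    ∃ t', elemLeft c d ++ c :: t = c :: d :: t' := by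
  by_cases h : d = c
  · exact ⟨t, by rw [h, elemLeft_self]; rfl⟩
  · exact ⟨c :: t, by rw [elemLeft_of_ne h]; rfl⟩

theorem exists_elemLeft_eq_cons (c d : B) : ∃ t, elemLeft c d = c :: t := by
  by_cases h : d = c
  · exact ⟨[], by rw [h, elemLeft_self]⟩
  · exact ⟨[d], by rw [elemLeft_of_ne h]⟩

/-- Over the letters `c` and `d`, a word in which every `d` is preceded by `c` is the image of a
word under `c ↦ c`, `d ↦ c d`. -/
theorem exists_flatMap_elemLeft {c d : B} (hcd : ∀ e, e = c ∨ e = d) (hne : c ≠ d) (w : List B)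
    (h1 : ¬ [d] <+: w) (h2 : ¬ [d, d] <:+: w) : ∃ w' : List B, w = w'.flatMap (elemLeft c) := by
  induction hn : w.length using Nat.strong_induction_on generalizing w with
  | _ n ih =>
    subst hn
    match w with
    | [] => exact ⟨[], rfl⟩
    | e :: t =>
      obtain rfl : e = c := (hcd e).resolve_right fun h => h1 ⟨t, by rw [h]; rfl⟩
      by_cases ht : [d] <+: t
      · obtain ⟨s, rfl⟩ := ht
        obtain ⟨w', hw'⟩ := ih s.length (by simp) s
          (fun ⟨r, hr⟩ => h2 ⟨[e], r, by rw [← hr]; simp⟩)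
          (fun h => h2 (h.trans (List.suffix_append [e, d] s).isInfix)) rfl
        exact ⟨d :: w', by rw [List.flatMap_cons, elemLeft_of_ne hne.symm, ← hw']; rfl⟩
      · obtain ⟨w', hw'⟩ := ih t.length (by simp) t ht
          (fun h => h2 (h.trans (List.suffix_cons e t).isInfix)) rfl
        exact ⟨e :: w', by rw [List.flatMap_cons, elemLeft_self, ← hw']; rfl⟩

/-- Over the letters `c` and `d`, a word in which every `d` is followed by `c` is the image of a
word under `c ↦ c`, `d ↦ d c`. -/
theorem exists_flatMap_elemRight {c d : B} (hcd : ∀ e, e = c ∨ e = d) (hne : c ≠ d) (w : List B)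
    (h1 : ¬ [d] <:+ w) (h2 : ¬ [d, d] <:+: w) : ∃ w' : List B, w = w'.flatMap (elemRight c) := by
  obtain ⟨w', hw'⟩ := exists_flatMap_elemLeft hcd hne w.reverse
    (fun h => h1 (by rw [← List.reverse_prefix]; exact h))
    (fun h => h2 (by rw [← List.reverse_infix]; exact h))
  refine ⟨w'.reverse, ?_⟩
  rw [← List.reverse_reverse w, hw', List.reverse_flatMap]
  simp only [Function.comp_def, elemLeft_reverse]

theorem length_flatMap_elemLeft_lt {c d : B} (hd : d ≠ c) {w : List B} (h : d ∈ w) :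
    w.length < (w.flatMap (elemLeft c)).length := by
  obtain ⟨s, t, rfl⟩ := List.append_of_mem h
  have h1 := length_le_length_flatMap (elemLeft_ne_nil c) s
  have h2 := length_le_length_flatMap (elemLeft_ne_nil c) t
  simp only [List.flatMap_append, List.flatMap_cons, elemLeft_of_ne hd, List.length_append,
    List.length_cons, List.length_nil]
  omega

theorem length_flatMap_elemRight (c : B) (w : List B) :
    (w.flatMap (elemRight c)).length = (w.flatMap (elemLeft c)).length := by
  have := congrArg List.length (flatMap_elemRight_conj c w)
  simp only [List.length_append, List.length_singleton] at this
  omega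

/-- The language contains no four words `a w b`, `a w b'`, `a' w b`, `a' w b'` with `a ≠ a'` and
`b ≠ b'`: the extension graphs have no cycle of length four. -/
def NoSquare (𝓛 : Set (List B)) : Prop :=
  ∀ (w : List B) (a a' b b' : B), a ≠ a' → b ≠ b' → a :: (w ++ [b]) ∈ 𝓛 → a :: (w ++ [b']) ∈ 𝓛 →
    a' :: (w ++ [b]) ∈ 𝓛 → a' :: (w ++ [b']) ∈ 𝓛 → False

/-- The bi-extensions of `v` become bi-extensions of `L(v) c`, where `L` is the substitution: each
image ends with the letter itself, and each image followed by `c` starts with `c` and the letter. -/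
theorem mem_imageLanguage_elemLeft {c : B} {y : ℤ → B} {v : List B} {a b : B}
    (h : a :: (v ++ [b]) ∈ language y) :
    a :: ((v.flatMap (elemLeft c) ++ [c]) ++ [b]) ∈ imageLanguage (elemLeft c) y := by
  obtain ⟨e, he⟩ := exists_extension_right h
  obtain ⟨t1, ht1⟩ := exists_elemLeft_eq_append c a
  obtain ⟨t3, ht3⟩ := exists_elemLeft_eq_cons c e
  obtain ⟨t4, ht4⟩ := exists_elemLeft_append_eq c b t3
  refine ⟨_, he, t1, t4, ?_⟩
  simp only [List.cons_append, List.flatMap_append, List.flatMap_cons, List.flatMap_nil,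
    List.append_nil, List.append_assoc, ht1, ht3]
  simp [ht4]

theorem NoSquare.of_elemLeft {u : A → List B} (hu : ∀ a, u a ≠ []) {c : B} {x : ℤ → A}
    (h : NoSquare (imageLanguage (fun a => (u a).flatMap (elemLeft c)) x)) :
    NoSquare (imageLanguage u x) := by
  obtain ⟨y, hy⟩ := exists_isImage hu x
  obtain ⟨z, hz⟩ := exists_isImage (elemLeft_ne_nil c) y
  have hne : ∀ a, (u a).flatMap (elemLeft c) ≠ [] := fun a h =>
    elemLeft_ne_nil c _ (List.flatMap_eq_nil_iff.1 h _ (List.getLast_mem (hu a)))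
  rw [← (hy.comp hz).language_eq hne, hz.language_eq (elemLeft_ne_nil c)] at h
  rw [← hy.language_eq hu]
  exact fun w a a' b b' ha hb h1 h2 h3 h4 => h _ a a' b b' ha hb (mem_imageLanguage_elemLeft h1)
    (mem_imageLanguage_elemLeft h2) (mem_imageLanguage_elemLeft h3) (mem_imageLanguage_elemLeft h4)

theorem imageLanguage_elemRight {u : A → List B} (hu : ∀ a, u a ≠ []) (c : B) (x : ℤ → A) :
    imageLanguage (fun a => (u a).flatMap (elemRight c)) x =
      imageLanguage (fun a => (u a).flatMap (elemLeft c)) x := by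
  refine imageLanguage_conj (P := [c]) (fun a => flatMap_elemRight_conj c (u a)) (fun a h => ?_) x
  exact elemLeft_ne_nil c _ (List.flatMap_eq_nil_iff.1 h _ (List.getLast_mem (hu a)))

/-- The substitutions obtained from the injective maps of letters by composing them with
elementary substitutions. -/
inductive IsElementaryProduct : (A → List B) → Prop
  | coding (f : A → B) (hf : Function.Injective f) : IsElementaryProduct fun a => [f a]
  | left (c : B) {u : A → List B} (h : IsElementaryProduct u) :
      IsElementaryProduct fun a => (u a).flatMap (elemLeft c)
  | right (c : B) {u : A → List B} (h : IsElementaryProduct u) :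
      IsElementaryProduct fun a => (u a).flatMap (elemRight c)

/-! ### Factorization of the substitutions whose images contain no square -/

/-- For each of the two letters `p`, the image of some word, in which `p` follows itself twice and
`q` does not follow itself, has extension graphs without cycles of length four. -/
def NoSquareImages (u : A → List B) : Prop :=
  ∀ p q : A, p ≠ q → ∃ x : ℤ → A, [p, p, p] ∈ language x ∧ [p, p, q] ∈ language x ∧
    [q, p, p] ∈ language x ∧ [p, q, p] ∈ language x ∧ NoSquare (imageLanguage u x)

theorem NoSquareImages.of_elemLeft {u : A → List B} (hu : ∀ a, u a ≠ []) {c : B}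
    (h : NoSquareImages fun a => (u a).flatMap (elemLeft c)) : NoSquareImages u := by
  intro p q hpq
  obtain ⟨x, h1, h2, h3, h4, h5⟩ := h p q hpq
  exact ⟨x, h1, h2, h3, h4, h5.of_elemLeft hu⟩

theorem NoSquareImages.of_elemRight {u : A → List B} (hu : ∀ a, u a ≠ []) {c : B}
    (h : NoSquareImages fun a => (u a).flatMap (elemRight c)) : NoSquareImages u := by
  intro p q hpq
  obtain ⟨x, h1, h2, h3, h4, h5⟩ := h p q hpq
  rw [imageLanguage_elemRight hu] at h5
  exact ⟨x, h1, h2, h3, h4, h5.of_elemLeft hu⟩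

theorem pair_mem_imageLanguage {u : A → List B} {x : ℤ → A} {r s : A} (h : [r, s] ∈ language x)
    {c d : B} (hr : [c] <:+ u r) (hs : [d] <+: u s) : [c, d] ∈ imageLanguage u x := by
  obtain ⟨t, ht⟩ := hr
  obtain ⟨t', ht'⟩ := hs
  exact ⟨_, h, t, t', by simp [← ht, ← ht']⟩

theorem infix_of_head_of_mem {a b : B} (hab : ∀ e, e = a ∨ e = b) (hne : a ≠ b) {w : List B}
    (h1 : [a] <+: w) (h2 : b ∈ w) : [a, b] <:+: w := by
  obtain ⟨t, rfl⟩ := h1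
  induction t with
  | nil => simp at h2; exact absurd h2.symm hne
  | cons c t ih =>
    rcases hab c with rfl | rfl
    · exact (ih (by simpa [hne.symm] using h2)).trans (List.suffix_cons _ _).isInfix
    · exact ⟨[], t, rfl⟩

theorem infix_of_last_of_mem {a b : B} (hab : ∀ e, e = a ∨ e = b) (hne : a ≠ b) {w : List B}
    (h1 : [a] <:+ w) (h2 : b ∈ w) : [b, a] <:+: w := by
  rw [← List.reverse_infix]
  exact infix_of_head_of_mem hab hne (by rw [← List.reverse_suffix]; simpa using h1) (by simpa)

/-- Over two letters, an alternating word is determined by its first letter and its length. -/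
theorem prefix_of_isChain_ne {a b : B} (hab : ∀ e, e = a ∨ e = b) {h : B} {s t : List B}
    (hs : (h :: s).IsChain (· ≠ ·)) (ht : (h :: t).IsChain (· ≠ ·)) (hl : s.length ≤ t.length) :
    s <+: t := by
  induction s generalizing t h with
  | nil => exact List.nil_prefix
  | cons c s ih =>
    cases t with
    | nil => simp at hl
    | cons d t =>
      rw [List.isChain_cons_cons] at hs ht
      obtain rfl : c = d := by
        have h1 := hs.1
        have h2 := ht.1
        rcases hab h with rfl | rfl <;> rcases hab c with rfl | rfl <;>
          rcases hab d with rfl | rfl <;> first | rfl | contradiction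
      rw [List.cons_prefix_cons]
      exact ⟨rfl, ih hs.2 ht.2 (by simpa using hl)⟩

theorem isChain_ne_of_not_infix {w : List B} (h : ∀ c, ¬ [c, c] <:+: w) : w.IsChain (· ≠ ·) := by
  rw [List.isChain_iff_forall_rel_of_append_cons_cons]
  rintro a b s t rfl rfl
  exact h a ⟨s, t, by simp⟩

variable {u : A → List B} {p q : A} {a b : B}

theorem mem_imageLanguage_of_pair {x : ℤ → A} {r s : A} (h : [r, s] ∈ language x) {w : List B}
    (hw : w <:+: u r ++ u s) : w ∈ imageLanguage u x :=
  ⟨_, h, by simpa using hw⟩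

theorem NoSquare.pair {𝓛 : Set (List B)} (h : NoSquare 𝓛) (hne : a ≠ b) (h1 : [a, a] ∈ 𝓛)
    (h2 : [a, b] ∈ 𝓛) (h3 : [b, a] ∈ 𝓛) (h4 : [b, b] ∈ 𝓛) : False :=
  h [] a b a b hne hne h1 h2 h3 h4

/-- The pairs of letters in the words of `NoSquareImages`. -/
theorem NoSquareImages.exists_pairs (h : NoSquareImages u) (hpq : p ≠ q) :
    ∃ x : ℤ → A, [p, p] ∈ language x ∧ [p, q] ∈ language x ∧ [q, p] ∈ language x ∧
      NoSquare (imageLanguage u x) := by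
  obtain ⟨x, h1, h2, h3, -, h5⟩ := h p q hpq
  exact ⟨x, language_of_infix ⟨[p], [], by simp⟩ h1, language_of_infix ⟨[p], [], by simp⟩ h2,
    language_of_infix ⟨[], [p], by simp⟩ h3, h5⟩

/-- When the images start with the same letter `a` and contain `b b`, they contain `a b` and `b a`
as well, hence no `a a`; so `u` factors through `b ↦ b`, `a ↦ a b`. When they do not contain `b b`,
it factors through `a ↦ a`, `b ↦ a b`. -/
theorem NoSquareImages.exists_elem_of_head_eq (h : NoSquareImages u) (hpq : p ≠ q)
    (hA : ∀ r, r = p ∨ r = q) (hab : ∀ e, e = a ∨ e = b) (hne : a ≠ b)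
    (hh : ∀ r, [a] <+: u r) :
    ∃ (c : B) (u' : A → List B), (u = fun r => (u' r).flatMap (elemLeft c)) ∨
      u = fun r => (u' r).flatMap (elemRight c) := by
  by_cases hbb : ∃ r, [b, b] <:+: u r
  · obtain ⟨r, hr⟩ := hbb
    obtain ⟨x, hpp, hpq, hqp, hx⟩ := h.exists_pairs hpq
    have hp : ∀ s, [s, p] ∈ language x := fun s => by rcases hA s with rfl | rfl <;> assumption
    have hb : b ∈ u r := hr.subset (by simp)
    have h1 : [b, b] ∈ imageLanguage u x :=
      mem_imageLanguage_of_pair (hp r) (hr.trans (List.prefix_append _ _).isInfix)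
    have h2 : [a, b] ∈ imageLanguage u x := mem_imageLanguage_of_pair (hp r)
      ((infix_of_head_of_mem hab hne (hh r) hb).trans (List.prefix_append _ _).isInfix)
    have h3 : [b, a] ∈ imageLanguage u x := by
      obtain ⟨t, ht⟩ := hh p
      have h4 : [b, a] <:+: u r ++ [a] :=
        infix_of_last_of_mem hab hne (List.suffix_append _ _) (by simp [hb])
      exact mem_imageLanguage_of_pair (hp r) (h4.trans ⟨[], t, by simp [← ht]⟩)
    have haa : [a, a] ∉ imageLanguage u x := fun h => hx.pair hne h h2 h3 h1
    choose u' hu' using fun s => exists_flatMap_elemRight (fun e => (hab e).symm) hne.symm (u s)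
      (fun h => haa (pair_mem_imageLanguage (hp s) h (hh p)))
      (fun h => haa (mem_imageLanguage_of_pair (hp s) (h.trans (List.prefix_append _ _).isInfix)))
    exact ⟨b, u', Or.inr (funext hu')⟩
  · push Not at hbb
    choose u' hu' using fun s => exists_flatMap_elemLeft hab hne (u s)
      (fun ⟨t, ht⟩ => by
        obtain ⟨t', ht'⟩ := hh s
        rw [← ht'] at ht
        simp at ht
        exact hne ht.1.symm) (hbb s)
    exact ⟨a, u', Or.inl (funext hu')⟩

/-- The mirror image of `NoSquareImages.exists_elem_of_head_eq`. -/
theorem NoSquareImages.exists_elem_of_last_eq (h : NoSquareImages u) (hpq : p ≠ q)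
    (hA : ∀ r, r = p ∨ r = q) (hab : ∀ e, e = a ∨ e = b) (hne : a ≠ b)
    (hl : ∀ r, [a] <:+ u r) :
    ∃ (c : B) (u' : A → List B), (u = fun r => (u' r).flatMap (elemLeft c)) ∨
      u = fun r => (u' r).flatMap (elemRight c) := by
  by_cases hbb : ∃ r, [b, b] <:+: u r
  · obtain ⟨r, hr⟩ := hbb
    obtain ⟨x, hpp, hpq, hqp, hx⟩ := h.exists_pairs hpq
    have hp : ∀ s, [p, s] ∈ language x := fun s => by rcases hA s with rfl | rfl <;> assumption
    have hb : b ∈ u r := hr.subset (by simp)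
    have h1 : [b, b] ∈ imageLanguage u x :=
      mem_imageLanguage_of_pair (hp r) (hr.trans (List.suffix_append _ _).isInfix)
    have h2 : [b, a] ∈ imageLanguage u x := mem_imageLanguage_of_pair (hp r)
      ((infix_of_last_of_mem hab hne (hl r) hb).trans (List.suffix_append _ _).isInfix)
    have h3 : [a, b] ∈ imageLanguage u x := by
      obtain ⟨t, ht⟩ := hl p
      have h4 : [a, b] <:+: [a] ++ u r :=
        infix_of_head_of_mem hab hne (List.prefix_append _ _) (by simp [hb])
      exact mem_imageLanguage_of_pair (hp r) (h4.trans ⟨t, [], by simp [← ht]⟩)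
    have haa : [a, a] ∉ imageLanguage u x := fun h => hx.pair hne h h3 h2 h1
    choose u' hu' using fun s => exists_flatMap_elemLeft (fun e => (hab e).symm) hne.symm (u s)
      (fun h => haa (pair_mem_imageLanguage (hp s) (hl p) h))
      (fun h => haa (mem_imageLanguage_of_pair (hp s) (h.trans (List.suffix_append _ _).isInfix)))
    exact ⟨b, u', Or.inl (funext hu')⟩
  · push Not at hbb
    choose u' hu' using fun s => exists_flatMap_elemRight hab hne (u s)
      (fun ⟨t, ht⟩ => by
        obtain ⟨t', ht'⟩ := hl s
        rw [← ht'] at ht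
        simp at ht
        exact hne ht.2.symm) (hbb s)
    exact ⟨a, u', Or.inr (funext hu')⟩

/-- The images of `p` and `q` do not start and end with opposite letters: all the words of length
two would be factors of the images. -/
theorem NoSquareImages.not_crossed (h : NoSquareImages u) (hpq : p ≠ q)
    (hab : ∀ e, e = a ∨ e = b) (hne : a ≠ b) (hhp : [b] <+: u p) (hlp : [a] <:+ u p)
    (hhq : [a] <+: u q) (hlq : [b] <:+ u q) : False := by
  obtain ⟨x, hpp, hpq, hqp, hx⟩ := h.exists_pairs hpq
  refine hx.pair hne (pair_mem_imageLanguage hpq hlp hhq) (pair_mem_imageLanguage hpp hlp hhp)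
    (mem_imageLanguage_of_pair hpp ((infix_of_head_of_mem (fun e => (hab e).symm) hne.symm hhp
      (hlp.subset (by simp))).trans (List.prefix_append _ _).isInfix))
    (pair_mem_imageLanguage hqp hlq hhp)

/-- If `u p` starts and ends with `b` and `u q` with `a`, both are alternating words. When they
are not single letters, the word `u q` has four extensions in the image of a word that contains
`q q q`, `q q p`, `p q q` and `q p q`. -/
theorem NoSquareImages.length_eq_one (h : NoSquareImages u) (hpq : p ≠ q)
    (hab : ∀ e, e = a ∨ e = b) (hne : a ≠ b) (hhp : [b] <+: u p) (hlp : [b] <:+ u p)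
    (hhq : [a] <+: u q) (hlq : [a] <:+ u q) : (u p).length = 1 ∧ (u q).length = 1 := by
  have hlenp : 1 ≤ (u p).length := hhp.length_le
  have hlenq : 1 ≤ (u q).length := hhq.length_le
  by_contra hlen
  obtain ⟨x, hpp, hpq', hqp, hx⟩ := h.exists_pairs hpq
  have haa : [a, a] ∉ imageLanguage u x := fun h => hx.pair hne h
    (pair_mem_imageLanguage hqp hlq hhp) (pair_mem_imageLanguage hpq' hlp hhq)
    (pair_mem_imageLanguage hpp hlp hhp)
  obtain ⟨x', hqqq, hqqp, hpqq, hqpq, hx'⟩ := h q p hpq.symm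
  have hqq' : [q, q] ∈ language x' := language_of_infix ⟨[q], [], by simp⟩ hqqq
  have hqp' : [q, p] ∈ language x' := language_of_infix ⟨[q], [], by simp⟩ hqqp
  have hpq'' : [p, q] ∈ language x' := language_of_infix ⟨[], [q], by simp⟩ hpqq
  have hbb : [b, b] ∉ imageLanguage u x' := fun h => hx'.pair hne
    (pair_mem_imageLanguage hqq' hlq hhq) (pair_mem_imageLanguage hqp' hlq hhp)
    (pair_mem_imageLanguage hpq'' hlp hhq) h
  have hcp : (u p).IsChain (· ≠ ·) := isChain_ne_of_not_infix fun c hc => by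
    rcases hab c with rfl | rfl
    · exact haa (mem_imageLanguage_of_pair hpq' (hc.trans (List.prefix_append _ _).isInfix))
    · exact hbb (mem_imageLanguage_of_pair hpq'' (hc.trans (List.prefix_append _ _).isInfix))
  have hcq : (u q).IsChain (· ≠ ·) := isChain_ne_of_not_infix fun c hc => by
    rcases hab c with rfl | rfl
    · exact haa (mem_imageLanguage_of_pair hqp (hc.trans (List.prefix_append _ _).isInfix))
    · exact hbb (mem_imageLanguage_of_pair hqp' (hc.trans (List.prefix_append _ _).isInfix))
  obtain ⟨sp, hsp⟩ := hhp
  obtain ⟨tp, htp⟩ := hlp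
  obtain ⟨sq, hsq⟩ := hhq
  obtain ⟨tq, htq⟩ := hlq
  have hq_p : (u q ++ u p).IsChain (· ≠ ·) := hcq.append hcp fun c hc d hd => by
    rw [← htq] at hc
    rw [← hsp] at hd
    simp at hc hd
    rw [← hc, ← hd]
    exact hne
  have hq_p_q : (u q ++ u p ++ u q).IsChain (· ≠ ·) := hq_p.append hcq fun c hc d hd => by
    rw [← htp, ← List.append_assoc] at hc
    rw [← hsq] at hd
    simp at hc hd
    rw [← hc, ← hd]
    exact hne.symm
  have hbqb : (b :: (u q ++ [b])).IsChain (· ≠ ·) := by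
    rw [← hsq, List.singleton_append, List.cons_append, List.isChain_cons_cons]
    refine ⟨hne.symm, ?_⟩
    rw [← List.cons_append, ← List.singleton_append, hsq]
    refine hcq.append (List.isChain_singleton _) fun c hc d hd => ?_
    rw [← htq] at hc
    simp at hc hd
    rw [← hc, ← hd]
    exact hne
  -- the alternating word `u q u p u q` starts with `a b`, and is long enough to contain `b u(q) b`
  -- from its second letter on
  have hbwb : b :: (u q ++ [b]) <:+: u q ++ u p ++ u q := by
    have hz : ∃ z, u q ++ u p ++ u q = a :: b :: z := by
      cases hsq' : sq with
      | nil => exact ⟨sp ++ u q, by rw [← hsq, ← hsp, hsq']; simp⟩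
      | cons d s =>
        rw [← hsq, hsq', List.singleton_append, List.isChain_cons_cons] at hcq
        obtain rfl : d = b := (hab d).resolve_left hcq.1.symm
        exact ⟨s ++ u p ++ u q, by rw [← hsq, hsq']; simp⟩
    obtain ⟨z, hz⟩ := hz
    have hzl := congrArg List.length hz
    simp only [List.length_append, List.length_cons] at hzl
    rw [hz] at hq_p_q ⊢
    have := prefix_of_isChain_ne hab hbqb hq_p_q.tail (by
      simp only [List.length_append, List.length_cons, List.length_nil]; omega)
    exact ((List.cons_prefix_cons).2 ⟨rfl, this⟩).isInfix.trans (List.suffix_cons _ _).isInfix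
  have hassoc : ∀ (T S W : List B) (c d : B),
      T ++ c :: (W ++ [d]) ++ S = (T ++ [c]) ++ (W ++ ([d] ++ S)) := by simp
  refine hx' (u q) a b a b hne hne ⟨_, hqqq, tq, sq, ?_⟩ ⟨_, hqqp, tq, sp, ?_⟩
    ⟨_, hpqq, tp, sq, ?_⟩ ⟨_, hqpq, by simpa using hbwb⟩
  · rw [hassoc, htq, hsq]; simp
  · rw [hassoc, htq, hsp]; simp
  · rw [hassoc, htp, hsq]; simp

/-- An elementary substitution can be factored out when the images have the same first letter or the
same last letter; otherwise they are single letters. -/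
theorem NoSquareImages.exists_elem (h : NoSquareImages u) (hu : ∀ r, u r ≠ []) (hpq : p ≠ q)
    (hA : ∀ r, r = p ∨ r = q) (hB : ∀ a b : B, a ≠ b → ∀ e, e = a ∨ e = b)
    (hcomm : u p ++ u q ≠ u q ++ u p) :
    (∃ f : A → B, u = fun r => [f r]) ∨
    ∃ (c : B) (u' : A → List B), (u = fun r => (u' r).flatMap (elemLeft c)) ∨
      u = fun r => (u' r).flatMap (elemRight c) := by
  choose f s hf using fun r => List.exists_cons_of_ne_nil (hu r)
  choose t l hl using fun r => (List.eq_nil_or_concat' (u r)).resolve_left (hu r)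
  have hf' : ∀ r, [f r] <+: u r := fun r => ⟨s r, (hf r).symm⟩
  have hl' : ∀ r, [l r] <:+ u r := fun r => ⟨t r, (hl r).symm⟩
  obtain ⟨a, b, hne⟩ : ∃ a b : B, a ≠ b := by
    by_contra hall
    push Not at hall
    -- over a single letter all words commute
    have hrep : ∀ r, u r = List.replicate (u r).length (f p) := fun r =>
      List.eq_replicate_iff.2 ⟨rfl, fun c _ => hall _ _⟩
    rw [hrep p, hrep q, List.replicate_append_replicate, List.replicate_append_replicate,
      add_comm] at hcomm
    exact hcomm rfl
  have hother : ∀ a : B, ∃ b, a ≠ b := fun c => by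
    by_cases hc : c = a
    · exact ⟨b, hc ▸ hne⟩
    · exact ⟨a, hc⟩
  by_cases hfe : f q = f p
  · obtain ⟨d, hd⟩ := hother (f p)
    refine Or.inr (h.exists_elem_of_head_eq hpq hA (hB _ _ hd) hd fun r => ?_)
    rcases hA r with rfl | rfl
    · exact hf' _
    · exact hfe ▸ hf' _
  by_cases hle : l q = l p
  · obtain ⟨d, hd⟩ := hother (l p)
    refine Or.inr (h.exists_elem_of_last_eq hpq hA (hB _ _ hd) hd fun r => ?_)
    rcases hA r with rfl | rfl
    · exact hl' _
    · exact hle ▸ hl' _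
  have hab := hB _ _ hfe
  left
  rcases hab (l p) with h1 | h1
  · have h2 : l q = f p := (hab (l q)).resolve_left fun h => hle (h.trans h1.symm)
    exact absurd (h.not_crossed hpq hab hfe (hf' p) (h1 ▸ hl' p) (hf' q) (h2 ▸ hl' q)) id
  · have h2 : l q = f q := (hab (l q)).resolve_right fun h => hle (h.trans h1.symm)
    obtain ⟨h3, h4⟩ := h.length_eq_one hpq hab hfe (hf' p) (h1 ▸ hl' p) (hf' q) (h2 ▸ hl' q)
    refine ⟨f, funext fun r => ?_⟩
    have : (u r).length = 1 := by rcases hA r with rfl | rfl <;> assumption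
    rw [hf r] at this ⊢
    simp only [List.length_cons, Nat.add_eq_right, List.length_eq_zero_iff] at this
    rw [this]

/-- Factoring out an elementary substitution decreases the total length of the images. -/
theorem NoSquareImages.isElementaryProduct (h : NoSquareImages u) (hu : ∀ r, u r ≠ [])
    (hpq : p ≠ q) (hA : ∀ r, r = p ∨ r = q) (hB : ∀ a b : B, a ≠ b → ∀ e, e = a ∨ e = b)
    (hcomm : u p ++ u q ≠ u q ++ u p) : IsElementaryProduct u := by
  induction hn : (u p ++ u q).length using Nat.strong_induction_on generalizing u with
  | _ n ih =>
    subst hn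
    -- the words `u' r` commute when all their letters are equal to `c`
    have hlt : ∀ (c : B) (u' : A → List B), u' p ++ u' q ≠ u' q ++ u' p →
        (u' p ++ u' q).length < ((u' p ++ u' q).flatMap (elemLeft c)).length := by
      intro c u' hcomm'
      by_contra hge
      have hall : ∀ d ∈ u' p ++ u' q, d = c := fun d hd => by
        by_contra hdc
        exact hge (length_flatMap_elemLeft_lt hdc hd)
      have hrep : ∀ w, (∀ d ∈ w, d ∈ u' p ++ u' q) → w = List.replicate w.length c := fun w hw =>
        List.eq_replicate_iff.2 ⟨rfl, fun d hd => hall d (hw d hd)⟩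
      rw [hrep (u' p) (by simp +contextual), hrep (u' q) (by simp +contextual),
        List.replicate_append_replicate, List.replicate_append_replicate, add_comm] at hcomm'
      exact hcomm' rfl
    rcases h.exists_elem hu hpq hA hB hcomm with ⟨f, rfl⟩ | ⟨c, u', rfl | rfl⟩
    · refine .coding f fun r s hrs => ?_
      have hf : f p ≠ f q := fun h => hcomm (by simp [h])
      rcases hA r with rfl | rfl <;> rcases hA s with rfl | rfl <;>
        first | rfl | exact absurd hrs hf | exact absurd hrs.symm hf
    · have hu' : ∀ r, u' r ≠ [] := fun r hr => hu r (by simp [hr])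
      have hcomm' : u' p ++ u' q ≠ u' q ++ u' p := fun h => hcomm (by
        simp only [← List.flatMap_append, h])
      refine .left c (ih _ ?_ (h.of_elemLeft hu') hu' hcomm' rfl)
      simpa only [List.flatMap_append] using hlt c u' hcomm'
    · have hu' : ∀ r, u' r ≠ [] := fun r hr => hu r (by simp [hr])
      have hcomm' : u' p ++ u' q ≠ u' q ++ u' p := fun h => hcomm (by
        simp only [← List.flatMap_append, h])
      refine .right c (ih _ ?_ (h.of_elemRight hu') hu' hcomm' rfl)
      simpa only [← List.flatMap_append, length_flatMap_elemRight] using hlt c u' hcomm'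

end Elementary

end RIET

/-! ### The words with a single occurrence of a letter -/

namespace RIET

section StepWord

variable {A B : Type*} {p q : A}

theorem stepWord_of_ne {n : ℤ} (hn : n ≠ 0) : stepWord p q p n = p := by
  simp [stepWord, hn]

theorem stepWord_zero : stepWord p q p 0 = q := by simp [stepWord]

theorem stepWord_mem_language (i : ℤ) (a b c : A) (ha : stepWord p q p i = a)
    (hb : stepWord p q p (i + 1) = b) (hc : stepWord p q p (i + 1 + 1) = c) :
    [a, b, c] ∈ language (stepWord p q p) :=
  ⟨i, 3, by simp only [window_succ, window_zero, ha, hb, hc]⟩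

theorem stepWord_triples : [p, p, p] ∈ language (stepWord p q p) ∧
    [p, p, q] ∈ language (stepWord p q p) ∧ [q, p, p] ∈ language (stepWord p q p) ∧
    [p, q, p] ∈ language (stepWord p q p) := by
  refine ⟨stepWord_mem_language 1 _ _ _ ?_ ?_ ?_, stepWord_mem_language (-2) _ _ _ ?_ ?_ ?_,
    stepWord_mem_language 0 _ _ _ ?_ ?_ ?_, stepWord_mem_language (-1) _ _ _ ?_ ?_ ?_⟩ <;>
  simp [stepWord]

/-- Every factor extends by `p` on both sides, and not by two other letters, which would be two
occurrences of `q`: the extension graphs are double stars. -/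
theorem stepWord_isDendric : IsDendric (stepWord p q p) := by
  intro w hw
  refine extensionGraph_isTree_of_doubleStar (a := p) (b := p) ?_ ?_
  · obtain ⟨i, hi⟩ := mem_language_iff.1 hw
    refine biextension_mem_language.2 ?_
    by_cases h : i - 1 = 0 ∨ i + w.length = 0
    · refine ⟨1, stepWord_of_ne one_ne_zero, ?_, stepWord_of_ne (by omega)⟩
      rw [← hi, window_length, window_eq_iff]
      intro j hj
      rw [stepWord_of_ne (by omega), stepWord_of_ne (by omega)]
    · push Not at h
      exact ⟨i - 1, stepWord_of_ne h.1, by rw [sub_add_cancel, hi],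
        stepWord_of_ne (by rw [sub_add_cancel]; exact h.2)⟩
  · rintro ⟨a, b⟩ hab
    obtain ⟨i, h1, -, h3⟩ := biextension_mem_language.1 hab
    by_cases hi : i = 0
    · right
      rw [← h3, stepWord_of_ne (by omega)]
    · left
      rw [← h1, stepWord_of_ne hi]

theorem stepWord_surjective (hA : ∀ r, r = p ∨ r = q) : Function.Surjective (stepWord p q p) := by
  intro r
  rcases hA r with rfl | rfl
  · exact ⟨1, stepWord_of_ne one_ne_zero⟩
  · exact ⟨0, stepWord_zero⟩

end StepWord

/-! ### Morphisms on two letters are products of elementary substitutions -/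

section TwoLetters

variable {A B : Type*} {σ : FreeMonoid A →* FreeMonoid B} {hσ : NonErasing σ}

open IntervalExchange

/-- If the images of the two letters commute, the powers of one of them are prefixes of the images
of all the powers of themselves. -/
theorem not_comm_of_not_prefix {u : A → List B} (hu : ∀ a, u a ≠ []) {p q : A}
    (hA : ∀ r, r = p ∨ r = q)
    (h : ¬ ∀ N, ∃ P : List B, N ≤ P.length ∧ ∀ a, P <+: u a ++ P) :
    u p ++ u q ≠ u q ++ u p := by
  refine fun hcomm => h fun N => ⟨(List.replicate N p).flatMap u, ?_, fun a => ?_⟩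
  · simpa using length_le_length_flatMap hu (List.replicate N p)
  · have hc : ∀ n, u a ++ (List.replicate n p).flatMap u =
        (List.replicate n p).flatMap u ++ u a := by
      intro n
      induction n with
      | zero => simp
      | succ n ih =>
        have h1 : u a ++ u p = u p ++ u a := by
          rcases hA a with rfl | rfl
          · rfl
          · exact hcomm.symm
        rw [List.replicate_succ, List.flatMap_cons, ← List.append_assoc, h1, List.append_assoc, ih,
          List.append_assoc]
    rw [hc]
    exact List.prefix_append _ _

theorem exists_equiv_of_pair {p q : A} (hpq : p ≠ q) (hA : ∀ r, r = p ∨ r = q) :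
    ∃ e : Fin (1 + 1) ≃ A, e 0 = p ∧ e 1 = q := by
  refine ⟨Equiv.ofBijective ![p, q] ⟨fun i j hij => ?_, fun r => ?_⟩, rfl, rfl⟩
  · fin_cases i <;> fin_cases j <;> simp_all
  · rcases hA r with rfl | rfl
    · exact ⟨0, rfl⟩
    · exact ⟨1, rfl⟩

theorem surjective_biImage (hmin : ∀ b : B, ∃ w : FreeMonoid A, b ∈ FreeMonoid.toList (σ w))
    {x : ℤ → A} (hx : Function.Surjective x) : Function.Surjective (biImage σ hσ x) := by
  intro b
  obtain ⟨w, hw⟩ := hmin b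
  have h1 : b ∈ (FreeMonoid.toList w).flatMap (letterImage σ) := by
    rw [← toList_map]
    exact hw
  obtain ⟨a, -, ha⟩ := List.mem_flatMap.1 h1
  obtain ⟨i, rfl⟩ := hx a
  obtain ⟨s, t, hst⟩ := List.append_of_mem ha
  have h2 : [b] ∈ language (biImage σ hσ x) := by
    rw [language_biImage]
    exact ⟨_, singleton_mem_language x i, s, t, by simp [hst]⟩
  obtain ⟨j, hj⟩ := mem_language_iff.1 h2
  exact ⟨j, by simpa using hj⟩

variable [Fintype A] [Fintype B]

theorem exists_two_letters {A : Type*} [Fintype A] (hA : Fintype.card A = 2) :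
    ∃ p q : A, p ≠ q ∧ ∀ r, r = p ∨ r = q := by
  classical
  obtain ⟨p, q, hpq, h⟩ := Finset.card_eq_two.1 (Finset.card_univ.trans hA)
  refine ⟨p, q, hpq, fun r => ?_⟩
  have := Finset.mem_univ r
  rw [h] at this
  simpa using this

theorem eq_or_eq_of_card_eq_two {A : Type*} [Fintype A] (hA : Fintype.card A = 2) {a b : A}
    (hab : a ≠ b) (e : A) : e = a ∨ e = b := by
  obtain ⟨p, q, -, h⟩ := exists_two_letters hA
  rcases h a with rfl | rfl <;> rcases h b with rfl | rfl <;> rcases h e with rfl | rfl <;> simp_all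

/-- The test words are the codings of rotations of small angle. -/
theorem RIETPreserving.noSquareImages [Nontrivial B] (h : RIETPreserving σ hσ)
    (hA : Fintype.card A = 2) : NoSquareImages (letterImage σ) := by
  intro p q hpq
  have hA' := eq_or_eq_of_card_eq_two hA hpq
  obtain ⟨θ, hθ, h0, h1⟩ := exists_irrational_btwn (show (0 : ℝ) < 1 / 4 by norm_num)
  obtain ⟨e, hep, heq⟩ := exists_equiv_of_pair hpq hA'
  have hlt : ((1 : ℕ) : ℝ) * θ < 1 := by push_cast; linarith
  obtain ⟨x, hx⟩ := exists_isCodingOf (rotation one_pos h0 hlt e) ⟨0, le_rfl, one_pos⟩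
  obtain ⟨t1, t2, t3, t4⟩ := rotation_triples hθ hep heq (by linarith) hx
  refine ⟨x, t1, t2, t3, t4, ?_⟩
  obtain ⟨L, R, hLR⟩ := (h x ⟨_, rotation_isRegular hθ, _, hx⟩).exists_orderCompatible
  rw [language_biImage] at hLR
  exact fun w a a' b b' => hLR.not_square w

theorem RIETPreserving.isElementaryProduct (h : RIETPreserving σ hσ)
    (hA : Fintype.card A = 2) (hB : 2 ≤ Fintype.card B) :
    Fintype.card B = 2 ∧ IsElementaryProduct (letterImage σ) := by
  have : Nontrivial A := Fintype.one_lt_card_iff_nontrivial.1 (by omega)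
  have : Nontrivial B := Fintype.one_lt_card_iff_nontrivial.1 (by omega)
  have hB2 : Fintype.card B = 2 := le_antisymm (hA ▸ h.card_le) hB
  obtain ⟨p, q, hpq, hA'⟩ := exists_two_letters hA
  exact ⟨hB2, (h.noSquareImages hA).isElementaryProduct hσ.letterImage_ne_nil hpq hA'
    (fun a b => eq_or_eq_of_card_eq_two hB2)
    (not_comm_of_not_prefix hσ.letterImage_ne_nil hA' h.not_prefix)⟩

/-- The test words are the words `⋯ p p q p p ⋯`, which are dendric. Their images have at most
`n + O(1)` factors of length `n`, and at least `(|B| - 1) n + 1` since they are dendric. -/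
theorem DendricPreserving.isElementaryProduct (h : DendricPreserving σ hσ)
    (hA : Fintype.card A = 2) (hB : 2 ≤ Fintype.card B)
    (hmin : ∀ b : B, ∃ w : FreeMonoid A, b ∈ FreeMonoid.toList (σ w)) :
    Fintype.card B = 2 ∧ IsElementaryProduct (letterImage σ) := by
  have hu := hσ.letterImage_ne_nil
  obtain ⟨K, hK⟩ := exists_length_le (letterImage σ)
  obtain ⟨p, q, hpq, hA'⟩ := exists_two_letters hA
  have hD : ∀ p q : A, p ≠ q → IsDendric (biImage σ hσ (stepWord p q p)) := fun p q hpq =>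
    h _ (stepWord_surjective (eq_or_eq_of_card_eq_two hA hpq)) stepWord_isDendric
  have hle : ∀ n, (Fintype.card B - 1) * n + 1 ≤
      {w ∈ imageLanguage (letterImage σ) (stepWord p q p) | w.length = n}.ncard := fun n => by
    rw [← language_biImage σ hσ]
    exact (hD p q hpq).le_ncard (surjective_biImage hmin (stepWord_surjective hA')) n
  have hB2 : Fintype.card B ≤ 1 + 1 := card_le_of_linear_bounds (C := 3 * K + 1) fun n => by
    have h1 := ncard_imageLanguage_le (ι := Unit) hu hK (fun _ => p) (fun _ => q) (fun _ => p) n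
      (x := stepWord p q p) fun j => ⟨(), j, rfl⟩
    rw [Fintype.card_unit] at h1
    exact (hle n).trans h1
  have hB2 : Fintype.card B = 2 := le_antisymm hB2 hB
  have hsq : NoSquareImages (letterImage σ) := fun p q hpq => by
    obtain ⟨t1, t2, t3, t4⟩ := stepWord_triples (p := p) (q := q)
    refine ⟨_, t1, t2, t3, t4, ?_⟩
    rw [← language_biImage σ hσ]
    exact fun w a a' b b' => (hD p q hpq).not_square w
  refine ⟨hB2, hsq.isElementaryProduct hu hpq hA' (fun a b => eq_or_eq_of_card_eq_two hB2)
    (not_comm_of_not_prefix hu hA' fun hP => ?_)⟩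
  have h1 := hle K
  have h2 := ncard_imageLanguage_le_of_prefix hu hK hP (stepWord p q p) K
  rw [hB2] at h1
  omega

end TwoLetters

/-! ### Elementary substitutions preserve dendric words -/

section DendricElementary

variable {A B : Type*} {c : B}

/-- In an image under `c ↦ c`, `d ↦ c d`, one of any two consecutive letters is `c`. -/
theorem mem_or_of_pair_infix_flatMap_elemLeft {d e : B} {t : List B}
    (h : [d, e] <:+: t.flatMap (elemLeft c)) : d = c ∨ e = c := by
  induction t with
  | nil => simp at h
  | cons f t ih =>
    have hhead : ∀ d, [d] <+: t.flatMap (elemLeft c) → d = c := by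
      intro d hd
      cases t with
      | nil => simp at hd
      | cons g t =>
        obtain ⟨t', ht'⟩ := exists_elemLeft_eq_cons c g
        rw [List.flatMap_cons, ht', List.cons_append, List.cons_prefix_cons] at hd
        exact hd.1
    rw [List.flatMap_cons] at h
    by_cases hf : f = c
    · rw [hf, elemLeft_self, List.singleton_append, List.infix_cons_iff, List.cons_prefix_cons] at h
      rcases h with h | h
      · exact Or.inl h.1
      · exact ih h
    · rw [elemLeft_of_ne hf, List.cons_append, List.singleton_append, List.infix_cons_iff,
        List.infix_cons_iff, List.cons_prefix_cons, List.cons_prefix_cons (a := d)] at h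
      rcases h with h | h | h
      · exact Or.inl h.1
      · exact Or.inr (hhead e h.2)
      · exact ih h

/-- An image under `c ↦ c`, `d ↦ c d` is decoded from left to right; the two letters `c b` that
follow `L(v)` start the image of `b`, or are `c = L(c)` followed by the first letter `b = c` of an
image. -/
theorem prefix_of_flatMap_elemLeft {v t : List B} {b : B}
    (h : v.flatMap (elemLeft c) ++ [c, b] <+: t.flatMap (elemLeft c)) : v ++ [b] <+: t := by
  induction v generalizing t with
  | nil =>
    cases t with
    | nil => simp at h
    | cons f t =>
      by_cases hf : f = c
      · subst hf
        rw [List.flatMap_nil, List.nil_append, List.flatMap_cons, elemLeft_self,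
          List.singleton_append, List.cons_prefix_cons] at h
        cases t with
        | nil => simp at h
        | cons g t =>
          obtain ⟨t', ht'⟩ := exists_elemLeft_eq_cons f g
          rw [List.flatMap_cons, ht', List.cons_append, List.cons_prefix_cons] at h
          rw [h.2.1]
          exact ⟨_, rfl⟩
      · rw [List.flatMap_nil, List.nil_append, List.flatMap_cons, elemLeft_of_ne hf,
          List.cons_append, List.cons_prefix_cons, List.singleton_append,
          List.cons_prefix_cons] at h
        rw [h.2.1]
        exact ⟨t, rfl⟩
  | cons e v ih =>
    cases t with
    | nil => simp at h
    | cons f t =>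
      have hc : ∃ r, v.flatMap (elemLeft c) ++ [c, b] = c :: r := by
        cases v with
        | nil => exact ⟨_, rfl⟩
        | cons g v =>
          obtain ⟨t', ht'⟩ := exists_elemLeft_eq_cons c g
          exact ⟨_, by rw [List.flatMap_cons, ht', List.cons_append, List.cons_append]⟩
      obtain ⟨r, hr⟩ := hc
      rw [List.flatMap_cons, List.append_assoc, List.flatMap_cons] at h
      -- `e = f`: otherwise one of the two words has its second letter equal to `c`
      have hef : e = f := by
        by_cases he : e = c <;> by_cases hf : f = c
        · rw [he, hf]
        · rw [he, elemLeft_self, elemLeft_of_ne hf, hr, List.singleton_append, List.cons_append,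
            List.cons_prefix_cons, List.singleton_append, List.cons_prefix_cons] at h
          exact absurd h.2.1.symm hf
        · rw [hf, elemLeft_self, elemLeft_of_ne he, List.singleton_append, List.cons_append,
            List.cons_prefix_cons, List.singleton_append] at h
          cases t with
          | nil => simp at h
          | cons g t =>
            obtain ⟨t', ht'⟩ := exists_elemLeft_eq_cons c g
            rw [List.flatMap_cons, ht', List.cons_append, List.cons_prefix_cons] at h
            exact absurd h.2.1 he
        · rw [elemLeft_of_ne he, elemLeft_of_ne hf, List.cons_append, List.singleton_append,
            List.cons_append, List.cons_prefix_cons, List.singleton_append,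
            List.cons_prefix_cons] at h
          exact h.2.1
      subst hef
      rw [List.prefix_append_right_inj] at h
      rw [List.cons_append, List.cons_prefix_cons]
      exact ⟨rfl, ih h⟩

/-- The letter before `L(v) c` is the last letter of the image of the letter before `v`, since it is
followed by `c`, which starts an image. -/
theorem infix_of_flatMap_elemLeft {v t : List B} {a b : B}
    (h : a :: (v.flatMap (elemLeft c) ++ [c, b]) <:+: t.flatMap (elemLeft c)) :
    a :: (v ++ [b]) <:+: t := by
  have hc : ∃ r, v.flatMap (elemLeft c) ++ [c, b] = c :: r := by
    cases v with
    | nil => exact ⟨_, rfl⟩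
    | cons g v =>
      obtain ⟨t', ht'⟩ := exists_elemLeft_eq_cons c g
      exact ⟨_, by rw [List.flatMap_cons, ht', List.cons_append, List.cons_append]⟩
  obtain ⟨r, hr⟩ := hc
  induction t with
  | nil => simp at h
  | cons f t ih =>
    rw [List.flatMap_cons] at h
    by_cases hf : f = c
    · rw [hf, elemLeft_self, List.singleton_append, List.infix_cons_iff, List.cons_prefix_cons] at h
      rcases h with ⟨rfl, h⟩ | h
      · rw [hf]
        exact (List.cons_prefix_cons.2 ⟨rfl, prefix_of_flatMap_elemLeft h⟩).isInfix
      · exact (ih h).trans (List.suffix_cons _ _).isInfix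
    · rw [elemLeft_of_ne hf, List.cons_append, List.singleton_append, List.infix_cons_iff,
        List.infix_cons_iff, List.cons_prefix_cons, List.cons_prefix_cons] at h
      rcases h with ⟨-, h⟩ | ⟨rfl, h⟩ | h
      · rw [hr, List.cons_prefix_cons] at h
        exact absurd h.1.symm hf
      · exact (List.cons_prefix_cons.2 ⟨rfl, prefix_of_flatMap_elemLeft h⟩).isInfix
      · exact (ih h).trans (List.suffix_cons _ _).isInfix

/-- The word `v` has the same bi-extensions in `y` as `L(v) c` has in the image of `y` by `L`. -/
theorem biExt_elemLeft {y z : ℤ → B} (hz : language z = imageLanguage (elemLeft c) y) (v : List B) :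
    biExt z (v.flatMap (elemLeft c) ++ [c]) = biExt y v := by
  ext ⟨a, b⟩
  simp only [biExt, hz, Set.mem_ofPred_eq]
  constructor
  · rintro ⟨t, ht, h⟩
    rw [List.append_assoc] at h
    exact language_of_infix (infix_of_flatMap_elemLeft h) ht
  · exact mem_imageLanguage_elemLeft

/-- The letter `d` is always surrounded by `c` in the image, so that the words that start or end
with `d` have a single left or right extension. The others are empty or of the form `L(v) c`. -/
theorem IsDendric.of_elemLeft {d : B} (hcd : ∀ e, e = c ∨ e = d) (hne : c ≠ d) {y z : ℤ → B}
    (hy : IsDendric y) (hys : Function.Surjective y)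
    (hz : language z = imageLanguage (elemLeft c) y) : IsDendric z := by
  have hdd : ∀ w, [d, d] <:+: w → w ∉ language z := by
    intro w hw hwz
    rw [hz] at hwz
    obtain ⟨t, -, ht⟩ := hwz
    rcases mem_or_of_pair_infix_flatMap_elemLeft (hw.trans ht) with h | h <;> exact hne h.symm
  intro w hw
  by_cases h1 : [d] <+: w
  · -- only `c` precedes `d`
    obtain ⟨t, rfl⟩ := h1
    have hleft : ∀ a b, (a, b) ∈ biExt z ([d] ++ t) → a = c := fun a b h =>
      (hcd a).resolve_right fun had => hdd _ ⟨[], t ++ [b], by simp [had]⟩ h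
    obtain ⟨a, ha⟩ := exists_extension_left hw
    obtain ⟨b, hb⟩ := mem_leftExt_iff.1 ha
    obtain rfl := hleft a b hb
    exact extensionGraph_isTree_of_doubleStar hb fun p hp => Or.inl (hleft p.1 p.2 hp)
  by_cases h2 : [d] <:+ w
  · obtain ⟨t, rfl⟩ := h2
    have hright : ∀ a b, (a, b) ∈ biExt z (t ++ [d]) → b = c := fun a b h =>
      (hcd b).resolve_right fun hbd => hdd _ ⟨a :: t, [], by simp [hbd]⟩ h
    obtain ⟨b, hb⟩ := exists_extension_right hw
    obtain ⟨a, ha⟩ := mem_rightExt_iff.1 hb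
    obtain rfl := hright a b ha
    exact extensionGraph_isTree_of_doubleStar ha fun p hp => Or.inr (hright p.1 p.2 hp)
  rcases List.eq_nil_or_concat' w with rfl | ⟨t, e, rfl⟩
  · refine extensionGraph_isTree_of_doubleStar (a := c) (b := c) ?_ ?_
    · obtain ⟨i, hi⟩ := hys c
      obtain ⟨e, he⟩ := exists_extension_right (singleton_mem_language y i)
      obtain ⟨t, ht⟩ := exists_elemLeft_eq_cons c e
      simp only [biExt, hz]
      exact ⟨_, he, [], t, by simp [hi, elemLeft_self, ht]⟩
    · rintro ⟨a, b⟩ h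
      by_contra hab
      push Not at hab
      refine hdd _ ⟨[], [], ?_⟩ h
      rw [(hcd a).resolve_left hab.1, (hcd b).resolve_left hab.2]
      rfl
  · -- otherwise the word is `L(v) c`, where `L` is the substitution
    obtain rfl : e = c := (hcd e).resolve_right fun h => h2 ⟨t, by rw [h]⟩
    obtain ⟨v, rfl⟩ := exists_flatMap_elemLeft hcd hne t
      (fun h => h1 (h.trans (List.prefix_append _ _)))
      fun h => hdd _ (h.trans (List.prefix_append _ _).isInfix) hw
    have hb := biExt_elemLeft hz v
    obtain ⟨a, ha⟩ := exists_extension_left hw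
    obtain ⟨b, hab⟩ := mem_leftExt_iff.1 ha
    rw [hb] at hab
    refine (extensionGraph_isTree_iff (Equiv.refl B) fun a b => ?_).1
      (hy v (language_of_infix ⟨[a], [b], by simp⟩ hab))
    rw [hb]
    rfl

theorem IsImage.surjective_of_elemLeft {y z : ℤ → B} (h : IsImage (elemLeft c) y z)
    (hy : Function.Surjective y) : Function.Surjective z := by
  intro b
  obtain ⟨i, rfl⟩ := hy b
  obtain ⟨t, ht⟩ := exists_elemLeft_eq_append c (y i)
  have h2 : [y i] ∈ language z := by
    rw [h.language_eq (elemLeft_ne_nil c)]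
    exact ⟨_, singleton_mem_language y i, t, [], by simp [ht]⟩
  obtain ⟨j, hj⟩ := mem_language_iff.1 h2
  exact ⟨j, by simpa using hj⟩

theorem surjective_of_language_eq {x y : ℤ → B} (h : language x = language y)
    (hx : Function.Surjective x) : Function.Surjective y := by
  intro b
  obtain ⟨i, rfl⟩ := hx b
  obtain ⟨j, hj⟩ := mem_language_iff.1 (h ▸ singleton_mem_language x i)
  exact ⟨j, by simpa using hj⟩

theorem IsElementaryProduct.ne_nil {u : A → List B} (h : IsElementaryProduct u) (a : A) :
    u a ≠ [] := by
  induction h with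
  | coding f hf => simp
  | left c h ih => exact fun h' => elemLeft_ne_nil _ _ (List.flatMap_eq_nil_iff.1 h' _
      (List.getLast_mem ih))
  | right c h ih => exact fun h' => elemRight_ne_nil _ _ (List.flatMap_eq_nil_iff.1 h' _
      (List.getLast_mem ih))

theorem IsImage.apply_eq_of_coding {f : A → B} {x : ℤ → A} {y : ℤ → B}
    (h : IsImage (fun a => [f a]) x y) : y = fun n => f (x n) := by
  refine IsImage.unique (u := fun a => [f a]) (by simp) h ⟨id, rfl, ?_, ?_⟩ <;> simp

theorem IsElementaryProduct.isDendric [Fintype A] [Fintype B] (hA : Fintype.card A = 2)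
    (hB : Fintype.card B = 2) {u : A → List B} (h : IsElementaryProduct u) {x : ℤ → A} {y : ℤ → B}
    (hxy : IsImage u x y) (hx : Function.Surjective x) (hxd : IsDendric x) :
    Function.Surjective y ∧ IsDendric y := by
  induction h generalizing y with
  | coding f hf =>
    obtain rfl := hxy.apply_eq_of_coding
    have hfb := (Fintype.bijective_iff_injective_and_card f).2 ⟨hf, hA.trans hB.symm⟩
    refine ⟨hfb.2.comp hx, fun w hw => ?_⟩
    obtain ⟨v, rfl⟩ : ∃ v : List A, w = v.map f := by
      obtain ⟨i, n, rfl⟩ := hw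
      exact ⟨window x i n, by simp [window, List.map_ofFn, Function.comp_def]⟩
    have hmem : ∀ w : List A, w.map f ∈ language (fun n => f (x n)) ↔ w ∈ language x := by
      intro w
      rw [mem_language_iff, mem_language_iff]
      refine exists_congr fun i => ?_
      rw [List.length_map, ← (List.map_injective_iff.2 hf).eq_iff (b := w)]
      simp [window, List.map_ofFn, Function.comp_def]
    refine (extensionGraph_isTree_iff (Equiv.ofBijective f hfb) fun a b => ?_).1
      (hxd v ((hmem v).1 hw))
    have := hmem (a :: (v ++ [b]))
    simp only [List.map_cons, List.map_append, List.map_nil] at this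
    exact this.symm
  | left c h ih =>
    obtain ⟨y', hy'⟩ := exists_isImage h.ne_nil x
    obtain ⟨h1, h2⟩ := ih hy'
    obtain ⟨z, hz⟩ := exists_isImage (elemLeft_ne_nil c) y'
    obtain rfl := IsImage.unique (h.left c).ne_nil (hy'.comp hz) hxy
    obtain ⟨d, hd⟩ : ∃ d, c ≠ d := by
      obtain ⟨a, b, hab, h⟩ := exists_two_letters hB
      rcases h c with rfl | rfl
      · exact ⟨b, hab⟩
      · exact ⟨a, hab.symm⟩
    exact ⟨hz.surjective_of_elemLeft h1, h2.of_elemLeft (eq_or_eq_of_card_eq_two hB hd) hd h1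
      (hz.language_eq (elemLeft_ne_nil c))⟩
  | @right c u h ih =>
    -- the two elementary substitutions are conjugate, so that the images have the same factors
    obtain ⟨y', hy'⟩ := exists_isImage h.ne_nil x
    obtain ⟨h1, h2⟩ := ih hy'
    obtain ⟨z, hz⟩ := exists_isImage (elemLeft_ne_nil c) y'
    obtain ⟨d, hd⟩ : ∃ d, c ≠ d := by
      obtain ⟨a, b, hab, h⟩ := exists_two_letters hB
      rcases h c with rfl | rfl
      · exact ⟨b, hab⟩
      · exact ⟨a, hab.symm⟩
    have hlang : language z = language y := by
      rw [(hy'.comp hz).language_eq (h.left c).ne_nil, hxy.language_eq (h.right c).ne_nil,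
        imageLanguage_elemRight h.ne_nil]
    exact ⟨surjective_of_language_eq hlang (hz.surjective_of_elemLeft h1), (isDendric_congr hlang).1
      (h2.of_elemLeft (eq_or_eq_of_card_eq_two hB hd) hd h1
        (hz.language_eq (elemLeft_ne_nil c)))⟩

end DendricElementary

end RIET

/-! ### Words read from the integer parts of an arithmetic progression -/

namespace RIET

open IntervalExchange

section FloorFormula

variable {A : Type*}

/-- The letters of `x` are given by the integer parts of an arithmetic progression: `x n = q` when
`⌊ρ + (n + 1) θ⌋ = ⌊ρ + n θ⌋ + 1`, and `x n = p` when the two integer parts are equal. -/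
structure IsFloorCoding (θ ρ : ℝ) (p q : A) (x : ℤ → A) : Prop where
  irrational : Irrational θ
  pos : 0 < θ
  lt_one : θ < 1
  nonneg : 0 ≤ ρ
  start_lt_one : ρ < 1
  step : ∀ n : ℤ, (x n = p ∧ ⌊ρ + (n + 1) * θ⌋ = ⌊ρ + n * θ⌋) ∨
    (x n = q ∧ ⌊ρ + (n + 1) * θ⌋ = ⌊ρ + n * θ⌋ + 1)

/-- The integer parts increase when the fractional part is at least `1 - θ`. -/
theorem floor_add_eq {θ r : ℝ} (h0 : 0 < θ) (h1 : θ < 1) :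
    (Int.fract r < 1 - θ → ⌊r + θ⌋ = ⌊r⌋) ∧ (1 - θ ≤ Int.fract r → ⌊r + θ⌋ = ⌊r⌋ + 1) := by
  have h2 := Int.floor_add_fract r
  have h3 := Int.fract_nonneg r
  have h4 := Int.fract_lt_one r
  refine ⟨fun h => ?_, fun h => ?_⟩ <;> rw [Int.floor_eq_iff] <;> push_cast <;>
    constructor <;> linarith

theorem fract_lt_iff_floor {θ r : ℝ} (h0 : 0 < θ) (h1 : θ < 1) :
    Int.fract r < 1 - θ ↔ ⌊r + θ⌋ = ⌊r⌋ := by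
  refine ⟨(floor_add_eq h0 h1).1, fun h => ?_⟩
  by_contra hlt
  have := (floor_add_eq h0 h1).2 (not_lt.1 hlt)
  omega

variable {p q : A}

/-- The image of a floor coding under `p ↦ p`, `q ↦ p q`. With `g n = ⌊ρ + n θ⌋`, the number of
letters `q` before position `n` when `n ≥ 0`, the image of the letter `x n` starts at position
`n + g n`. The new angle is the frequency `θ / (1 + θ)` of `q` in the image, and the new integer
part at position `n + g n` is again the number `g n` of letters `q` before it. -/
theorem IsFloorCoding.of_elemLeft_self {θ ρ : ℝ} {x z : ℤ → A} (hpq : p ≠ q)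
    (h : IsFloorCoding θ ρ p q x) (hz : IsImage (elemLeft p) x z) :
    IsFloorCoding (θ / (1 + θ)) (ρ / (1 + θ)) p q z := by
  obtain ⟨hθ, h0, h1, hρ0, hρ1, hstep⟩ := h
  obtain ⟨s, hs0, hs, hzs⟩ := hz
  have h1θ : 0 < 1 + θ := by linarith
  have hmono := cut_strictMono (elemLeft_ne_nil p) hs
  set g : ℤ → ℤ := fun n => ⌊ρ + n * θ⌋ with hg
  set F : ℤ → ℤ := fun m => ⌊ρ / (1 + θ) + m * (θ / (1 + θ))⌋ with hF
  have hp : ∀ n, x n = p → s (n + 1) = s n + 1 ∧ z (s n) = p := fun n hn => by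
    have h2 := hs n
    have h3 := hzs n
    rw [hn, elemLeft_self] at h2 h3
    exact ⟨h2, by simpa using h3⟩
  have hq : ∀ n, x n = q → s (n + 1) = s n + 2 ∧ z (s n) = p ∧ z (s n + 1) = q := fun n hn => by
    have h2 := hs n
    have h3 := hzs n
    rw [hn, elemLeft_of_ne hpq.symm] at h2 h3
    rw [show [p, q].length = 1 + 1 from rfl, window_add, window_one, window_one] at h3
    simp at h3
    exact ⟨h2, h3⟩
  have hsg : ∀ n, s n = n + g n := by
    have hstep' : ∀ n, s (n + 1) - (n + 1 + g (n + 1)) = s n - (n + g n) := fun n => by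
      rcases hstep n with ⟨h2, h3⟩ | ⟨h2, h3⟩
      · have : g (n + 1) = g n := by simp only [hg]; push_cast; exact h3
        have := (hp n h2).1
        omega
      · have : g (n + 1) = g n + 1 := by simp only [hg]; push_cast; exact h3
        have := (hq n h2).1
        omega
    have hg0 : g 0 = 0 := by simp [hg, Int.floor_eq_iff, hρ0, hρ1]
    have : ∀ n, s n - (n + g n) = 0 := fun n => by
      induction n using Int.induction_on with
      | zero => simp [hs0, hg0]
      | succ n ih => rw [hstep', ih]
      | pred n ih => rw [← hstep', sub_add_cancel]; exact ih
    intro n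
    have := this n
    omega
  -- the value of `F` at the integers of the form `n + N`
  have hFeq : ∀ n N k : ℤ, (k : ℝ) * (1 + θ) ≤ ρ + (n + N) * θ →
      ρ + (n + N) * θ < (k + 1) * (1 + θ) → F (n + N) = k := fun n N k h2 h3 => by
    simp only [hF]
    rw [Int.floor_eq_iff, mul_div_assoc', ← add_div, le_div_iff₀ h1θ, div_lt_iff₀ h1θ]
    push_cast
    exact ⟨h2, h3⟩
  have hgle : ∀ n : ℤ, (g n : ℝ) ≤ ρ + n * θ := fun n => Int.floor_le _
  have hglt : ∀ n : ℤ, ρ + n * θ < g n + 1 := fun n => Int.lt_floor_add_one _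
  have hFs : ∀ n, F (s n) = g n := fun n => by
    rw [hsg]
    exact hFeq n (g n) (g n) (by nlinarith [hgle n]) (by nlinarith [hglt n])
  refine ⟨?_, by positivity, by rw [div_lt_one h1θ]; linarith, by positivity,
    by rw [div_lt_one h1θ]; linarith, fun m => ?_⟩
  · rw [show θ / (1 + θ) = ((1 : ℚ) : ℝ) - ((1 : ℚ) + θ)⁻¹ by push_cast; field_simp; ring]
    exact (hθ.ratCast_add 1).inv.ratCast_sub 1
  have hFm : ∀ m : ℤ, ⌊ρ / (1 + θ) + ((m : ℝ) + 1) * (θ / (1 + θ))⌋ = F (m + 1) := fun m => by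
    simp only [hF]; push_cast; rfl
  rw [hFm]
  change (z m = p ∧ F (m + 1) = F m) ∨ (z m = q ∧ F (m + 1) = F m + 1)
  obtain ⟨n, hn1, hn2⟩ := exists_cut_le_lt hmono m
  rcases hstep n with ⟨h2, h3⟩ | ⟨h2, h3⟩
  · obtain ⟨h4, h5⟩ := hp n h2
    have h6 : g (n + 1) = g n := by simp only [hg]; push_cast; exact h3
    obtain rfl : m = s n := by omega
    left
    rw [← h4, hFs, hFs]
    exact ⟨h5, h6⟩
  · obtain ⟨h4, h5, h6⟩ := hq n h2
    have h7 : g (n + 1) = g n + 1 := by simp only [hg]; push_cast; exact h3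
    have h8 : F (s n + 1) = g n := by
      rw [hsg, add_assoc]
      exact hFeq n (g n + 1) (g n) (by push_cast; nlinarith [hgle n])
        (by push_cast; nlinarith [hglt n])
    rcases (show m = s n ∨ m = s n + 1 by omega) with rfl | rfl
    · left
      rw [h8, hFs]
      exact ⟨h5, rfl⟩
    · right
      rw [add_assoc, one_add_one_eq_two, ← h4, hFs, h8]
      exact ⟨h6, h7⟩

/-- The image of a floor coding under `q ↦ q`, `p ↦ q p`. With `g n = ⌊ρ + n θ⌋`, the image of the
letter `x n` starts at position `2 n - g n`, and each of these images contains exactly one `q`, at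
its start. The new angle is the frequency `1 / (2 - θ)` of `q` in the image, and the new integer
part at position `2 n - g n` is the number `n` of letters `q` before it. -/
theorem IsFloorCoding.of_elemLeft_other {θ ρ : ℝ} {x z : ℤ → A} (hpq : p ≠ q)
    (h : IsFloorCoding θ ρ p q x) (hz : IsImage (elemLeft q) x z) :
    IsFloorCoding (1 / (2 - θ)) ((ρ + 1 - θ) / (2 - θ)) p q z := by
  obtain ⟨hθ, h0, h1, hρ0, hρ1, hstep⟩ := h
  obtain ⟨s, hs0, hs, hzs⟩ := hz
  have h2θ : 0 < 2 - θ := by linarith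
  have hmono := cut_strictMono (elemLeft_ne_nil q) hs
  set g : ℤ → ℤ := fun n => ⌊ρ + n * θ⌋ with hg
  set F : ℤ → ℤ := fun m => ⌊(ρ + 1 - θ) / (2 - θ) + m * (1 / (2 - θ))⌋ with hF
  have hq : ∀ n, x n = q → s (n + 1) = s n + 1 ∧ z (s n) = q := fun n hn => by
    have h2 := hs n
    have h3 := hzs n
    rw [hn, elemLeft_self] at h2 h3
    exact ⟨h2, by simpa using h3⟩
  have hp : ∀ n, x n = p → s (n + 1) = s n + 2 ∧ z (s n) = q ∧ z (s n + 1) = p := fun n hn => by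
    have h2 := hs n
    have h3 := hzs n
    rw [hn, elemLeft_of_ne hpq] at h2 h3
    rw [show [q, p].length = 1 + 1 from rfl, window_add, window_one, window_one] at h3
    simp at h3
    exact ⟨h2, h3⟩
  have hsg : ∀ n, s n = 2 * n - g n := by
    have hstep' : ∀ n, s (n + 1) - (2 * (n + 1) - g (n + 1)) = s n - (2 * n - g n) := fun n => by
      rcases hstep n with ⟨h2, h3⟩ | ⟨h2, h3⟩
      · have : g (n + 1) = g n := by simp only [hg]; push_cast; exact h3
        have := (hp n h2).1
        omega
      · have : g (n + 1) = g n + 1 := by simp only [hg]; push_cast; exact h3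
        have := (hq n h2).1
        omega
    have hg0 : g 0 = 0 := by simp [hg, Int.floor_eq_iff, hρ0, hρ1]
    have : ∀ n, s n - (2 * n - g n) = 0 := fun n => by
      induction n using Int.induction_on with
      | zero => simp [hs0, hg0]
      | succ n ih => rw [hstep', ih]
      | pred n ih => rw [← hstep', sub_add_cancel]; exact ih
    intro n
    have := this n
    omega
  -- the value of `F` without division
  have hFeq : ∀ m k : ℤ, (k : ℝ) * (2 - θ) ≤ ρ + 1 - θ + m →
      ρ + 1 - θ + m < (k + 1) * (2 - θ) → F m = k := fun m k h2 h3 => by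
    simp only [hF]
    rw [Int.floor_eq_iff, mul_div_assoc', ← add_div, le_div_iff₀ h2θ, div_lt_iff₀ h2θ, mul_one]
    exact ⟨h2, h3⟩
  have hgle : ∀ n : ℤ, (g n : ℝ) ≤ ρ + n * θ := fun n => Int.floor_le _
  have hglt : ∀ n : ℤ, ρ + n * θ < g n + 1 := fun n => Int.lt_floor_add_one _
  have hFs : ∀ n, F (s n) = n := fun n => by
    rw [hsg]
    exact hFeq _ n (by push_cast; nlinarith [hgle n]) (by push_cast; nlinarith [hglt n])
  refine ⟨?_, by positivity, by rw [div_lt_one h2θ]; linarith,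
    div_nonneg (by linarith) h2θ.le, by rw [div_lt_one h2θ]; linarith, fun m => ?_⟩
  · rw [one_div]
    exact (hθ.ratCast_sub 2).inv
  have hFm : ∀ m : ℤ, ⌊(ρ + 1 - θ) / (2 - θ) + ((m : ℝ) + 1) * (1 / (2 - θ))⌋ = F (m + 1) :=
    fun m => by simp only [hF]; push_cast; rfl
  rw [hFm]
  change (z m = p ∧ F (m + 1) = F m) ∨ (z m = q ∧ F (m + 1) = F m + 1)
  obtain ⟨n, hn1, hn2⟩ := exists_cut_le_lt hmono m
  rcases hstep n with ⟨h2, h3⟩ | ⟨h2, h3⟩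
  · obtain ⟨h4, h5, h6⟩ := hp n h2
    have h8 : F (s n + 1) = n + 1 := by
      rw [hsg]
      exact hFeq _ (n + 1) (by push_cast; nlinarith [hgle n]) (by push_cast; nlinarith [hglt n])
    rcases (show m = s n ∨ m = s n + 1 by omega) with rfl | rfl
    · right
      rw [h8, hFs]
      exact ⟨h5, rfl⟩
    · left
      rw [add_assoc, one_add_one_eq_two, ← h4, hFs, h8]
      exact ⟨h6, rfl⟩
  · obtain ⟨h4, h5⟩ := hq n h2
    obtain rfl : m = s n := by omega
    right
    rw [← h4, hFs, hFs]
    exact ⟨h5, rfl⟩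

end FloorFormula

/-! ### Interval exchanges on two letters -/

section TwoIntervals

variable {A : Type*} [Fintype A] {p q : A}

/-- A floor coding is the coding of the rotation of angle `θ` of two intervals. -/
theorem isRIETCoding_of_isFloorCoding (hpq : p ≠ q) (hA : ∀ r, r = p ∨ r = q) {θ ρ : ℝ} {x : ℤ → A}
    (h : IsFloorCoding θ ρ p q x) : IsRIETCoding x := by
  obtain ⟨hθ, h0, h1, hρ0, hρ1, hstep⟩ := h
  obtain ⟨e, hep, heq⟩ := exists_equiv_of_pair hpq hA
  have hlt : ((1 : ℕ) : ℝ) * θ < 1 := by push_cast; linarith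
  refine ⟨rotation one_pos h0 hlt e, rotation_isRegular hθ, ⟨ρ, hρ0, hρ1⟩, fun n a => ?_⟩
  have hI : ∀ (n : ℤ) (i : Fin (1 + 1)),
      ((rotation one_pos h0 hlt e).T ^ n) ⟨ρ, hρ0, hρ1⟩ ∈ (rotation one_pos h0 hlt e).I (e i) ↔
        rotMark 1 θ i ≤ Int.fract (ρ + n * θ) ∧ Int.fract (ρ + n * θ) < rotMark 1 θ (i + 1) :=
    fun n i => by rw [mem_rotation_I, rotation_zpow]
  have hm0 : rotMark 1 θ 0 = 0 := rotMark_zero one_pos θ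
  have hm1 : rotMark 1 θ 1 = 1 - θ := rotMark_self 1 θ
  have hm2 : rotMark 1 θ (1 + 1) = 1 := rotMark_succ 1 θ
  have hiff := fract_lt_iff_floor (r := ρ + n * θ) h0 h1
  rw [show ρ + n * θ + θ = ρ + (n + 1) * θ by ring] at hiff
  have hf0 := Int.fract_nonneg (ρ + n * θ)
  have hf1 := Int.fract_lt_one (ρ + n * θ)
  have hP := hI n 0
  have hQ := hI n 1
  simp only [hep, heq, Fin.val_zero, Fin.val_one, zero_add, hm0, hm1, hm2, hf0, hf1, true_and,
    and_true] at hP hQ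
  rcases hA a with rfl | rfl
  · rw [hP, hiff]
    rcases hstep n with ⟨h2, h3⟩ | ⟨h2, h3⟩
    · simp [h2, h3]
    · rw [h2, h3]
      simp [hpq.symm]
  · rw [hQ, ← not_lt, hiff]
    rcases hstep n with ⟨h2, h3⟩ | ⟨h2, h3⟩
    · rw [h2, h3]
      simp [hpq]
    · simp [h2, h3]

theorem univ_eq_cons_of_pair (hpq : p ≠ q) (hA : ∀ r, r = p ∨ r = q) :
    (Finset.univ : Finset A) = Finset.cons p {q} (by simpa using hpq) := by
  ext r
  simpa using hA r

theorem leftEnd_of_pair (hpq : p ≠ q) (hA : ∀ r, r = p ∨ r = q) (o : LinearOrder A) (len : A → ℝ)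
    (ho : o.lt p q) : leftEnd o len p = 0 ∧ leftEnd o len q = len p := by
  have h1 : ¬ o.lt q p := fun h => @lt_asymm _ o.toPreorder _ _ ho h
  have h2 : ∀ r, ¬ o.lt r r := fun r => @lt_irrefl _ o.toPreorder r
  constructor
  · rw [leftEnd, Finset.sum_filter, univ_eq_cons_of_pair hpq hA, Finset.sum_cons,
      Finset.sum_singleton, if_neg (h2 p), if_neg h1, add_zero]
  · rw [leftEnd, Finset.sum_filter, univ_eq_cons_of_pair hpq hA, Finset.sum_cons,
      Finset.sum_singleton, if_pos ho, if_neg (h2 q), add_zero]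

/-- A regular exchange of two intervals is the rotation by the length of the second interval, which
is irrational since no point is periodic. -/
theorem IsRIETCoding.exists_isFloorCoding (hA : Fintype.card A = 2) {x : ℤ → A}
    (hx : IsRIETCoding x) :
    ∃ p q : A, p ≠ q ∧ (∀ r, r = p ∨ r = q) ∧ ∃ θ ρ, IsFloorCoding θ ρ p q x := by
  have : Nontrivial A := Fintype.one_lt_card_iff_nontrivial.1 (by omega)
  obtain ⟨D, hD, z, hz⟩ := hx
  -- `p` is the smallest letter
  obtain ⟨p, q, hpq, hpq'⟩ : ∃ p q : A, p ≠ q ∧ D.ord.lt p q := by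
    obtain ⟨p, q, hpq, -⟩ := exists_two_letters hA
    rcases @lt_or_gt_of_ne _ D.ord _ _ hpq with h | h
    · exact ⟨p, q, hpq, h⟩
    · exact ⟨q, p, hpq.symm, h⟩
  have hA' := eq_or_eq_of_card_eq_two hA hpq
  have hsum : D.len p = 1 - D.len q := by
    have := D.len_sum
    rw [univ_eq_cons_of_pair hpq hA', Finset.sum_cons, Finset.sum_singleton] at this
    linarith
  have hp0 := D.len_pos p
  have hq0 := D.len_pos q
  obtain ⟨hep, heq⟩ := leftEnd_of_pair hpq hA' D.ord D.len hpq'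
  have hIp : ∀ z : Set.Ico (0 : ℝ) 1, z ∈ D.I p ↔ (z : ℝ) < 1 - D.len q := fun z => by
    change leftEnd _ _ _ ≤ (z : ℝ) ∧ (z : ℝ) < leftEnd _ _ _ + _ ↔ _
    rw [hep, zero_add, hsum]
    exact and_iff_right z.2.1
  have hIq : ∀ z : Set.Ico (0 : ℝ) 1, z ∈ D.I q ↔ 1 - D.len q ≤ (z : ℝ) := fun z => by
    change leftEnd _ _ _ ≤ (z : ℝ) ∧ (z : ℝ) < leftEnd _ _ _ + _ ↔ _
    rw [heq, hsum, sub_add_cancel]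
    exact and_iff_left z.2.2
  -- the second order is the opposite of the first one: otherwise `T` is the identity
  have hord' : D.ord'.lt q p := by
    rcases @lt_or_gt_of_ne _ D.ord' _ _ hpq with h | h
    · have hep' := (leftEnd_of_pair hpq hA' D.ord' D.len h).1
      refine absurd (Subtype.ext ?_) (hD.pow_apply_ne one_ne_zero (D.leftPoint p))
      rw [pow_one, T_apply D (D.leftPoint_mem_I p), hep, hep']
      ring
    · exact h
  have heq' := leftEnd_of_pair hpq.symm (fun r => (hA' r).symm) D.ord' D.len hord'
  have hT : ∀ z, (D.T z : ℝ) = Int.fract ((z : ℝ) + D.len q) := fun z => by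
    have hz0 := z.2.1
    have hz1 := z.2.2
    symm
    by_cases hz : z ∈ D.I p
    · rw [T_apply D hz, hep, heq'.2, Int.fract_eq_iff]
      rw [hIp] at hz
      exact ⟨by linarith, by linarith, 0, by push_cast; ring⟩
    · have hz' : z ∈ D.I q := by rwa [hIq, ← not_lt, ← hIp]
      rw [T_apply D hz', heq, heq'.1, Int.fract_eq_iff]
      rw [hIq] at hz'
      exact ⟨by linarith, by linarith, 1, by push_cast; linarith⟩
  have hzp := zpow_eq_fract hT
  refine ⟨p, q, hpq, hA', D.len q, z, ?_, hq0, by linarith, z.2.1, z.2.2, fun n => ?_⟩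
  · rintro ⟨r, hr⟩
    refine hD.pow_apply_ne r.den_nz z (Subtype.ext ?_)
    have h1 := hzp r.den z
    rw [zpow_natCast] at h1
    have h2 : ((r.den : ℤ) : ℝ) * D.len q = (r.num : ℝ) := by
      rw [← hr]
      exact_mod_cast Rat.den_mul_eq_num r
    rw [h1, h2, Int.fract_add_intCast, Int.fract_eq_self.2 z.2]
  · have hfl := floor_add_eq (r := z + n * D.len q) hq0 (by linarith)
    rw [show (z : ℝ) + n * D.len q + D.len q = z + (n + 1) * D.len q by ring] at hfl
    rcases hA' (x n) with hx | hx
    · refine Or.inl ⟨hx, hfl.1 ?_⟩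
      have := (hz n p).1 hx
      rwa [hIp, hzp] at this
    · refine Or.inr ⟨hx, hfl.2 ?_⟩
      have := (hz n q).1 hx
      rwa [hIq, hzp] at this

theorem IsRIETCoding.of_elemLeft (hA : Fintype.card A = 2) {c : A} {x z : ℤ → A}
    (hx : IsRIETCoding x) (hz : IsImage (elemLeft c) x z) : IsRIETCoding z := by
  obtain ⟨p, q, hpq, hA', θ, ρ, h⟩ := hx.exists_isFloorCoding hA
  rcases hA' c with rfl | rfl
  · exact isRIETCoding_of_isFloorCoding hpq hA' (h.of_elemLeft_self hpq hz)
  · exact isRIETCoding_of_isFloorCoding hpq hA' (h.of_elemLeft_other hpq hz)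

theorem IsRIETCoding.shift {x : ℤ → A} (hx : IsRIETCoding x) (k : ℤ) :
    IsRIETCoding fun n => x (n + k) := by
  obtain ⟨D, hD, z, hz⟩ := hx
  exact ⟨D, hD, _, D.coding_shift hz k⟩

end TwoIntervals

/-! ### Renaming the letters of an interval exchange -/

section Relabel

variable {A B : Type*} [Fintype A] [Fintype B]

/-- The interval exchange obtained by renaming the letters. -/
noncomputable def IntervalExchange.relabel (D : IntervalExchange A) (e : A ≃ B) :
    IntervalExchange B where
  ord := @LinearOrder.lift' _ _ D.ord e.symm e.symm.injective
  ord' := @LinearOrder.lift' _ _ D.ord' e.symm e.symm.injective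
  len b := D.len (e.symm b)
  len_pos b := D.len_pos _
  len_sum := by rw [Equiv.sum_comp e.symm D.len, D.len_sum]

theorem leftEnd_relabel (o : LinearOrder A) (len : A → ℝ) (e : A ≃ B) (a : A) :
    leftEnd (@LinearOrder.lift' _ _ o e.symm e.symm.injective) (fun b => len (e.symm b)) (e a) =
      leftEnd o len a := by
  let := o
  rw [leftEnd_lift, ← Equiv.sum_comp e, leftEnd, Finset.sum_filter]
  simp only [Equiv.symm_apply_apply]

theorem mem_relabel_I (D : IntervalExchange A) (e : A ≃ B) {a : A} {z : Set.Ico (0 : ℝ) 1} :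
    z ∈ (D.relabel e).I (e a) ↔ z ∈ D.I a := by
  simp only [IntervalExchange.I, IntervalExchange.relabel, leftEnd_relabel, Set.mem_ofPred_eq,
    Equiv.symm_apply_apply]

theorem relabel_T (D : IntervalExchange A) (e : A ≃ B) : (D.relabel e).T = D.T := by
  ext z
  obtain ⟨a, ha⟩ := D.exists_mem_I z
  rw [T_apply _ ha, T_apply _ ((mem_relabel_I D e).2 ha)]
  simp only [IntervalExchange.relabel, leftEnd_relabel]

theorem relabel_leftPoint (D : IntervalExchange A) (e : A ≃ B) (a : A) :
    (D.relabel e).leftPoint (e a) = D.leftPoint a :=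
  Subtype.ext (leftEnd_relabel D.ord D.len e a)

theorem IsRIETCoding.relabel {x : ℤ → A} (hx : IsRIETCoding x) (e : A ≃ B) :
    IsRIETCoding fun n => e (x n) := by
  obtain ⟨D, hD, z, hz⟩ := hx
  refine ⟨D.relabel e, ⟨fun b => ?_, fun b b' => ?_⟩, z, fun n b => ?_⟩
  · obtain ⟨a, rfl⟩ := e.surjective b
    simpa only [IntervalExchange.orbit, relabel_T, relabel_leftPoint] using hD.1 a
  · obtain ⟨a, rfl⟩ := e.surjective b
    obtain ⟨a', rfl⟩ := e.surjective b'
    simpa only [IntervalExchange.orbit, relabel_T, relabel_leftPoint, e.injective.ne_iff]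
      using hD.2 a a'
  · obtain ⟨a, rfl⟩ := e.surjective b
    rw [mem_relabel_I, relabel_T, e.injective.eq_iff]
    exact hz n a

end Relabel

/-! ### The products of elementary substitutions, and the bijective codings -/

section Converse

variable {A B : Type*} [Fintype A] [Fintype B]

theorem IsElementaryProduct.isRIETCoding (hA : Fintype.card A = 2) (hB : Fintype.card B = 2)
    {u : A → List B} (h : IsElementaryProduct u) {x : ℤ → A} {y : ℤ → B} (hxy : IsImage u x y)
    (hx : IsRIETCoding x) : IsRIETCoding y := by
  induction h generalizing y with
  | coding f hf =>
    obtain rfl := hxy.apply_eq_of_coding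
    have hfb := (Fintype.bijective_iff_injective_and_card f).2 ⟨hf, hA.trans hB.symm⟩
    exact hx.relabel (Equiv.ofBijective f hfb)
  | left c h ih =>
    obtain ⟨y', hy'⟩ := exists_isImage h.ne_nil x
    obtain ⟨z, hz⟩ := exists_isImage (elemLeft_ne_nil c) y'
    obtain rfl := IsImage.unique (h.left c).ne_nil (hy'.comp hz) hxy
    exact (ih hy').of_elemLeft hB hz
  | @right c u h ih =>
    obtain ⟨y', hy'⟩ := exists_isImage h.ne_nil x
    obtain ⟨z, hz⟩ := exists_isImage (elemLeft_ne_nil c) y'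
    -- the conjugate substitution produces a shift of the coding
    have hshift := IsImage.conj (P := [c]) (fun a => flatMap_elemRight_conj c (u a))
      (h.left c).ne_nil (hy'.comp hz)
    obtain rfl := IsImage.unique (h.right c).ne_nil hshift hxy
    exact ((ih hy').of_elemLeft hB hz).shift _

theorem IsBijectiveCoding.rietPreserving {σ : FreeMonoid A →* FreeMonoid B} {hσ : NonErasing σ}
    (h : IsBijectiveCoding σ) (hmin : ∀ b : B, ∃ w : FreeMonoid A, b ∈ FreeMonoid.toList (σ w)) :
    RIETPreserving σ hσ := by
  choose f hf using fun a => List.length_eq_one_iff.1 (h.1 a)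
  have hu : letterImage σ = fun a => [f a] := funext hf
  have hinj : Function.Injective f := fun a a' haa => h.2 (FreeMonoid.toList.injective (by
    change letterImage σ a = letterImage σ a'
    rw [hu]
    simp [haa]))
  have hsurj : Function.Surjective f := fun b => by
    obtain ⟨w, hw⟩ := hmin b
    have h1 : b ∈ (FreeMonoid.toList w).flatMap (letterImage σ) := by
      rw [← toList_map]
      exact hw
    rw [hu] at h1
    obtain ⟨a, -, ha⟩ := List.mem_flatMap.1 h1
    exact ⟨a, (List.mem_singleton.1 ha).symm⟩
  intro x hx
  have h2 := biImage_isImage σ hσ x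
  rw [hu] at h2
  rw [h2.apply_eq_of_coding]
  exact hx.relabel (Equiv.ofBijective f ⟨hinj, hsurj⟩)

end Converse

end RIET

theorem mainTheorem4 {A B : Type*} [Fintype A] [Fintype B]
    (hA : 2 ≤ Fintype.card A) (hB : 2 ≤ Fintype.card B)
    (σ : FreeMonoid A →* FreeMonoid B) (hσ : RIET.NonErasing σ)
    (hmin : ∀ b : B, ∃ w : FreeMonoid A, b ∈ FreeMonoid.toList (σ w)) :
    RIET.RIETPreserving σ hσ ↔
      (Fintype.card A = 2 ∧ RIET.IsSturmianMorphism σ hσ) ∨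
        (3 ≤ Fintype.card A ∧ RIET.IsBijectiveCoding σ) := by
  constructor
  · intro h
    rcases (show Fintype.card A = 2 ∨ 3 ≤ Fintype.card A by omega) with h2 | h3
    · obtain ⟨hB2, hu⟩ := h.isElementaryProduct h2 hB
      exact Or.inl ⟨h2, h2, fun x hx hxd =>
        (hu.isDendric h2 hB2 (RIET.biImage_isImage σ hσ x) hx hxd).2⟩
    · have : Nontrivial B := Fintype.one_lt_card_iff_nontrivial.1 (by omega)
      exact Or.inr ⟨h3, h.isBijectiveCoding h3⟩
  · rintro (⟨h2, -, h⟩ | ⟨-, h⟩)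
    · obtain ⟨hB2, hu⟩ := h.isElementaryProduct h2 hB hmin
      exact fun x hx => hu.isRIETCoding h2 hB2 (RIET.biImage_isImage σ hσ x) hx
    · exact h.rietPreserving hmin
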